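/- **Setting.** Let $M$ be a smooth finite-dimensional real manifold (Hausdorff, $\sigma$-compact), $A\to M$ a smooth vector bundle of finite rank, and let $A$ carry a Lie algebroid structure: a Lie bracket $\lfloor\cdot,\cdot\rfloor$ on $\Gamma(A)$ and a bundle map $\delta:A\to TM$ (the anchor) with $\delta_{\lfloor\varepsilon_1,\varepsilon_2\rfloor}=[\delta_{\varepsilon_1},\delta_{\varepsilon_2}]$ and $\lfloor\varepsilon_1,f\varepsilon_2\rfloor=f\lfloor\varepsilon_1,\varepsilon_2\rfloor+(\delta_{\varepsilon_1}f)\varepsilon_2$. Let $\{U_i\}$ be an open cover of $M$. *Cohomology.* $H^1(A,M)=Z^1/B^1$ is the first cohomology of the Čech–Lie algebroid bicomplex of the cover. Here $Z^1$ consists of the pairs $(c_i,c_{ij})$ with $c_i\in\Gamma(U_i,A^*)$, $c_{ij}\in C^\infty(U_i\cap U_j)$ and $$c_i(\lfloor\varepsilon_1,\varepsilon_2\rfloor)=\delta_{\varepsilon_1}c_i(\varepsilon_2)-\delta_{\varepsilon_2}c_i(\varepsilon_1),\qquad \delta_\varepsilon c_{ij}=c_j(\varepsilon)-c_i(\varepsilon),\qquad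 c_{ik}=c_{ij}+c_{jk},$$ and $B^1$ of the pairs $(\delta_\varepsilon f_i,\;f_j-f_i)$ with $f_i\in C^\infty(U_i)$. *Affinizations of $T^*M$.* Let $c_{ij}\in C^\infty(U_i\cap U_j)$ satisfy $c_{ik}=c_{ij}+c_{jk}$, and let $\mathcal L$ be the line bundle with transition functions $\exp c_{ij}$. The symplectic affine bundle $\mathcal R=\mathrm{Conn}(\mathcal L)\to M$ is the bundle whose points over $x$ are families of covectors $p_i\in T_x^*M$ (for $U_i\ni x$) with $p_i=p_j+dc_{ij}$. Its symplectic form is $\langle dp_i\wedge dx\rangle$ over each $U_i$, with Poisson bracket $\{f,f'\}=\sum_a\left(\frac{\partial f}{\partial p_a}\frac{\partial f'}{\partial x^a}-\frac{\partial f}{\partial x^a}\frac{\partial f'}{\partial p_a}\right)$. *Lifts.* Let $\pi:\mathcal R\to M$ be the projection. A lift of the anchor action to Hamiltonian transformations of $\mathcal R$ is a smooth bundle map $\varepsilon\mapsto h_\varepsilon$ from $\pi^*A$ to the trivial line bundle over $\mathcal R$ such that $\{h_\varepsilon,\pi^*f\}=\pi^*(\delta_\varepsilon f)$ for $f\in C^\infty(M)$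 and $\{h_{\varepsilon_1},h_{\varepsilon_2}\}=h_{\lfloor\varepsilon_1,\varepsilon_2\rfloor}$ for $\varepsilon,\varepsilon_1,\varepsilon_2\in\Gamma(A)$. *Equivalence.* A lift $h$ to the $\mathcal R$ of a cocycle $c_{ij}$ and a lift $h'$ to the $\mathcal R'$ of a cocycle $c'_{ij}$ are equivalent if an isomorphism of the line bundles carries one to the other. That is, there are $f_i\in C^\infty(U_i)$ with $c'_{ij}=c_{ij}+f_j-f_i$ such that the map $\varphi:\mathcal R\to\mathcal R'$, $p_i\mapsto p_i-df_i$, satisfies $h'_\varepsilon\circ\varphi=h_\varepsilon$. *Hamiltonian algebroid.* Let $h$ be a lift to $\mathcal R$ and put $A^H=\pi^*A$. A Hamiltonian algebroid structure on $A^H$ is an $\mathbb R$-bilinear bracket $\Gamma(A)\times\Gamma(A^H)\to\Gamma(A^H)$, $(\varepsilon,s)\mapsto\lfloor\varepsilon,s\rfloor_H$, with $$\lfloor\varepsilon_1,\pi^*\varepsilon_2\rfloor_H=\pi^*\lfloor\varepsilon_1,\varepsilon_2\rfloor,\qquad \{h_\varepsilon,h_s\}=h_{\lfloor\varepsilon,s\rfloor_H},\qquad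 \lfloor\varepsilon,fs\rfloor_H=f\lfloor\varepsilon,s\rfloor_H+\{h_\varepsilon,f\}s\quad(f\in C^\infty(\mathcal R)),$$ $$\lfloor\varepsilon_1,\lfloor\varepsilon_2,s\rfloor_H\rfloor_H=\lfloor\lfloor\varepsilon_1,\varepsilon_2\rfloor,s\rfloor_H+\lfloor\varepsilon_2,\lfloor\varepsilon_1,s\rfloor_H\rfloor_H .$$ In particular $A^H$ has the same fibres and the same structure functions as $A$. **Lemma 2.1.** 1. For every cocycle $c_{ij}$ the anchor action of $A$ lifts to Hamiltonian transformations of the corresponding $\mathcal R$. 2. For every lift, $A^H$ carries exactly one Hamiltonian algebroid structure. 3. The Hamiltonians of a lift to the $\mathcal R$ of $c_{ij}$ are linear (affine) in the momenta: there are unique $c_i\in\Gamma(U_i,A^*)$ such that over each $U_i$ $$h_\varepsilon=\langle p_i\,|\,\delta_\varepsilon\rangle+c_i(\varepsilon),$$ and $(c_i,c_{ij})\in Z^1$. In a local frame $e^j$ of $A$ with $b^j=\delta_{e^j}$ this reads $h^j=\langle p\,|\,b^j\rangle+c^j(x)$. 4. Sending a lift to the class of $(c_i,c_{ij})$ is a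 well-defined bijection from the set of equivalence classes of lifts (over all cocycles $c_{ij}$ for the cover) onto $H^1(A,M)$. Moreover, every class in $H^1(A,M)$ is the class of a lift to the $\mathcal R$ of any prescribed cocycle $c_{ij}$. -/

import Mathlib

open scoped Manifold ContDiff Bundle Topology
open Bundle TopologicalSpace

noncomputable section

set_option linter.unusedSectionVars false

namespace HamAlg

section LieAlgebroid

variable (n : ℕ) (M : Type*) [TopologicalSpace M] [ChartedSpace (EuclideanSpace ℝ (Fin n)) M]
  [IsManifold (𝓡 n) ∞ M]
  (F : Type*) [NormedAddCommGroup F] [NormedSpace ℝ F]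
  (A : M → Type*) [TopologicalSpace (TotalSpace F A)] [∀ x, TopologicalSpace (A x)]
  [FiberBundle F A] [∀ x, AddCommGroup (A x)] [∀ x, Module ℝ (A x)] [VectorBundle ℝ F A]

/-- Smooth sections of the vector bundle `A` over the `n`-dimensional manifold `M`. -/
abbrev Sec := Cₛ^∞⟮𝓡 n; F, A⟯

variable {n M F A} in
/-- The product of a smooth function and a smooth section. -/
def fsmul (f : C^∞⟮𝓡 n, M; ℝ⟯) (ε : Sec n M F A) : Sec n M F A :=
  ⟨fun x => f x • ε x, f.contMDiff.smul_section ε.contMDiff⟩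

/-- A Lie algebroid: a vector bundle `A → M`, a Lie bracket on its smooth sections and a smooth
bundle map (the anchor) `A → TM` that carries the bracket to the bracket of vector fields and
satisfies the Leibniz rule. -/
structure LieAlgebroid where
  bracket : Sec n M F A →ₗ[ℝ] Sec n M F A →ₗ[ℝ] Sec n M F A
  bracket_self : ∀ ε, bracket ε ε = 0
  jacobi : ∀ ε₁ ε₂ ε₃, bracket ε₁ (bracket ε₂ ε₃) =
    bracket (bracket ε₁ ε₂) ε₃ + bracket ε₂ (bracket ε₁ ε₃)
  anchor : ∀ x, A x →ₗ[ℝ] TangentSpace (𝓡 n) x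
  anchor_smooth : ∀ ε : Sec n M F A, ContMDiff (𝓡 n) (𝓡 n).tangent ∞
    (fun x => (⟨x, anchor x (ε x)⟩ : TangentBundle (𝓡 n) M))
  anchor_bracket : ∀ (ε₁ ε₂ : Sec n M F A) (x : M), anchor x (bracket ε₁ ε₂ x) =
    VectorField.mlieBracket (𝓡 n) (fun y => anchor y (ε₁ y)) (fun y => anchor y (ε₂ y)) x
  leibniz : ∀ (ε₁ ε₂ : Sec n M F A) (f : C^∞⟮𝓡 n, M; ℝ⟯) (x : M),
    bracket ε₁ (fsmul f ε₂) x =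
      f x • bracket ε₁ ε₂ x + (mvfderiv (𝓡 n) f x (anchor x (ε₁ x))) • ε₂ x

end LieAlgebroid

/-- An open cover of `M` indexed by `ι`. -/
structure OpenCover (M : Type*) [TopologicalSpace M] (ι : Type*) where
  set : ι → Opens M
  covers : ∀ x, ∃ i, x ∈ set i

section Cochains

variable (n : ℕ) {M : Type*} [TopologicalSpace M] [ChartedSpace (EuclideanSpace ℝ (Fin n)) M]
  [IsManifold (𝓡 n) ∞ M]

/-- `C^∞(U)`; a function on the open set `U` is represented by its extension by zero. -/
def funOn (U : Opens M) : Submodule ℝ (M → ℝ) where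
  carrier := {f | ContMDiffOn (𝓡 n) 𝓘(ℝ) ∞ f U ∧ ∀ x ∉ U, f x = 0}
  zero_mem' := ⟨contMDiffOn_const, fun _ _ => rfl⟩
  add_mem' := fun ha hb => ⟨ha.1.add hb.1, fun x hx => by simp [ha.2 x hx, hb.2 x hx]⟩
  smul_mem' := fun t f hf =>
    ⟨(contDiff_const_smul t).contMDiff.comp_contMDiffOn hf.1, fun x hx => by simp [hf.2 x hx]⟩

variable (F : Type*) [NormedAddCommGroup F] [NormedSpace ℝ F]
  (A : M → Type*) [TopologicalSpace (TotalSpace F A)] [∀ x, TopologicalSpace (A x)]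
  [FiberBundle F A] [∀ x, AddCommGroup (A x)] [∀ x, Module ℝ (A x)] [VectorBundle ℝ F A]

/-- `Γ(U, A*)`, the smooth sections over the open set `U` of the bundle dual to `A`, again
extended by zero: families of linear forms on the fibres of `A`, smooth on smooth sections. -/
def formOn (U : Opens M) : Submodule ℝ (∀ x, A x → ℝ) where
  carrier := {c | (∀ x, IsLinearMap ℝ (c x)) ∧
    (∀ ε : Sec n M F A, ContMDiffOn (𝓡 n) 𝓘(ℝ) ∞ (fun x => c x (ε x)) U) ∧
    ∀ x ∉ U, c x = 0}
  zero_mem' := ⟨fun _ => ⟨by simp, by simp⟩, fun _ => contMDiffOn_const, fun _ _ => rfl⟩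
  add_mem' := fun ha hb =>
    ⟨fun x => ⟨fun u v => by simp [(ha.1 x).map_add, (hb.1 x).map_add]; ring,
      fun t u => by simp [(ha.1 x).map_smul, (hb.1 x).map_smul]; ring⟩,
      fun ε => (ha.2.1 ε).add (hb.2.1 ε), fun x hx => by simp [ha.2.2 x hx, hb.2.2 x hx]⟩
  smul_mem' := fun t f hf =>
    ⟨fun x => ⟨fun u v => by simp [(hf.1 x).map_add]; ring,
      fun t u => by simp [(hf.1 x).map_smul]; ring⟩,
      fun ε => (contDiff_const_smul t).contMDiff.comp_contMDiffOn (hf.2.1 ε),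
      fun x hx => by simp [hf.2.2 x hx]⟩

variable {ι : Type*} (𝒰 : OpenCover M ι)

/-- The Čech–Lie algebroid cochains of total degree zero: `⨁ Γ(U_i, Λ⁰A*)`. -/
abbrev C0 := ∀ i, funOn n (𝒰.set i)

/-- The Čech–Lie algebroid cochains of total degree one:
`⨁ Γ(U_i, Λ¹A*) ⊕ ⨁ Γ(U_i ∩ U_j, Λ⁰A*)`. -/
abbrev C1 := (∀ i, formOn n F A (𝒰.set i)) × (∀ i j, funOn n (𝒰.set i ⊓ 𝒰.set j))

variable {n F A} (L : LieAlgebroid n M F A)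

theorem mdiffAt_of_funOn {U : Opens M} (f : funOn n U) {x : M} (hx : x ∈ U) :
    MDifferentiableAt (𝓡 n) 𝓘(ℝ) (f : M → ℝ) x :=
  ((f.2.1 x hx).contMDiffAt (U.isOpen.mem_nhds hx)).mdifferentiableAt (by simp)

theorem mvfderiv_constSmul {g : M → ℝ} {x : M} (hg : MDifferentiableAt (𝓡 n) 𝓘(ℝ) g x) (t : ℝ) :
    mvfderiv (𝓡 n) (t • g) x = t • mvfderiv (𝓡 n) g x := by
  simp only [mvfderiv, const_smul_mfderiv hg t]
  rfl

/-- One-cocycles: pairs `(c_i, c_ij)` with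
`c_i(⌊ε₁, ε₂⌋) = δ_{ε₁} c_i(ε₂) - δ_{ε₂} c_i(ε₁)`, `δ_ε c_ij = c_j(ε) - c_i(ε)` and
`c_ik = c_ij + c_jk`. -/
def Z1 : Submodule ℝ (C1 n F A 𝒰) where
  carrier := {z |
    (∀ i, ∀ x ∈ 𝒰.set i, ∀ ε₁ ε₂ : Sec n M F A,
      (z.1 i).1 x (L.bracket ε₁ ε₂ x) =
        mvfderiv (𝓡 n) (fun y => (z.1 i).1 y (ε₂ y)) x (L.anchor x (ε₁ x)) -
        mvfderiv (𝓡 n) (fun y => (z.1 i).1 y (ε₁ y)) x (L.anchor x (ε₂ x))) ∧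
    (∀ i j, ∀ x ∈ 𝒰.set i ⊓ 𝒰.set j, ∀ a : A x,
      mvfderiv (𝓡 n) (z.2 i j).1 x (L.anchor x a) = (z.1 j).1 x a - (z.1 i).1 x a) ∧
    (∀ i j k, ∀ x ∈ 𝒰.set i ⊓ 𝒰.set j ⊓ 𝒰.set k,
      (z.2 i k).1 x = (z.2 i j).1 x + (z.2 j k).1 x)}
  zero_mem' := by
    refine ⟨fun i x hx ε₁ ε₂ => ?_, fun i j x hx a => ?_, fun i j k x hx => ?_⟩
    · simp [mvfderiv_const]
    · have : mvfderiv (𝓡 n) (0 : M → ℝ) x = 0 := mvfderiv_const (0 : ℝ)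
      simp [this]
    · simp
  add_mem' := by
    rintro z w ⟨hz1, hz2, hz3⟩ ⟨hw1, hw2, hw3⟩
    refine ⟨fun i x hx ε₁ ε₂ => ?_, fun i j x hx a => ?_, fun i j k x hx => ?_⟩
    · have key : ∀ ε : Sec n M F A,
          mvfderiv (𝓡 n) (fun y => ((z + w).1 i).1 y (ε y)) x =
          mvfderiv (𝓡 n) (fun y => (z.1 i).1 y (ε y)) x +
            mvfderiv (𝓡 n) (fun y => (w.1 i).1 y (ε y)) x := fun ε =>
        mvfderiv_add (g := fun y => (z.1 i).1 y (ε y)) (g' := fun y => (w.1 i).1 y (ε y))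
          ((((z.1 i).2.2.1 ε x hx).contMDiffAt
            ((𝒰.set i).isOpen.mem_nhds hx)).mdifferentiableAt (by simp))
          ((((w.1 i).2.2.1 ε x hx).contMDiffAt
            ((𝒰.set i).isOpen.mem_nhds hx)).mdifferentiableAt (by simp))
      rw [key, key]
      have h1 := hz1 i x hx ε₁ ε₂
      have h2 := hw1 i x hx ε₁ ε₂
      simp only [Prod.fst_add, Pi.add_apply, Submodule.coe_add, add_apply]
      rw [h1, h2]; ring
    · have key : mvfderiv (𝓡 n) ((z + w).2 i j).1 x =
          mvfderiv (𝓡 n) (z.2 i j).1 x + mvfderiv (𝓡 n) (w.2 i j).1 x :=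
        mvfderiv_add (mdiffAt_of_funOn (z.2 i j) hx) (mdiffAt_of_funOn (w.2 i j) hx)
      rw [key, add_apply, hz2 i j x hx a, hw2 i j x hx a]
      simp only [Prod.fst_add, Pi.add_apply, Submodule.coe_add]
      ring
    · have h1 := hz3 i j k x hx
      have h2 := hw3 i j k x hx
      simp only [Prod.snd_add, Pi.add_apply, Submodule.coe_add]
      rw [h1, h2]; ring
  smul_mem' := by
    rintro t z ⟨hz1, hz2, hz3⟩
    refine ⟨fun i x hx ε₁ ε₂ => ?_, fun i j x hx a => ?_, fun i j k x hx => ?_⟩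
    · have key : ∀ ε : Sec n M F A,
          mvfderiv (𝓡 n) (fun y => ((t • z).1 i).1 y (ε y)) x =
          t • mvfderiv (𝓡 n) (fun y => (z.1 i).1 y (ε y)) x := fun ε =>
        mvfderiv_constSmul (g := fun y => (z.1 i).1 y (ε y))
          ((((z.1 i).2.2.1 ε x hx).contMDiffAt
            ((𝒰.set i).isOpen.mem_nhds hx)).mdifferentiableAt (by simp)) t
      rw [key, key]
      have h1 := hz1 i x hx ε₁ ε₂
      simp only [Prod.smul_fst, Pi.smul_apply, Submodule.coe_smul, smul_apply, smul_eq_mul]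
      rw [h1]; ring
    · have key : mvfderiv (𝓡 n) ((t • z).2 i j).1 x = t • mvfderiv (𝓡 n) (z.2 i j).1 x :=
        mvfderiv_constSmul (mdiffAt_of_funOn (z.2 i j) hx) t
      rw [key, smul_apply, hz2 i j x hx a]
      simp only [Prod.smul_fst, Pi.smul_apply, Submodule.coe_smul, smul_eq_mul]
      ring
    · have h1 := hz3 i j k x hx
      simp only [Prod.smul_snd, Pi.smul_apply, Submodule.coe_smul, smul_eq_mul]
      rw [h1]; ring

/-- One-coboundaries: the pairs `(δ_ε f_i, f_j - f_i)` for a zero-cochain `(f_i)`. -/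
def B1 : Submodule ℝ (C1 n F A 𝒰) where
  carrier := {z | ∃ f : C0 n 𝒰,
    (∀ i, ∀ x ∈ 𝒰.set i, ∀ a : A x,
      (z.1 i).1 x a = mvfderiv (𝓡 n) (f i).1 x (L.anchor x a)) ∧
    (∀ i j, ∀ x ∈ 𝒰.set i ⊓ 𝒰.set j, (z.2 i j).1 x = (f j).1 x - (f i).1 x)}
  zero_mem' := by
    refine ⟨0, fun i x hx a => ?_, fun i j x hx => ?_⟩
    · have : mvfderiv (𝓡 n) (0 : M → ℝ) x = 0 := mvfderiv_const (0 : ℝ)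
      simp [this]
    · simp
  add_mem' := by
    rintro z w ⟨f, hf1, hf2⟩ ⟨g, hg1, hg2⟩
    refine ⟨f + g, fun i x hx a => ?_, fun i j x hx => ?_⟩
    · have key : mvfderiv (𝓡 n) ((f + g) i).1 x =
          mvfderiv (𝓡 n) (f i).1 x + mvfderiv (𝓡 n) (g i).1 x :=
        mvfderiv_add (mdiffAt_of_funOn (f i) hx) (mdiffAt_of_funOn (g i) hx)
      rw [key, add_apply, ← hf1 i x hx a, ← hg1 i x hx a]
      rfl
    · have h1 := hf2 i j x hx
      have h2 := hg2 i j x hx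
      simp only [Prod.snd_add, Pi.add_apply, Submodule.coe_add]
      rw [h1, h2]; ring
  smul_mem' := by
    rintro t z ⟨f, hf1, hf2⟩
    refine ⟨t • f, fun i x hx a => ?_, fun i j x hx => ?_⟩
    · have key : mvfderiv (𝓡 n) ((t • f) i).1 x = t • mvfderiv (𝓡 n) (f i).1 x :=
        mvfderiv_constSmul (mdiffAt_of_funOn (f i) hx) t
      rw [key, smul_apply, ← hf1 i x hx a]
      rfl
    · have h1 := hf2 i j x hx
      simp only [Prod.smul_snd, Pi.smul_apply, Submodule.coe_smul, smul_eq_mul]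
      rw [h1]; ring

/-- The first cohomology group of the Čech–Lie algebroid bicomplex of `L` for the cover `𝒰`:
one-cocycles modulo one-coboundaries. -/
abbrev H1 := Z1 𝒰 L ⧸ ((B1 𝒰 L).submoduleOf (Z1 𝒰 L)).toAddSubgroup

end Cochains

section Affinization

variable {n : ℕ} {M : Type*} [TopologicalSpace M] [ChartedSpace (EuclideanSpace ℝ (Fin n)) M]
  [IsManifold (𝓡 n) ∞ M] {ι : Type*}

/-- The data of a line bundle over `M` trivialized over the cover: smooth functions `c_ij` on
`U_i ∩ U_j` with `c_ik = c_ij + c_jk`. The transition functions of the bundle are `exp c_ij`, that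
is, a section is a family of functions `ψ_i` on `U_i` with `ψ_j = exp(c_ij) ψ_i`. -/
structure LineCocycle (n : ℕ) {M : Type*} [TopologicalSpace M]
    [ChartedSpace (EuclideanSpace ℝ (Fin n)) M] [IsManifold (𝓡 n) ∞ M] {ι : Type*}
    (𝒰 : OpenCover M ι) where
  c : ∀ i j, funOn n (𝒰.set i ⊓ 𝒰.set j)
  cocycle : ∀ i j k, ∀ x ∈ 𝒰.set i ⊓ 𝒰.set j ⊓ 𝒰.set k, (c i k).1 x = (c i j).1 x + (c j k).1 x

variable {𝒰 : OpenCover M ι}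

/-- The affinization `R → M` of `T*M` given by the connections of a line bundle. A point over
`x = base` is a connection at `x`; in the trivialization over `U_i ∋ x` it reads
`∇ = d + p_i` with a covector `p_i = mom i`, and `p_i = p_j + dc_ij`. -/
@[ext]
structure Aff (g : LineCocycle n 𝒰) where
  base : M
  mom : ∀ i, base ∈ 𝒰.set i → (TangentSpace (𝓡 n) base →L[ℝ] ℝ)
  glue : ∀ i j (hi : base ∈ 𝒰.set i) (hj : base ∈ 𝒰.set j),
    mom i hi = mom j hj + mvfderiv (𝓡 n) (g.c i j).1 base

namespace Aff

variable {g : LineCocycle n 𝒰}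

/-- The action of the covectors at the base point on the fibre of `R`. -/
def shift (r : Aff g) (ξ : TangentSpace (𝓡 n) r.base →L[ℝ] ℝ) : Aff g where
  base := r.base
  mom i hi := r.mom i hi + ξ
  glue i j hi hj := by rw [r.glue i j hi hj]; abel

/-- Every fibre of `R` is a principal homogeneous space of the cotangent space. -/
theorem existsUnique_shift (x : M)
    (m m' : ∀ i, x ∈ 𝒰.set i → (TangentSpace (𝓡 n) x →L[ℝ] ℝ)) (h h') :
    ∃! ξ, shift (⟨x, m, h⟩ : Aff g) ξ = ⟨x, m', h'⟩ := by
  obtain ⟨i, hi⟩ := 𝒰.covers x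
  refine ⟨m' i hi - m i hi, ?_, ?_⟩
  · have : (fun j hj => m j hj + (m' i hi - m i hi)) = m' := by
      funext j hj
      rw [h j i hj hi, h' j i hj hi]; abel
    simp only [shift]
    congr
  · intro ξ hξ
    simp only [shift, mk.injEq, heq_eq_eq, true_and] at hξ
    rw [← hξ]; simp

theorem covec_cancel {x : M} (p d : TangentSpace (𝓡 n) x →L[ℝ] ℝ) : p + d - d = p := by
  abel

theorem mvfderiv_cocycle (g : LineCocycle n 𝒰) (i j k : ι) {x : M} (hi : x ∈ 𝒰.set i)
    (hj : x ∈ 𝒰.set j) (hk : x ∈ 𝒰.set k) :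
    mvfderiv (𝓡 n) (g.c i k).1 x =
      mvfderiv (𝓡 n) (g.c i j).1 x + mvfderiv (𝓡 n) (g.c j k).1 x := by
  rw [← mvfderiv_add (mdiffAt_of_funOn (g.c i j) ⟨hi, hj⟩) (mdiffAt_of_funOn (g.c j k) ⟨hj, hk⟩)]
  have : (g.c i k).1 =ᶠ[𝓝 x] (g.c i j).1 + (g.c j k).1 := by
    filter_upwards [(𝒰.set i ⊓ 𝒰.set j ⊓ 𝒰.set k).isOpen.mem_nhds
      (show x ∈ 𝒰.set i ⊓ 𝒰.set j ⊓ 𝒰.set k from ⟨⟨hi, hj⟩, hk⟩)] with y hy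
    exact g.cocycle i j k y hy
  simp only [mvfderiv]
  rw [this.mfderiv_eq]
  have hx : (g.c i k).1 x = ((g.c i j).1 + (g.c j k).1) x := this.self_of_nhds
  rw [hx]

/-- The point of `R` over `x ∈ U_i` whose momentum in the trivialization over `U_i` is `p`. -/
def pt (g : LineCocycle n 𝒰) (i : ι) (x : M) (hi : x ∈ 𝒰.set i)
    (p : TangentSpace (𝓡 n) x →L[ℝ] ℝ) : Aff g where
  base := x
  mom j _ := p + mvfderiv (𝓡 n) (g.c j i).1 x
  glue j k hj hk := by rw [mvfderiv_cocycle g j k i hj hk hi]; abel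

/-- The coordinate space `{(q, η)}` of `R`: positions and momenta. -/
abbrev Phase (n : ℕ) :=
  EuclideanSpace ℝ (Fin n) × (EuclideanSpace ℝ (Fin n) →L[ℝ] ℝ)

/-- The chart of `M` around `x₀` and the trivialization over `U_i` give coordinates `(q, η)` on the
part of `R` over `U_i` and the chart domain; these coordinates range over this set. -/
def dom (𝒰 : OpenCover M ι) (i : ι) (x₀ : M) : Set (Phase n) :=
  {z | z.1 ∈ (extChartAt (𝓡 n) x₀).target ∧ (extChartAt (𝓡 n) x₀).symm z.1 ∈ 𝒰.set i}

/-- The covector at `y` whose components in the chart around `x₀` are `η`. -/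
def covec (x₀ y : M) (η : EuclideanSpace ℝ (Fin n) →L[ℝ] ℝ) : TangentSpace (𝓡 n) y →L[ℝ] ℝ :=
  η ∘L mvfderiv (𝓡 n) (extChartAt (𝓡 n) x₀) y

open Classical in
/-- A function on `R` in the coordinates `(q, η)` (zero outside `dom 𝒰 i x₀`). -/
def loc (i : ι) (x₀ : M) (f : Aff g → ℝ) (z : Phase n) : ℝ :=
  if h : (extChartAt (𝓡 n) x₀).symm z.1 ∈ 𝒰.set i then
    f (pt g i _ h (covec x₀ _ z.2))
  else 0

/-- Smoothness of a function on `R`. -/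
def IsSmooth (f : Aff g → ℝ) : Prop :=
  ∀ i x₀, ContDiffOn ℝ ∞ (loc i x₀ f) (dom 𝒰 i x₀)

/-- The canonical Poisson bracket `∑ₐ (∂f/∂ηₐ ∂f'/∂qₐ - ∂f/∂qₐ ∂f'/∂ηₐ)`, which belongs to the
symplectic form `dη ∧ dq`. -/
def canonicalBracket (f f' : Phase n → ℝ) (z : Phase n) : ℝ :=
  ∑ a, (fderiv ℝ f z (0, EuclideanSpace.proj a) * fderiv ℝ f' z (EuclideanSpace.single a 1, 0) -
    fderiv ℝ f z (EuclideanSpace.single a 1, 0) * fderiv ℝ f' z (0, EuclideanSpace.proj a))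

/-- The Poisson bracket of the symplectic form on `R` that reads `dp_i ∧ dx` in the trivialization
over each `U_i`. It is computed in the chart of `M` around the base point and in some
trivialization; for smooth functions the result does not depend on these choices, since changes of
charts of `M` and the shifts `p ↦ p + dc_ij` are canonical transformations. -/
def poisson (f f' : Aff g → ℝ) (r : Aff g) : ℝ :=
  let i := (𝒰.covers r.base).choose
  canonicalBracket (loc i r.base f) (loc i r.base f')
    (extChartAt (𝓡 n) r.base r.base,
      r.mom i (𝒰.covers r.base).choose_spec ∘L
        (mvfderiv (𝓡 n) (extChartAt (𝓡 n) r.base) r.base).inverse)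

/-- An isomorphism of line bundles given by multiplication by `exp f_i` over `U_i`, from the bundle
with cocycle `c_ij` to the bundle with cocycle `c'_ij = c_ij + f_j - f_i`, acts on connections:
`p_i ↦ p_i - df_i`. -/
def gauge {g g' : LineCocycle n 𝒰} (f : C0 n 𝒰)
    (H : ∀ i j, ∀ x ∈ 𝒰.set i ⊓ 𝒰.set j,
      (g'.c i j).1 x = (g.c i j).1 x + ((f j).1 x - (f i).1 x))
    (r : Aff g) : Aff g' where
  base := r.base
  mom i hi := r.mom i hi - mvfderiv (𝓡 n) (f i).1 r.base
  glue i j hi hj := by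
    have hg : (g'.c i j).1 =ᶠ[𝓝 r.base] (g.c i j).1 + ((f j).1 - (f i).1) := by
      filter_upwards [(𝒰.set i ⊓ 𝒰.set j).isOpen.mem_nhds
        (show r.base ∈ 𝒰.set i ⊓ 𝒰.set j from ⟨hi, hj⟩)] with y hy
      exact H i j y hy
    have hd : mvfderiv (𝓡 n) (g'.c i j).1 r.base =
        mvfderiv (𝓡 n) (g.c i j).1 r.base +
          (mvfderiv (𝓡 n) (f j).1 r.base - mvfderiv (𝓡 n) (f i).1 r.base) := by
      rw [← mvfderiv_sub (mdiffAt_of_funOn (f j) hj) (mdiffAt_of_funOn (f i) hi),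
        ← mvfderiv_add (mdiffAt_of_funOn (g.c i j) ⟨hi, hj⟩)
          ((mdiffAt_of_funOn (f j) hj).sub (mdiffAt_of_funOn (f i) hi))]
      simp only [mvfderiv]
      rw [hg.mfderiv_eq, hg.self_of_nhds]
    rw [hd, r.glue i j hi hj]; abel

end Aff
end Affinization

section Lifts

variable {n : ℕ} {M : Type*} [TopologicalSpace M] [ChartedSpace (EuclideanSpace ℝ (Fin n)) M]
  [IsManifold (𝓡 n) ∞ M]
  {F : Type*} [NormedAddCommGroup F] [NormedSpace ℝ F]
  {A : M → Type*} [TopologicalSpace (TotalSpace F A)] [∀ x, TopologicalSpace (A x)]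
  [FiberBundle F A] [∀ x, AddCommGroup (A x)] [∀ x, Module ℝ (A x)] [VectorBundle ℝ F A]
  {ι : Type*} {𝒰 : OpenCover M ι}

/-- A lift of the anchor action of `L` to Hamiltonian transformations of `R`: a bundle map over `R`
from the pull-back of `A` to the trivial line bundle, hence a `C^∞(R)`-linear map `ε ↦ h_ε` to
smooth functions on `R`, such that the Hamiltonian vector field `{h_ε, ·}` projects to the anchor
vector field `δ_ε` on `M` and `{h_{ε₁}, h_{ε₂}} = h_{⌊ε₁, ε₂⌋}`. -/
structure Lift (L : LieAlgebroid n M F A) (g : LineCocycle n 𝒰) where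
  ham : ∀ r : Aff g, A r.base →ₗ[ℝ] ℝ
  smooth : ∀ ε : Sec n M F A, Aff.IsSmooth fun r => ham r (ε r.base)
  anchor : ∀ (ε : Sec n M F A) (f : C^∞⟮𝓡 n, M; ℝ⟯) (r : Aff g),
    Aff.poisson (fun r => ham r (ε r.base)) (fun r => f r.base) r =
      mvfderiv (𝓡 n) f r.base (L.anchor r.base (ε r.base))
  bracket : ∀ (ε₁ ε₂ : Sec n M F A) (r : Aff g),
    Aff.poisson (fun r => ham r (ε₁ r.base)) (fun r => ham r (ε₂ r.base)) r =
      ham r (L.bracket ε₁ ε₂ r.base)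

/-- Two lifts, to affinizations `R` and `R'`, are equivalent if some isomorphism of the underlying
line bundles carries one to the other. -/
def LiftEquiv (L : LieAlgebroid n M F A) (𝒰 : OpenCover M ι) :
    Setoid (Σ g : LineCocycle n 𝒰, Lift L g) where
  r s t := ∃ (f : C0 n 𝒰) (H : ∀ i j, ∀ x ∈ 𝒰.set i ⊓ 𝒰.set j,
      (t.1.c i j).1 x = (s.1.c i j).1 x + ((f j).1 x - (f i).1 x)),
    ∀ (r : Aff s.1) (a : A r.base), t.2.ham (Aff.gauge f H r) a = s.2.ham r a
  iseqv := by
    have ham_congr : ∀ {g : LineCocycle n 𝒰} (h : Lift L g) (x : M)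
        (m m' : ∀ i, x ∈ 𝒰.set i → (TangentSpace (𝓡 n) x →L[ℝ] ℝ)) (k k') (a : A x),
        m = m' → h.ham ⟨x, m, k⟩ a = h.ham ⟨x, m', k'⟩ a := by
      intro g h x m m' k k' a e
      subst e; rfl
    refine ⟨fun s => ⟨0, by simp, fun r a => ?_⟩, ?_, ?_⟩
    · refine ham_congr s.2 r.base _ _ _ r.glue a ?_
      funext i hi
      have : mvfderiv (𝓡 n) ((0 : C0 n 𝒰) i).1 r.base = 0 := mvfderiv_const (0 : ℝ)
      rw [this, sub_zero]
    · rintro s t ⟨f, H, h⟩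
      refine ⟨-f, fun i j x hx => ?_, fun r a => ?_⟩
      · rw [H i j x hx]; simp; ring
      · refine Eq.trans (h (Aff.gauge (-f) _ r) a).symm ?_
        refine ham_congr t.2 r.base _ _ _ r.glue a ?_
        funext i hi
        have : mvfderiv (𝓡 n) ((-f : C0 n 𝒰) i).1 r.base = -mvfderiv (𝓡 n) (f i).1 r.base :=
          mvfderiv_neg
        simp only [Aff.gauge, this, sub_neg_eq_add]
        exact Aff.covec_cancel _ _
    · rintro s t u ⟨f, H, h⟩ ⟨f', H', h'⟩
      refine ⟨f + f', fun i j x hx => ?_, fun r a => ?_⟩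
      · rw [H' i j x hx, H i j x hx]; simp; ring
      · refine Eq.trans ?_ ((h' (Aff.gauge f H r) a).trans (h r a))
        refine ham_congr u.2 r.base _ _ _ (Aff.gauge f' H' (Aff.gauge f H r)).glue a ?_
        funext i hi
        have : mvfderiv (𝓡 n) ((f + f' : C0 n 𝒰) i).1 r.base =
            mvfderiv (𝓡 n) (f i).1 r.base + mvfderiv (𝓡 n) (f' i).1 r.base :=
          mvfderiv_add (mdiffAt_of_funOn (f i) hi) (mdiffAt_of_funOn (f' i) hi)
        simp only [Aff.gauge, this]
        abel

open Classical in
/-- A section of the pull-back of `A` to `R` in the coordinates `(q, η)` (zero outside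
`dom 𝒰 i x₀`). -/
def locSec {g : LineCocycle n 𝒰} (i : ι) (x₀ : M) (s : ∀ r : Aff g, A r.base) (z : Aff.Phase n) :
    A ((extChartAt (𝓡 n) x₀).symm z.1) :=
  if h : (extChartAt (𝓡 n) x₀).symm z.1 ∈ 𝒰.set i then
    s (Aff.pt g i _ h (Aff.covec x₀ _ z.2))
  else 0

theorem locSec_of_mem {g : LineCocycle n 𝒰} (i : ι) (x₀ : M) (s : ∀ r : Aff g, A r.base)
    (z : Aff.Phase n) (h : (extChartAt (𝓡 n) x₀).symm z.1 ∈ 𝒰.set i)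
    (a : A ((extChartAt (𝓡 n) x₀).symm z.1))
    (ha : s (Aff.pt g i _ h (Aff.covec x₀ _ z.2)) = a) : locSec i x₀ s z = a :=
  (dif_pos h).trans ha

theorem contMDiffOn_along {b : Aff.Phase n → M} {D : Set (Aff.Phase n)}
    {p q w : ∀ z, A (b z)} (φ ψ : Aff.Phase n → ℝ)
    (hφ : ContDiffOn ℝ ∞ φ D) (hψ : ContDiffOn ℝ ∞ ψ D)
    (hp : ContMDiffOn 𝓘(ℝ, Aff.Phase n) ((𝓡 n).prod 𝓘(ℝ, F)) ∞
      (fun z => (⟨b z, p z⟩ : TotalSpace F A)) D)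
    (hq : ContMDiffOn 𝓘(ℝ, Aff.Phase n) ((𝓡 n).prod 𝓘(ℝ, F)) ∞
      (fun z => (⟨b z, q z⟩ : TotalSpace F A)) D)
    (hw : ∀ z ∈ D, w z = φ z • p z + ψ z • q z) :
    ContMDiffOn 𝓘(ℝ, Aff.Phase n) ((𝓡 n).prod 𝓘(ℝ, F)) ∞
      (fun z => (⟨b z, w z⟩ : TotalSpace F A)) D := by
  intro z₀ hz₀
  have hp' := hp z₀ hz₀
  have hq' := hq z₀ hz₀
  rw [contMDiffWithinAt_totalSpace] at hp' hq' ⊢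
  refine ⟨hp'.1, ?_⟩
  have hb : ∀ᶠ z in 𝓝[D] z₀, b z ∈ (trivializationAt F A (b z₀)).baseSet :=
    hp'.1.continuousWithinAt.preimage_mem_nhdsWithin
      ((trivializationAt F A (b z₀)).open_baseSet.mem_nhds
        (mem_baseSet_trivializationAt F A (b z₀)))
  have key : ∀ z ∈ D, b z ∈ (trivializationAt F A (b z₀)).baseSet →
      (trivializationAt F A (b z₀) ⟨b z, w z⟩).2 =
        φ z • (trivializationAt F A (b z₀) ⟨b z, p z⟩).2 +
        ψ z • (trivializationAt F A (b z₀) ⟨b z, q z⟩).2 := by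
    intro z hz hbz
    have hl := (trivializationAt F A (b z₀)).linear ℝ hbz
    rw [hw z hz, hl.map_add, hl.map_smul, hl.map_smul]
  refine ContMDiffWithinAt.congr_of_eventuallyEq
    (((hφ z₀ hz₀).contMDiffWithinAt.smul hp'.2).add ((hψ z₀ hz₀).contMDiffWithinAt.smul hq'.2))
    ?_ (key z₀ hz₀ (mem_baseSet_trivializationAt F A (b z₀)))
  filter_upwards [hb, self_mem_nhdsWithin] with z h1 h2
  exact key z h2 h1

theorem contMDiffOn_base (𝒰 : OpenCover M ι) (i : ι) (x₀ : M) :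
    ContMDiffOn 𝓘(ℝ, Aff.Phase n) (𝓡 n) ∞
      (fun z : Aff.Phase n => (extChartAt (𝓡 n) x₀).symm z.1) (Aff.dom 𝒰 i x₀) :=
  (contMDiffOn_extChartAt_symm x₀).comp contDiff_fst.contMDiff.contMDiffOn fun _ hz => hz.1

variable (F A) in
/-- The bundle `A^H` over `R` is the pull-back of `A`; these are its smooth sections. -/
def HSec (g : LineCocycle n 𝒰) : Submodule ℝ (∀ r : Aff g, A r.base) where
  carrier := {s | ∀ i x₀, ContMDiffOn 𝓘(ℝ, Aff.Phase n) ((𝓡 n).prod 𝓘(ℝ, F)) ∞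
    (fun z => (⟨(extChartAt (𝓡 n) x₀).symm z.1, locSec i x₀ s z⟩ : TotalSpace F A))
    (Aff.dom 𝒰 i x₀)}
  zero_mem' := by
    intro i x₀
    refine ((contMDiff_zeroSection ℝ A).comp_contMDiffOn (contMDiffOn_base 𝒰 i x₀)).congr
      fun z hz => ?_
    rw [locSec_of_mem i x₀ _ z hz.2 0 rfl]
    rfl
  add_mem' := by
    intro s t hs ht i x₀
    refine contMDiffOn_along (fun _ => 1) (fun _ => 1) contDiffOn_const contDiffOn_const
      (hs i x₀) (ht i x₀) fun z hz => ?_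
    rw [one_smul, one_smul, locSec_of_mem i x₀ s z hz.2 _ rfl, locSec_of_mem i x₀ t z hz.2 _ rfl]
    exact locSec_of_mem i x₀ (s + t) z hz.2 _ rfl
  smul_mem' := by
    intro t s hs i x₀
    refine contMDiffOn_along (fun _ => t) (fun _ => 0) contDiffOn_const contDiffOn_const
      (hs i x₀) (hs i x₀) fun z hz => ?_
    rw [zero_smul, add_zero, locSec_of_mem i x₀ s z hz.2 _ rfl]
    exact locSec_of_mem i x₀ (t • s) z hz.2 _ rfl

/-- The pull-back to `R` of a section of `A`. -/
def pull (g : LineCocycle n 𝒰) (ε : Sec n M F A) : HSec F A g :=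
  ⟨fun r => ε r.base, fun i x₀ => by
    refine (ε.contMDiff.comp_contMDiffOn (contMDiffOn_base 𝒰 i x₀)).congr fun z hz => ?_
    rw [locSec_of_mem i x₀ _ z hz.2 (ε ((extChartAt (𝓡 n) x₀).symm z.1)) rfl]
    rfl⟩

/-- The product of a smooth function on `R` and a section of `A^H`. -/
def hsmul {g : LineCocycle n 𝒰} (f : Aff g → ℝ) (hf : Aff.IsSmooth f) (s : HSec F A g) :
    HSec F A g :=
  ⟨fun r => f r • s.1 r, fun i x₀ => by
    refine contMDiffOn_along (Aff.loc i x₀ f) (fun _ => 0) (hf i x₀) contDiffOn_const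
      (s.2 i x₀) (s.2 i x₀) fun z hz => ?_
    rw [zero_smul, add_zero, Aff.loc, dif_pos hz.2, locSec_of_mem i x₀ s.1 z hz.2 _ rfl]
    exact locSec_of_mem i x₀ _ z hz.2 _ rfl⟩

/-- A bracket making the pull-back `A^H` of `A` to `R`, with the bundle map `ε ↦ h_ε`, a Hamiltonian
algebroid: it extends the bracket of `A` (so the structure functions of `A^H` in a local frame of
`A` are those of `A`), carries over to the Poisson bracket of Hamiltonians, satisfies the Leibniz
rule with respect to `C^∞(R)` and the Jacobi identity. The first argument is a section of `A`, the
second an arbitrary section of `A^H`. -/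
structure IsHamiltonianAlgebroid {L : LieAlgebroid n M F A} {g : LineCocycle n 𝒰} (h : Lift L g)
    (B : Sec n M F A →ₗ[ℝ] HSec F A g →ₗ[ℝ] HSec F A g) : Prop where
  pull : ∀ ε₁ ε₂, B ε₁ (pull g ε₂) = pull g (L.bracket ε₁ ε₂)
  ham : ∀ (ε : Sec n M F A) (s : HSec F A g) (r : Aff g),
    Aff.poisson (fun r => h.ham r (ε r.base)) (fun r => h.ham r (s.1 r)) r =
      h.ham r ((B ε s).1 r)
  leibniz : ∀ (ε : Sec n M F A) (f : Aff g → ℝ) (hf : Aff.IsSmooth f) (s : HSec F A g) (r : Aff g),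
    (B ε (hsmul f hf s)).1 r =
      f r • (B ε s).1 r + Aff.poisson (fun r => h.ham r (ε r.base)) f r • s.1 r
  jacobi : ∀ ε₁ ε₂ s, B ε₁ (B ε₂ s) = B (L.bracket ε₁ ε₂) s + B ε₂ (B ε₁ s)

/-- The cocycle `z = (c_i, c_ij)` describes the lift `h`: `c_ij` is the cocycle that glues `R`, and
over `U_i` the Hamiltonians are `h_ε = ⟨p_i | δ_ε⟩ + c_i(ε)`, affine in the momenta. -/
def Describes {L : LieAlgebroid n M F A} {g : LineCocycle n 𝒰} (z : Z1 𝒰 L) (h : Lift L g) :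
    Prop :=
  z.1.2 = g.c ∧ ∀ (i : ι) (r : Aff g) (hi : r.base ∈ 𝒰.set i) (a : A r.base),
    h.ham r a = r.mom i hi (L.anchor r.base a) + (z.1.1 i).1 r.base a

end Lifts
end HamAlg

end

/-! The affinization R is studied in coordinates `(q, η)` given by a chart of M and a trivialization
over some U_i. A change of chart and trivialization alters `η dq` only by an exact form, the
differential of c_ji, so it is symplectic (`symplecticForm_transition`). Hence the Poisson bracket
may be computed in any such coordinates (`Aff.poisson_pt`), and it inherits the Leibniz rule and the
Jacobi identity from phase space.

For functions affine in the momenta, {⟨p|X⟩ + c, ⟨p|Y⟩ + d} = ⟨p|[X,Y]⟩ + X(d) - Y(c)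
(`canonicalBracket_affine`). For h_ε = ⟨p_i|δ_ε⟩ + c_i(ε) the bracket condition of a lift is
therefore the first cocycle equation. Independence of i, given p_i = p_j + dc_ij, is the second. So
a cocycle yields a lift (`liftOf`). Conversely, the anchor condition tested on functions with
arbitrary differential fixes the derivative of h_ε along the fibres of R. Thus h_ε is affine with
linear part ⟨p_i|δ_ε⟩ (`Lift.ham_eq`), and its values at zero momentum form a cocycle
(`Lift.cocycle`).

An isomorphism of line bundles shifts the momenta by -df_i, which changes the cocycle exactly by the
coboundary of f (`liftEquiv_iff`); this is the classification. A partition of unity makes smooth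
Čech cocycles coboundaries (`LineCocycle.exists_eq_sub`), so every class has a representative with
prescribed c_ij. This realizes every class on every R, and in particular shows that lifts exist.

For the Hamiltonian algebroid, sections of A^H are locally finite sums of products f·π*ε. An
additive local operator with the right values on such products is thus unique
(`IsLeibnizAt.unique`), and the formula in a local frame has these values
(`isLeibnizAt_frameBracket`). By uniqueness the frame formulas patch to one bracket. Its remaining
identities are checked on products, where they reduce to those of A and of the Poisson bracket. -/

noncomputable section

set_option linter.unusedSectionVars false

namespace HamAlg

/-! ### Linear symplectic algebra and the canonical bracket on phase space -/

section PhaseSpace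

open Aff

variable {n : ℕ}

/-- The canonical symplectic form `dη ∧ dq`, up to sign, on the coordinate space. -/
def symplecticForm (u z : Phase n) : ℝ := z.2 u.1 - u.2 z.1

/-- The vector dual to a covector of the coordinate space under the canonical symplectic form. -/
def hamVec (α : Phase n →L[ℝ] ℝ) : Phase n :=
  (WithLp.toLp 2 fun a => α (0, EuclideanSpace.proj a),
    -(α ∘L ContinuousLinearMap.inl ℝ (EuclideanSpace ℝ (Fin n)) (EuclideanSpace ℝ (Fin n) →L[ℝ] ℝ)))

theorem symplecticForm_ext {u v : Phase n} (h : ∀ z, symplecticForm u z = symplecticForm v z) :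
    u = v := by
  have h1 : u.1 = v.1 := by
    ext a
    simpa [symplecticForm] using h (0, EuclideanSpace.proj a)
  have h2 : u.2 = v.2 := by
    ext w
    simpa [symplecticForm] using h (w, 0)
  exact Prod.ext h1 h2

theorem eq_sum_proj (ζ : EuclideanSpace ℝ (Fin n) →L[ℝ] ℝ) :
    ζ = ∑ a, ζ (EuclideanSpace.single a 1) •
      (EuclideanSpace.proj a : EuclideanSpace ℝ (Fin n) →L[ℝ] ℝ) := by
  ext v
  have hv : v = ∑ a, v a • EuclideanSpace.single a (1 : ℝ) := by
    ext b
    simp [Finset.sum_apply, Pi.single_apply]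
  conv_lhs => rw [hv]
  simp [mul_comm]

/-- The defining property of a Hamiltonian vector, which fixes the signs in `hamVec`. The position
part of `z` is immediate; the momentum part is expanded in the coordinate covectors. -/
theorem symplecticForm_hamVec (α : Phase n →L[ℝ] ℝ) (z : Phase n) :
    symplecticForm (hamVec α) z = α z := by
  have h : α (0, z.2) = z.2 (hamVec α).1 := by
    conv_lhs => rw [eq_sum_proj z.2]
    conv_rhs => rw [eq_sum_proj z.2]
    have : ((0 : EuclideanSpace ℝ (Fin n)), ∑ a, z.2 (EuclideanSpace.single a 1) •
        (EuclideanSpace.proj a : EuclideanSpace ℝ (Fin n) →L[ℝ] ℝ)) =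
        ∑ a, z.2 (EuclideanSpace.single a 1) •
          ((0 : EuclideanSpace ℝ (Fin n)),
            (EuclideanSpace.proj a : EuclideanSpace ℝ (Fin n) →L[ℝ] ℝ)) := by
      ext <;> simp [Prod.fst_sum, Prod.snd_sum]
    rw [this, map_sum]
    simp only [map_smul]
    simp [hamVec]
  have hz : z = (z.1, 0) + (0, z.2) := by simp
  conv_rhs => rw [hz, map_add, h]
  simp [symplecticForm, hamVec]
  ring

/-- Turns the coordinate sum into a coordinate-free expression, from which additivity, the product
rule, symplectic invariance and the Jacobi identity are derived. -/
theorem canonicalBracket_eq (f f' : Phase n → ℝ) (z : Phase n) :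
    canonicalBracket f f' z = fderiv ℝ f' z (hamVec (fderiv ℝ f z)) := by
  have hsplit : hamVec (fderiv ℝ f z) =
      ∑ a, (fderiv ℝ f z (0, EuclideanSpace.proj a) • ((EuclideanSpace.single a 1, 0) : Phase n) -
        fderiv ℝ f z (EuclideanSpace.single a 1, 0) • ((0, EuclideanSpace.proj a) : Phase n)) := by
    refine Prod.ext ?_ ?_
    · ext b
      simp [hamVec, Prod.fst_sum, Finset.sum_apply, Pi.single_apply]
    · rw [eq_sum_proj (hamVec (fderiv ℝ f z)).2]
      simp [hamVec, Prod.snd_sum]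
  rw [hsplit, map_sum]
  simp only [map_sub, map_smul, smul_eq_mul, canonicalBracket]

theorem canonicalBracket_congr {f f' k k' : Phase n → ℝ} {z : Phase n} (hf : f =ᶠ[𝓝 z] k)
    (hf' : f' =ᶠ[𝓝 z] k') : canonicalBracket f f' z = canonicalBracket k k' z := by
  simp only [canonicalBracket_eq, hf.fderiv_eq, hf'.fderiv_eq]

/-- A linear symplectic map intertwines Hamiltonian vectors. -/
theorem map_hamVec (D : Phase n →L[ℝ] Phase n)
    (hD : ∀ u v, symplecticForm (D u) (D v) = symplecticForm u v) (α : Phase n →L[ℝ] ℝ) :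
    D (hamVec (α ∘L D)) = hamVec α := by
  -- Preserving a nondegenerate form makes `D` injective, hence surjective in finite dimension, so
  -- every test vector is of the form `D w`.
  have hinj : Function.Injective (D : Phase n →ₗ[ℝ] Phase n) := by
    intro u v huv
    refine symplecticForm_ext fun z => ?_
    rw [← hD u z, ← hD v z]
    have : D u = D v := huv
    rw [this]
  have hsurj := LinearMap.injective_iff_surjective.1 hinj
  refine symplecticForm_ext fun z => ?_
  obtain ⟨w, rfl⟩ := hsurj z
  rw [symplecticForm_hamVec]
  exact (hD _ _).trans (symplecticForm_hamVec _ _)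

/-- The chain rule composes both differentials with the derivative of `T`, and a symplectic
derivative matches the corresponding Hamiltonian vectors (`map_hamVec`). -/
theorem canonicalBracket_comp {f f' : Phase n → ℝ} {T : Phase n → Phase n} {z : Phase n}
    (hf : DifferentiableAt ℝ f (T z)) (hf' : DifferentiableAt ℝ f' (T z))
    (hT : DifferentiableAt ℝ T z)
    (hD : ∀ u v, symplecticForm (fderiv ℝ T z u) (fderiv ℝ T z v) = symplecticForm u v) :
    canonicalBracket (f ∘ T) (f' ∘ T) z = canonicalBracket f f' (T z) := by
  rw [canonicalBracket_eq, canonicalBracket_eq, fderiv_comp z hf hT, fderiv_comp z hf' hT,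
    ContinuousLinearMap.comp_apply, map_hamVec _ hD]

/-- A transformation that preserves the form `η dq` up to an exact form is symplectic. -/
theorem symplecticForm_fderiv {T : Phase n → Phase n} {c : EuclideanSpace ℝ (Fin n) → ℝ}
    {z : Phase n} (hT : ContDiffAt ℝ 2 T z) (hc : ContDiffAt ℝ 2 c z.1)
    (h : ∀ᶠ y in 𝓝 z, ∀ v, (T y).2 (fderiv ℝ T y v).1 = y.2 v.1 + fderiv ℝ c y.1 v.1)
    (u v : Phase n) :
    symplecticForm (fderiv ℝ T z u) (fderiv ℝ T z v) = symplecticForm u v := by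
  have hdT : DifferentiableAt ℝ T z := hT.differentiableAt (by simp)
  have hddT : DifferentiableAt ℝ (fderiv ℝ T) z :=
    (hT.fderiv_right (m := 1) (by norm_num)).differentiableAt (by simp)
  have hddc : DifferentiableAt ℝ (fderiv ℝ c) z.1 :=
    (hc.fderiv_right (m := 1) (by norm_num)).differentiableAt (by simp)
  have hsT : ∀ u v, fderiv ℝ (fderiv ℝ T) z u v = fderiv ℝ (fderiv ℝ T) z v u := fun u v =>
    (hT.isSymmSndFDerivAt (by simp)).eq u v
  have hsc : ∀ u v, fderiv ℝ (fderiv ℝ c) z.1 u v = fderiv ℝ (fderiv ℝ c) z.1 v u := fun u v =>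
    (hc.isSymmSndFDerivAt (by simp)).eq u v
  -- The hypothesis differentiated once more, in the direction `u`. Antisymmetrizing in `u` and `v`
  -- removes the second derivatives of `T` and `c`, which are symmetric.
  have key : ∀ u v : Phase n,
      (fderiv ℝ T z u).2 (fderiv ℝ T z v).1 + (T z).2 (fderiv ℝ (fderiv ℝ T) z u v).1 =
        u.2 v.1 + fderiv ℝ (fderiv ℝ c) z.1 u.1 v.1 := by
    intro u v
    have e : (fun y => (T y).2 (fderiv ℝ T y v).1) =ᶠ[𝓝 z]
        fun y => y.2 v.1 + fderiv ℝ c y.1 v.1 := h.mono fun y hy => hy v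
    have h1 : HasFDerivAt (fun y => (T y).2 (fderiv ℝ T y v).1) _ z :=
      (hdT.hasFDerivAt.snd).clm_apply
        ((hddT.hasFDerivAt.clm_apply (hasFDerivAt_const v z)).fst)
    have h2 : HasFDerivAt (fun y : Phase n => y.2 v.1 + fderiv ℝ c y.1 v.1) _ z :=
      (hasFDerivAt_snd.clm_apply (hasFDerivAt_const v.1 z)).add
        ((hddc.hasFDerivAt.comp z hasFDerivAt_fst).clm_apply (hasFDerivAt_const v.1 z))
    have := congrArg (fun l : Phase n →L[ℝ] ℝ => l u)
      ((h1.congr_of_eventuallyEq e.symm).unique h2)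
    simpa [add_comm] using this
  have k1 := key u v
  have k2 := key v u
  rw [hsT v u] at k2
  rw [hsc v.1 u.1] at k2
  simp only [symplecticForm]
  linarith

/-- By the product rule each summand gives four terms; they regroup into two pairings, each with a
single second derivative. This is the form that the Jacobi identity needs. -/
theorem hasFDerivAt_canonicalBracket {f k : Phase n → ℝ} {z : Phase n} (hf : ContDiffAt ℝ 2 f z)
    (hk : ContDiffAt ℝ 2 k z) (w : Phase n) :
    fderiv ℝ (canonicalBracket f k) z w =
      fderiv ℝ (fderiv ℝ k) z w (hamVec (fderiv ℝ f z)) -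
        fderiv ℝ (fderiv ℝ f) z w (hamVec (fderiv ℝ k z)) := by
  have hf' : DifferentiableAt ℝ (fderiv ℝ f) z :=
    (hf.fderiv_right (m := 1) (by norm_num)).differentiableAt (by simp)
  have hk' : DifferentiableAt ℝ (fderiv ℝ k) z :=
    (hk.fderiv_right (m := 1) (by norm_num)).differentiableAt (by simp)
  have happ : ∀ {l : Phase n → ℝ} (_ : DifferentiableAt ℝ (fderiv ℝ l) z) (v : Phase n),
      HasFDerivAt (fun y => fderiv ℝ l y v) ((fderiv ℝ (fderiv ℝ l) z).flip v) z := by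
    intro l hl v
    have := hl.hasFDerivAt.clm_apply (hasFDerivAt_const v z)
    refine this.congr_fderiv ?_
    ext u <;> simp
  have hd : HasFDerivAt (canonicalBracket f k) _ z :=
    HasFDerivAt.fun_sum (u := Finset.univ) fun a _ =>
      ((happ hf' (0, EuclideanSpace.proj a)).mul (happ hk' (EuclideanSpace.single a 1, 0))).sub
        ((happ hf' (EuclideanSpace.single a 1, 0)).mul (happ hk' (0, EuclideanSpace.proj a)))
  rw [hd.fderiv]
  -- For linear functions, which are their own derivatives, `canonicalBracket_eq` is the coordinate
  -- formula of the pairing.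
  have hpair : ∀ α β : Phase n →L[ℝ] ℝ, β (hamVec α) =
      ∑ a, (α (0, EuclideanSpace.proj a) * β (EuclideanSpace.single a 1, 0) -
        α (EuclideanSpace.single a 1, 0) * β (0, EuclideanSpace.proj a)) := by
    intro α β
    have := canonicalBracket_eq (⇑α) (⇑β) z
    simp only [canonicalBracket, α.fderiv, β.fderiv] at this
    exact this.symm
  rw [hpair, hpair, ← Finset.sum_sub_distrib]
  simp only [sum_apply, sub_apply, add_apply, smul_apply, smul_eq_mul,
    ContinuousLinearMap.flip_apply]
  refine Finset.sum_congr rfl fun a _ => ?_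
  ring

theorem hamVec_swap (α β : Phase n →L[ℝ] ℝ) : α (hamVec β) = -β (hamVec α) := by
  rw [← symplecticForm_hamVec α, ← symplecticForm_hamVec β]
  simp only [symplecticForm]
  ring

theorem canonicalBracket_swap (f k : Phase n → ℝ) (z : Phase n) :
    canonicalBracket f k z = -canonicalBracket k f z := by
  rw [canonicalBracket_eq, canonicalBracket_eq, hamVec_swap]

/-- All terms are second derivatives of one function evaluated on the Hamiltonian vectors of the
other two; they cancel by symmetry of second derivatives. -/
theorem canonicalBracket_jacobi {f k l : Phase n → ℝ} {z : Phase n} (hf : ContDiffAt ℝ 2 f z)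
    (hk : ContDiffAt ℝ 2 k z) (hl : ContDiffAt ℝ 2 l z) :
    canonicalBracket f (canonicalBracket k l) z =
      canonicalBracket (canonicalBracket f k) l z +
        canonicalBracket k (canonicalBracket f l) z := by
  rw [canonicalBracket_swap (canonicalBracket f k) l, canonicalBracket_eq, canonicalBracket_eq l,
    canonicalBracket_eq k, hasFDerivAt_canonicalBracket hk hl, hasFDerivAt_canonicalBracket hf hk,
    hasFDerivAt_canonicalBracket hf hl,
    (hf.isSymmSndFDerivAt (by simp)).eq (hamVec (fderiv ℝ k z)),
    (hk.isSymmSndFDerivAt (by simp)).eq (hamVec (fderiv ℝ f z)),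
    (hl.isSymmSndFDerivAt (by simp)).eq (hamVec (fderiv ℝ f z))]
  ring

theorem hasFDerivAt_affine {X : EuclideanSpace ℝ (Fin n) → EuclideanSpace ℝ (Fin n)}
    {c : EuclideanSpace ℝ (Fin n) → ℝ} {z : Phase n} (hX : DifferentiableAt ℝ X z.1)
    (hc : DifferentiableAt ℝ c z.1) :
    HasFDerivAt (fun y : Phase n => y.2 (X y.1) + c y.1)
      ((ContinuousLinearMap.apply ℝ ℝ (X z.1)) ∘L ContinuousLinearMap.snd ℝ _ _ +
        (z.2 ∘L fderiv ℝ X z.1 + fderiv ℝ c z.1) ∘L ContinuousLinearMap.fst ℝ _ _) z := by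
  have h : HasFDerivAt (fun y : Phase n => y.2 (X y.1) + c y.1) _ z :=
    (hasFDerivAt_snd.clm_apply (hX.hasFDerivAt.comp z hasFDerivAt_fst)).add
      (hc.hasFDerivAt.comp z hasFDerivAt_fst)
  refine h.congr_fderiv ?_
  ext v <;> simp

/-- The bracket of functions affine in the momenta. -/
theorem canonicalBracket_affine {X Y : EuclideanSpace ℝ (Fin n) → EuclideanSpace ℝ (Fin n)}
    {c d : EuclideanSpace ℝ (Fin n) → ℝ} {z : Phase n} (hX : DifferentiableAt ℝ X z.1)
    (hc : DifferentiableAt ℝ c z.1) (hY : DifferentiableAt ℝ Y z.1)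
    (hd : DifferentiableAt ℝ d z.1) :
    canonicalBracket (fun y => y.2 (X y.1) + c y.1) (fun y => y.2 (Y y.1) + d y.1) z =
      z.2 (VectorField.lieBracket ℝ X Y z.1) +
        (fderiv ℝ d z.1 (X z.1) - fderiv ℝ c z.1 (Y z.1)) := by
  have hX' : (hamVec (fderiv ℝ (fun y : Phase n => y.2 (X y.1) + c y.1) z)) =
      (X z.1, -(z.2 ∘L fderiv ℝ X z.1 + fderiv ℝ c z.1)) := by
    rw [(hasFDerivAt_affine hX hc).fderiv]
    refine Prod.ext ?_ ?_
    · ext a; simp [hamVec]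
    · ext v; simp [hamVec]
  rw [canonicalBracket_eq, hX', (hasFDerivAt_affine hY hd).fderiv]
  simp [VectorField.lieBracket]
  ring

end PhaseSpace

/-! ### Coordinates on the affinization and invariance of the Poisson bracket -/

section Coordinates

variable {n : ℕ} {M : Type*} [TopologicalSpace M] [ChartedSpace (EuclideanSpace ℝ (Fin n)) M]
  [IsManifold (𝓡 n) ∞ M]

theorem contDiffAt_comp_extChartAt_symm {G : Type*} [NormedAddCommGroup G] [NormedSpace ℝ G]
    {f : M → G} {x₀ : M} {q : EuclideanSpace ℝ (Fin n)} (hq : q ∈ (extChartAt (𝓡 n) x₀).target)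
    (hf : ContMDiffAt (𝓡 n) 𝓘(ℝ, G) ∞ f ((extChartAt (𝓡 n) x₀).symm q)) :
    ContDiffAt ℝ ∞ (f ∘ (extChartAt (𝓡 n) x₀).symm) q := by
  have h := (contMDiffOn_extChartAt_symm (I := 𝓡 n) (n := ∞) x₀).contMDiffAt
    ((isOpen_extChartAt_target x₀).mem_nhds hq)
  exact (hf.comp q h).contDiffAt

theorem contMDiffAt_extChartAt_of_mem {x₀ y : M} (hy : y ∈ (extChartAt (𝓡 n) x₀).source) :
    ContMDiffAt (𝓡 n) 𝓘(ℝ, EuclideanSpace ℝ (Fin n)) ∞ (extChartAt (𝓡 n) x₀) y :=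
  contMDiffAt_extChartAt' (by rwa [extChartAt_source] at hy)

/-- The differential of a function in terms of a chart. -/
theorem mvfderiv_eq_fderiv_comp {G : Type*} [NormedAddCommGroup G] [NormedSpace ℝ G]
    {f : M → G} {x₀ y : M} (hy : y ∈ (extChartAt (𝓡 n) x₀).source)
    (hf : MDifferentiableAt (𝓡 n) 𝓘(ℝ, G) f y) :
    mvfderiv (𝓡 n) f y = fderiv ℝ (f ∘ (extChartAt (𝓡 n) x₀).symm) (extChartAt (𝓡 n) x₀ y) ∘L
      mvfderiv (𝓡 n) (extChartAt (𝓡 n) x₀) y := by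
  have hq := (extChartAt (𝓡 n) x₀).map_source hy
  have hs : MDifferentiableAt 𝓘(ℝ, EuclideanSpace ℝ (Fin n)) (𝓡 n) (extChartAt (𝓡 n) x₀).symm
      (extChartAt (𝓡 n) x₀ y) :=
    ((contMDiffOn_extChartAt_symm (I := 𝓡 n) (n := ∞) x₀).contMDiffAt
      ((isOpen_extChartAt_target x₀).mem_nhds hq)).mdifferentiableAt (by simp)
  have hc := (contMDiffAt_extChartAt_of_mem hy).mdifferentiableAt (by simp)
  have hy' := (extChartAt (𝓡 n) x₀).left_inv hy
  have hfs : MDifferentiableAt 𝓘(ℝ, EuclideanSpace ℝ (Fin n)) 𝓘(ℝ, G)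
      (f ∘ (extChartAt (𝓡 n) x₀).symm) (extChartAt (𝓡 n) x₀ y) :=
    MDifferentiableAt.comp _ (by rwa [hy']) hs
  have he : f =ᶠ[𝓝 y] (f ∘ (extChartAt (𝓡 n) x₀).symm) ∘ extChartAt (𝓡 n) x₀ := by
    filter_upwards [(isOpen_extChartAt_source (I := 𝓡 n) x₀).mem_nhds hy] with w hw
    simp only [Function.comp_apply, (extChartAt (𝓡 n) x₀).left_inv hw]
  have h1 : mfderiv (𝓡 n) 𝓘(ℝ, G) f y =
      mfderiv (𝓡 n) 𝓘(ℝ, G) ((f ∘ (extChartAt (𝓡 n) x₀).symm) ∘ extChartAt (𝓡 n) x₀) y :=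
    he.mfderiv_eq
  rw [mfderiv_comp y hfs hc, mfderiv_eq_fderiv] at h1
  ext v
  exact congrArg (fun l : TangentSpace (𝓡 n) y →L[ℝ] G => l v) h1

theorem isInvertible_mvfderiv_extChartAt {x₀ y : M} (hy : y ∈ (extChartAt (𝓡 n) x₀).source) :
    (mvfderiv (𝓡 n) (extChartAt (𝓡 n) x₀) y).IsInvertible :=
  isInvertible_mfderiv_extChartAt hy

variable {ι : Type*} {𝒰 : OpenCover M ι} {g : LineCocycle n 𝒰}

namespace Aff

theorem isOpen_dom (i : ι) (x₀ : M) : IsOpen (dom 𝒰 i x₀ : Set (Phase n)) := by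
  have h : IsOpen ((extChartAt (𝓡 n) x₀).target ∩
      (extChartAt (𝓡 n) x₀).symm ⁻¹' (𝒰.set i : Set M)) :=
    (continuousOn_extChartAt_symm x₀).isOpen_inter_preimage (isOpen_extChartAt_target x₀)
      (𝒰.set i).isOpen
  exact h.preimage continuous_fst

theorem mem_dom {i : ι} {x₀ y : M} (hi : y ∈ 𝒰.set i) (hy : y ∈ (extChartAt (𝓡 n) x₀).source)
    (η : EuclideanSpace ℝ (Fin n) →L[ℝ] ℝ) : (extChartAt (𝓡 n) x₀ y, η) ∈ dom 𝒰 i x₀ :=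
  ⟨(extChartAt (𝓡 n) x₀).map_source hy, by
    change (extChartAt (𝓡 n) x₀).symm (extChartAt (𝓡 n) x₀ y) ∈ 𝒰.set i
    rwa [(extChartAt (𝓡 n) x₀).left_inv hy]⟩

theorem loc_apply {i : ι} {x₀ y : M} (f : Aff g → ℝ) (hi : y ∈ 𝒰.set i)
    (hy : y ∈ (extChartAt (𝓡 n) x₀).source) (η : EuclideanSpace ℝ (Fin n) →L[ℝ] ℝ) :
    loc i x₀ f (extChartAt (𝓡 n) x₀ y, η) = f (pt g i y hi (covec x₀ y η)) := by
  -- The base point read back from the chart equals `y` only propositionally, while the types depend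
  -- on it; hence substitution for a general `w`.
  have key : ∀ w (hw : w ∈ 𝒰.set i), w = y →
      f (pt g i w hw (covec x₀ w η)) = f (pt g i y hi (covec x₀ y η)) := by
    rintro w hw rfl; rfl
  have h := (mem_dom hi hy η).2
  rw [loc, dif_pos h]
  exact key _ _ ((extChartAt (𝓡 n) x₀).left_inv hy)

theorem loc_of_mem_dom {i : ι} {x₀ : M} (f : Aff g → ℝ) {z : Phase n} (hz : z ∈ dom 𝒰 i x₀) :
    loc i x₀ f z = f (pt g i _ hz.2 (covec x₀ _ z.2)) :=
  dif_pos hz.2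

@[simp]
theorem pt_mom (i : ι) (r : Aff g) (hi : r.base ∈ 𝒰.set i) : pt g i r.base hi (r.mom i hi) = r := by
  refine Aff.ext rfl (heq_of_eq ?_)
  funext j hj
  exact (r.glue j i hj hi).symm

/-- The cocycle identity for (i, i, i) reads d = d + d. It ensures that `pt` has the prescribed
momentum in its own trivialization. -/
theorem mvfderiv_cocycle_self (g : LineCocycle n 𝒰) {i : ι} {x : M} (hi : x ∈ 𝒰.set i) :
    mvfderiv (𝓡 n) (g.c i i).1 x = 0 := by
  simpa using mvfderiv_cocycle g i i i hi hi hi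

theorem pt_mom_self {i : ι} {x : M} (hi : x ∈ 𝒰.set i) (p : TangentSpace (𝓡 n) x →L[ℝ] ℝ) :
    (pt g i x hi p).mom i hi = p := by
  simp only [pt, mvfderiv_cocycle_self g hi]
  exact add_zero p

theorem exists_covec {x₀ y : M} (hy : y ∈ (extChartAt (𝓡 n) x₀).source)
    (p : TangentSpace (𝓡 n) y →L[ℝ] ℝ) :
    covec x₀ y (p ∘L (mvfderiv (𝓡 n) (extChartAt (𝓡 n) x₀) y).inverse) = p := by
  obtain ⟨e, he⟩ := isInvertible_mvfderiv_extChartAt hy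
  rw [covec, ← he]
  ext v
  simp

/-- The change of coordinates on `R`. -/
def transition (g : LineCocycle n 𝒰) (i j : ι) (x₀ x₁ : M) (z : Phase n) : Phase n :=
  (extChartAt (𝓡 n) x₁ ((extChartAt (𝓡 n) x₀).symm z.1),
    z.2 ∘L fderiv ℝ (extChartAt (𝓡 n) x₀ ∘ (extChartAt (𝓡 n) x₁).symm)
        (extChartAt (𝓡 n) x₁ ((extChartAt (𝓡 n) x₀).symm z.1)) +
      fderiv ℝ ((g.c j i).1 ∘ (extChartAt (𝓡 n) x₁).symm)
        (extChartAt (𝓡 n) x₁ ((extChartAt (𝓡 n) x₀).symm z.1)))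

/-- Justifies the momentum component of `transition`: the components change by the Jacobian of the
inverse coordinate change, by the chain rule, and are shifted by dc_ji as in `pt`. -/
theorem covec_transition {i j : ι} {x₀ x₁ y : M} (hi : y ∈ 𝒰.set i) (hj : y ∈ 𝒰.set j)
    (h₀ : y ∈ (extChartAt (𝓡 n) x₀).source) (h₁ : y ∈ (extChartAt (𝓡 n) x₁).source)
    (η : EuclideanSpace ℝ (Fin n) →L[ℝ] ℝ) :
    covec x₁ y (transition g i j x₀ x₁ (extChartAt (𝓡 n) x₀ y, η)).2 =
      (pt g i y hi (covec x₀ y η)).mom j hj := by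
  have hc := (contMDiffAt_extChartAt_of_mem h₀).mdifferentiableAt (by simp)
  simp only [covec, transition, pt, (extChartAt (𝓡 n) x₀).left_inv h₀]
  rw [mvfderiv_eq_fderiv_comp h₁ hc, mvfderiv_eq_fderiv_comp h₁ (mdiffAt_of_funOn (g.c j i) ⟨hj, hi⟩)]
  ext v
  simp

/-- A point of R is recovered from its momentum in any trivialization, so both sides evaluate `f` at
the same point. -/
theorem loc_transition {i j : ι} {x₀ x₁ : M} (f : Aff g → ℝ) {z : Phase n} (hz : z ∈ dom 𝒰 i x₀)
    (hj : (extChartAt (𝓡 n) x₀).symm z.1 ∈ 𝒰.set j)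
    (h₁ : (extChartAt (𝓡 n) x₀).symm z.1 ∈ (extChartAt (𝓡 n) x₁).source) :
    loc i x₀ f z = loc j x₁ f (transition g i j x₀ x₁ z) := by
  have h₀ := (extChartAt (𝓡 n) x₀).map_target hz.1
  have hz' : z = (extChartAt (𝓡 n) x₀ ((extChartAt (𝓡 n) x₀).symm z.1), z.2) := by
    rw [(extChartAt (𝓡 n) x₀).right_inv hz.1]
  have hc := covec_transition (g := g) hz.2 hj h₀ h₁ z.2
  rw [← hz'] at hc
  have hp := pt_mom j (pt g i _ hz.2 (covec x₀ _ z.2)) hj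
  have hr := loc_apply f hj h₁ (transition g i j x₀ x₁ z).2
  rw [hc] at hr
  exact (loc_of_mem_dom f hz).trans ((congrArg f hp).symm.trans hr.symm)

theorem contDiffAt_transition {i j : ι} {x₀ x₁ : M} {z : Phase n} (hz : z ∈ dom 𝒰 i x₀)
    (hj : (extChartAt (𝓡 n) x₀).symm z.1 ∈ 𝒰.set j)
    (h₁ : (extChartAt (𝓡 n) x₀).symm z.1 ∈ (extChartAt (𝓡 n) x₁).source) :
    ContDiffAt ℝ ∞ (transition g i j x₀ x₁) z := by
  have h₀ := (extChartAt (𝓡 n) x₀).map_target hz.1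
  have ht := (extChartAt (𝓡 n) x₁).map_source h₁
  have hl := (extChartAt (𝓡 n) x₁).left_inv h₁
  have hφ : ContDiffAt ℝ ∞
      (fun z : Phase n => extChartAt (𝓡 n) x₁ ((extChartAt (𝓡 n) x₀).symm z.1)) z :=
    (contDiffAt_comp_extChartAt_symm hz.1 (contMDiffAt_extChartAt_of_mem h₁)).comp z contDiffAt_fst
  have hψ : ContDiffAt ℝ ∞ (fderiv ℝ (extChartAt (𝓡 n) x₀ ∘ (extChartAt (𝓡 n) x₁).symm))
      (extChartAt (𝓡 n) x₁ ((extChartAt (𝓡 n) x₀).symm z.1)) :=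
    (contDiffAt_comp_extChartAt_symm ht
      (by rw [hl]; exact contMDiffAt_extChartAt_of_mem h₀)).fderiv_right (by simp)
  have hc : ContDiffAt ℝ ∞ (fderiv ℝ ((g.c j i).1 ∘ (extChartAt (𝓡 n) x₁).symm))
      (extChartAt (𝓡 n) x₁ ((extChartAt (𝓡 n) x₀).symm z.1)) :=
    (contDiffAt_comp_extChartAt_symm ht (by
      rw [hl]
      exact ((g.c j i).2.1 _ ⟨hj, hz.2⟩).contMDiffAt
        ((𝒰.set j ⊓ 𝒰.set i).isOpen.mem_nhds ⟨hj, hz.2⟩))).fderiv_right (by simp)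
  exact hφ.prodMk ((contDiffAt_snd.clm_comp (hψ.comp z hφ)).add (hc.comp z hφ))

theorem eventually_transition {i : ι} {x₀ x₁ : M} {z : Phase n} (j : ι) (hz : z ∈ dom 𝒰 i x₀)
    (hj : (extChartAt (𝓡 n) x₀).symm z.1 ∈ 𝒰.set j)
    (h₁ : (extChartAt (𝓡 n) x₀).symm z.1 ∈ (extChartAt (𝓡 n) x₁).source) :
    ∀ᶠ w in 𝓝 z, w ∈ dom 𝒰 i x₀ ∧ (extChartAt (𝓡 n) x₀).symm w.1 ∈ 𝒰.set j ∧
      (extChartAt (𝓡 n) x₀).symm w.1 ∈ (extChartAt (𝓡 n) x₁).source := by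
  have hcont : ContinuousAt (fun w : Phase n => (extChartAt (𝓡 n) x₀).symm w.1) z :=
    ((continuousOn_extChartAt_symm x₀).continuousAt
      ((isOpen_extChartAt_target x₀).mem_nhds hz.1)).comp (f := Prod.fst) continuousAt_fst
  filter_upwards [(isOpen_dom i x₀).mem_nhds hz, hcont.preimage_mem_nhds
    ((𝒰.set j).isOpen.mem_nhds hj), hcont.preimage_mem_nhds
    ((isOpen_extChartAt_source x₁).mem_nhds h₁)] with w h h' h''
  exact ⟨h, h', h''⟩

/-- The Jacobians acting on positions and on momenta cancel, so `η dq` changes only by the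
differential of c_ji read in the first chart. Then `symplecticForm_fderiv` applies. -/
theorem symplecticForm_transition {i j : ι} {x₀ x₁ : M} {z : Phase n} (hz : z ∈ dom 𝒰 i x₀)
    (hj : (extChartAt (𝓡 n) x₀).symm z.1 ∈ 𝒰.set j)
    (h₁ : (extChartAt (𝓡 n) x₀).symm z.1 ∈ (extChartAt (𝓡 n) x₁).source) (u v : Phase n) :
    symplecticForm (fderiv ℝ (transition g i j x₀ x₁) z u)
      (fderiv ℝ (transition g i j x₀ x₁) z v) = symplecticForm u v := by
  refine symplecticForm_fderiv (c := (g.c j i).1 ∘ (extChartAt (𝓡 n) x₀).symm)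
    ((contDiffAt_transition hz hj h₁).of_le (by norm_cast)) ?_ ?_ u v
  · exact (contDiffAt_comp_extChartAt_symm hz.1 (((g.c j i).2.1 _ ⟨hj, hz.2⟩).contMDiffAt
      ((𝒰.set j ⊓ 𝒰.set i).isOpen.mem_nhds ⟨hj, hz.2⟩))).of_le (by norm_cast)
  filter_upwards [eventually_transition j hz hj h₁] with w ⟨hw, hwj, hw₁⟩ v
  have h₀ := (extChartAt (𝓡 n) x₀).map_target hw.1
  have ht := (extChartAt (𝓡 n) x₁).map_source hw₁
  have hl := (extChartAt (𝓡 n) x₁).left_inv hw₁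
  set φ := extChartAt (𝓡 n) x₁ ∘ (extChartAt (𝓡 n) x₀).symm with hφdef
  have hφ : DifferentiableAt ℝ φ w.1 :=
    (contDiffAt_comp_extChartAt_symm hw.1 (contMDiffAt_extChartAt_of_mem hw₁)).differentiableAt
      (by simp)
  have hfst : (fderiv ℝ (transition g i j x₀ x₁) w v).1 = fderiv ℝ φ w.1 v.1 := by
    have hT := ((contDiffAt_transition (g := g) hw hwj hw₁).differentiableAt (by simp)).hasFDerivAt
    have h2 : HasFDerivAt (fun y : Phase n => φ y.1) _ w :=
      hφ.hasFDerivAt.comp w hasFDerivAt_fst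
    exact congrArg (fun l : Phase n →L[ℝ] _ => l v) (hT.fst.unique h2)
  have hψ : DifferentiableAt ℝ (extChartAt (𝓡 n) x₀ ∘ (extChartAt (𝓡 n) x₁).symm) (φ w.1) :=
    (contDiffAt_comp_extChartAt_symm ht
      (by rw [hl]; exact contMDiffAt_extChartAt_of_mem h₀)).differentiableAt (by simp)
  have hc : DifferentiableAt ℝ ((g.c j i).1 ∘ (extChartAt (𝓡 n) x₁).symm) (φ w.1) :=
    (contDiffAt_comp_extChartAt_symm ht (by
      rw [hl]
      exact ((g.c j i).2.1 _ ⟨hwj, hw.2⟩).contMDiffAt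
        ((𝒰.set j ⊓ 𝒰.set i).isOpen.mem_nhds ⟨hwj, hw.2⟩))).differentiableAt (by simp)
  have hev : ∀ᶠ q in 𝓝 w.1, (extChartAt (𝓡 n) x₁).symm (φ q) = (extChartAt (𝓡 n) x₀).symm q ∧
      q ∈ (extChartAt (𝓡 n) x₀).target := by
    filter_upwards [(((continuousOn_extChartAt_symm x₀).continuousAt
      ((isOpen_extChartAt_target x₀).mem_nhds hw.1))).preimage_mem_nhds
        ((isOpen_extChartAt_source x₁).mem_nhds hw₁),
      (isOpen_extChartAt_target x₀).mem_nhds hw.1] with q hq hq'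
    exact ⟨(extChartAt (𝓡 n) x₁).left_inv hq, hq'⟩
  -- The two coordinate changes are inverse to each other near the point; differentiated, this is
  -- the cancellation of Jacobians.
  have e1 : fderiv ℝ ((extChartAt (𝓡 n) x₀ ∘ (extChartAt (𝓡 n) x₁).symm) ∘ φ) w.1 =
      ContinuousLinearMap.id ℝ _ := by
    have : ((extChartAt (𝓡 n) x₀ ∘ (extChartAt (𝓡 n) x₁).symm) ∘ φ) =ᶠ[𝓝 w.1] id := by
      filter_upwards [hev] with q hq
      simp only [Function.comp_apply, hq.1, (extChartAt (𝓡 n) x₀).right_inv hq.2, id_eq]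
    rw [this.fderiv_eq, fderiv_id]
  have e2 : fderiv ℝ (((g.c j i).1 ∘ (extChartAt (𝓡 n) x₁).symm) ∘ φ) w.1 =
      fderiv ℝ ((g.c j i).1 ∘ (extChartAt (𝓡 n) x₀).symm) w.1 := by
    refine Filter.EventuallyEq.fderiv_eq ?_
    filter_upwards [hev] with q hq
    simp only [Function.comp_apply, hq.1]
  rw [fderiv_comp _ hψ hφ] at e1
  rw [fderiv_comp _ hc hφ] at e2
  rw [hfst, ← e2]
  have e1' := congrArg (fun l : _ →L[ℝ] _ => w.2 (l v.1)) e1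
  simp only [ContinuousLinearMap.comp_apply, ContinuousLinearMap.id_apply] at e1'
  simp only [transition, add_apply, ContinuousLinearMap.comp_apply]
  exact congrArg (· + _) e1'

theorem IsSmooth.contDiffAt {f : Aff g → ℝ} (hf : IsSmooth f) {i : ι} {x₀ : M} {z : Phase n}
    (hz : z ∈ dom 𝒰 i x₀) : ContDiffAt ℝ ∞ (loc i x₀ f) z :=
  (hf i x₀).contDiffAt ((isOpen_dom i x₀).mem_nhds hz)

/-- The Poisson bracket can be computed in any chart and any trivialization. -/
theorem poisson_pt {f f' : Aff g → ℝ} (hf : IsSmooth f) (hf' : IsSmooth f') {i : ι} {x₀ y : M}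
    (hi : y ∈ 𝒰.set i) (hy : y ∈ (extChartAt (𝓡 n) x₀).source)
    (η : EuclideanSpace ℝ (Fin n) →L[ℝ] ℝ) :
    poisson f f' (pt g i y hi (covec x₀ y η)) =
      canonicalBracket (loc i x₀ f) (loc i x₀ f') (extChartAt (𝓡 n) x₀ y, η) := by
  -- The definition of `poisson` uses the chart around `y` and this chosen index; the map `T` below
  -- passes from the given coordinates to those.
  set j := (𝒰.covers y).choose with hjdef
  have hj : y ∈ 𝒰.set j := (𝒰.covers y).choose_spec
  have hyy : y ∈ (extChartAt (𝓡 n) y).source := mem_extChartAt_source y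
  have hz := mem_dom hi hy η
  have hl := (extChartAt (𝓡 n) x₀).left_inv hy
  have hz2 : (extChartAt (𝓡 n) x₀).symm (extChartAt (𝓡 n) x₀ y, η).1 ∈ 𝒰.set j := by
    change (extChartAt (𝓡 n) x₀).symm (extChartAt (𝓡 n) x₀ y) ∈ _
    rwa [hl]
  have hz3 : (extChartAt (𝓡 n) x₀).symm (extChartAt (𝓡 n) x₀ y, η).1 ∈
      (extChartAt (𝓡 n) y).source := by
    change (extChartAt (𝓡 n) x₀).symm (extChartAt (𝓡 n) x₀ y) ∈ _
    rwa [hl]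
  set T := transition g i j x₀ y with hT
  have hTz : T (extChartAt (𝓡 n) x₀ y, η) = (extChartAt (𝓡 n) y y,
      (pt g i y hi (covec x₀ y η)).mom j hj ∘L
        (mvfderiv (𝓡 n) (extChartAt (𝓡 n) y) y).inverse) := by
    refine Prod.ext ?_ ?_
    · simp only [hT, transition, hl]
    · rw [← covec_transition hi hj hy hyy η]
      obtain ⟨e, he⟩ := isInvertible_mvfderiv_extChartAt hyy
      simp only [covec]
      rw [← he]
      ext v
      simp only [ContinuousLinearMap.inverse_equiv]
      exact congrArg (T _).2 (e.apply_symm_apply v).symm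
  have hmem : T (extChartAt (𝓡 n) x₀ y, η) ∈ dom 𝒰 j y := by
    rw [hTz]; exact mem_dom hj hyy _
  have hev : ∀ f : Aff g → ℝ, loc i x₀ f =ᶠ[𝓝 (extChartAt (𝓡 n) x₀ y, η)] loc j y f ∘ T :=
    fun f => (eventually_transition j hz hz2 hz3).mono fun w ⟨hw, hwj, hw₁⟩ =>
      loc_transition f hw hwj hw₁
  rw [canonicalBracket_congr (hev f) (hev f'), canonicalBracket_comp
    ((hf.contDiffAt hmem).differentiableAt (by simp))
    ((hf'.contDiffAt hmem).differentiableAt (by simp))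
    ((contDiffAt_transition hz hz2 hz3).differentiableAt (by simp))
    (symplecticForm_transition hz hz2 hz3), hTz]
  rfl

end Aff
end Coordinates

/-! ### The Poisson algebra of smooth functions on the affinization -/

section FunctionsOnAff

variable {n : ℕ} {M : Type*} [TopologicalSpace M] [ChartedSpace (EuclideanSpace ℝ (Fin n)) M]
  [IsManifold (𝓡 n) ∞ M] {ι : Type*} {𝒰 : OpenCover M ι} {g : LineCocycle n 𝒰}

theorem contDiffAt_canonicalBracket {f k : Aff.Phase n → ℝ} {z : Aff.Phase n}
    (hf : ContDiffAt ℝ ∞ f z) (hk : ContDiffAt ℝ ∞ k z) :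
    ContDiffAt ℝ ∞ (Aff.canonicalBracket f k) z := by
  have hf' : ContDiffAt ℝ ∞ (fderiv ℝ f) z := hf.fderiv_right (by simp)
  have hk' : ContDiffAt ℝ ∞ (fderiv ℝ k) z := hk.fderiv_right (by simp)
  refine ContDiffAt.sum fun a _ => ?_
  exact ((hf'.clm_apply contDiffAt_const).mul (hk'.clm_apply contDiffAt_const)).sub
    ((hf'.clm_apply contDiffAt_const).mul (hk'.clm_apply contDiffAt_const))

theorem canonicalBracket_add_right {f k l : Aff.Phase n → ℝ} {z : Aff.Phase n}
    (hk : DifferentiableAt ℝ k z) (hl : DifferentiableAt ℝ l z) :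
    Aff.canonicalBracket f (k + l) z =
      Aff.canonicalBracket f k z + Aff.canonicalBracket f l z := by
  simp only [canonicalBracket_eq, fderiv_add hk hl, add_apply]

theorem canonicalBracket_mul_right {f k l : Aff.Phase n → ℝ} {z : Aff.Phase n}
    (hk : DifferentiableAt ℝ k z) (hl : DifferentiableAt ℝ l z) :
    Aff.canonicalBracket f (k * l) z =
      k z * Aff.canonicalBracket f l z + l z * Aff.canonicalBracket f k z := by
  simp only [canonicalBracket_eq, fderiv_mul hk hl, add_apply, smul_apply, smul_eq_mul]

namespace Aff

theorem coord_mem_dom (r : Aff g) {i : ι} (hi : r.base ∈ 𝒰.set i)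
    (η : EuclideanSpace ℝ (Fin n) →L[ℝ] ℝ) :
    (extChartAt (𝓡 n) r.base r.base, η) ∈ dom 𝒰 i r.base :=
  mem_dom hi (mem_extChartAt_source r.base) η

theorem exists_eq_pt_of_mem (r : Aff g) {i : ι} (hi : r.base ∈ 𝒰.set i) {x₀ : M}
    (hx : r.base ∈ (extChartAt (𝓡 n) x₀).source) :
    ∃ η : EuclideanSpace ℝ (Fin n) →L[ℝ] ℝ, r = pt g i r.base hi (covec x₀ r.base η) :=
  ⟨_, by rw [exists_covec hx, pt_mom]⟩

theorem loc_add (i : ι) (x₀ : M) (f k : Aff g → ℝ) :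
    loc i x₀ (f + k) = loc i x₀ f + loc i x₀ k := by
  funext z
  simp only [loc, Pi.add_apply]
  split_ifs <;> simp

theorem loc_mul (i : ι) (x₀ : M) (f k : Aff g → ℝ) :
    loc i x₀ (f * k) = loc i x₀ f * loc i x₀ k := by
  funext z
  simp only [loc, Pi.mul_apply]
  split_ifs <;> simp

theorem isSmooth_comp_base {u : M → ℝ} (hu : ContMDiff (𝓡 n) 𝓘(ℝ) ∞ u) :
    IsSmooth fun r : Aff g => u r.base := by
  intro i x₀
  refine ((hu.comp_contMDiffOn (contMDiffOn_base 𝒰 i x₀)).contDiffOn).congr fun z hz => ?_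
  rw [loc_of_mem_dom _ hz]
  rfl

theorem IsSmooth.add {f k : Aff g → ℝ} (hf : IsSmooth f) (hk : IsSmooth k) : IsSmooth (f + k) :=
  fun i x₀ => by rw [loc_add]; exact (hf i x₀).add (hk i x₀)

theorem IsSmooth.mul {f k : Aff g → ℝ} (hf : IsSmooth f) (hk : IsSmooth k) : IsSmooth (f * k) :=
  fun i x₀ => by rw [loc_mul]; exact (hf i x₀).mul (hk i x₀)

theorem isSmooth_const (t : ℝ) : IsSmooth fun _ : Aff g => t :=
  isSmooth_comp_base (u := fun _ => t) contMDiff_const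

/-- Points of R over a neighbourhood of `y` fill a neighbourhood in coordinates, whatever the
momentum. Hence agreement over a neighbourhood in M is enough for all germ arguments on R. -/
theorem loc_eventuallyEq {f k : Aff g → ℝ} {i : ι} {x₀ y : M} (hi : y ∈ 𝒰.set i)
    (hy : y ∈ (extChartAt (𝓡 n) x₀).source)
    (h : ∀ᶠ w in 𝓝 y, ∀ r : Aff g, r.base = w → f r = k r)
    (η : EuclideanSpace ℝ (Fin n) →L[ℝ] ℝ) :
    loc i x₀ f =ᶠ[𝓝 (extChartAt (𝓡 n) x₀ y, η)] loc i x₀ k := by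
  have hq := (extChartAt (𝓡 n) x₀).map_source hy
  have hl := (extChartAt (𝓡 n) x₀).left_inv hy
  have hcont : ContinuousAt (fun w : Phase n => (extChartAt (𝓡 n) x₀).symm w.1)
      (extChartAt (𝓡 n) x₀ y, η) :=
    ((continuousOn_extChartAt_symm x₀).continuousAt
      ((isOpen_extChartAt_target x₀).mem_nhds hq)).comp (f := Prod.fst) continuousAt_fst
  have hcont' := hcont.tendsto
  simp only [hl] at hcont'
  filter_upwards [hcont'.eventually h, (isOpen_dom i x₀).mem_nhds (mem_dom hi hy η)] with z hz hz'
  rw [loc_of_mem_dom f hz', loc_of_mem_dom k hz']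
  exact hz _ rfl

/-- Smoothness is local over the base. -/
theorem isSmooth_of_local {f : Aff g → ℝ}
    (h : ∀ x, ∃ k : Aff g → ℝ, IsSmooth k ∧ ∀ᶠ w in 𝓝 x, ∀ r : Aff g, r.base = w → f r = k r) :
    IsSmooth f := by
  intro i x₀ z hz
  obtain ⟨k, hk, he⟩ := h ((extChartAt (𝓡 n) x₀).symm z.1)
  have hs := (extChartAt (𝓡 n) x₀).map_target hz.1
  have := loc_eventuallyEq (i := i) (x₀ := x₀) hz.2 hs he z.2
  rw [(extChartAt (𝓡 n) x₀).right_inv hz.1] at this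
  exact ((hk.contDiffAt hz).congr_of_eventuallyEq this).contDiffWithinAt

theorem poisson_congr {f f' k k' : Aff g → ℝ} {r : Aff g}
    (h : ∀ᶠ w in 𝓝 r.base, ∀ r : Aff g, r.base = w → f r = k r)
    (h' : ∀ᶠ w in 𝓝 r.base, ∀ r : Aff g, r.base = w → f' r = k' r) :
    poisson f f' r = poisson k k' r :=
  canonicalBracket_congr
    (loc_eventuallyEq (𝒰.covers r.base).choose_spec (mem_extChartAt_source r.base) h _)
    (loc_eventuallyEq (𝒰.covers r.base).choose_spec (mem_extChartAt_source r.base) h' _)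

/-- By coordinate independence the canonical bracket represents `poisson` on a whole coordinate
domain, not only at the centre of a chart. This gives its smoothness and allows brackets to be
iterated. -/
theorem loc_poisson {f k : Aff g → ℝ} (hf : IsSmooth f) (hk : IsSmooth k) {i : ι} {x₀ : M}
    {z : Phase n} (hz : z ∈ dom 𝒰 i x₀) :
    loc i x₀ (poisson f k) z = canonicalBracket (loc i x₀ f) (loc i x₀ k) z := by
  rw [loc_of_mem_dom _ hz, poisson_pt hf hk hz.2 ((extChartAt (𝓡 n) x₀).map_target hz.1),
    (extChartAt (𝓡 n) x₀).right_inv hz.1]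

theorem IsSmooth.poisson {f k : Aff g → ℝ} (hf : IsSmooth f) (hk : IsSmooth k) :
    IsSmooth (poisson f k) := fun i x₀ z hz => by
  refine (contDiffAt_canonicalBracket (hf.contDiffAt hz)
    (hk.contDiffAt hz)).contDiffWithinAt.congr_of_mem (fun w hw => loc_poisson hf hk hw) hz

theorem IsSmooth.differentiableAt_coord {f : Aff g → ℝ} (hf : IsSmooth f) (r : Aff g)
    (η : EuclideanSpace ℝ (Fin n) →L[ℝ] ℝ) :
    DifferentiableAt ℝ (loc (𝒰.covers r.base).choose r.base f)
      (extChartAt (𝓡 n) r.base r.base, η) :=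
  (hf.contDiffAt (coord_mem_dom r (𝒰.covers r.base).choose_spec η)).differentiableAt (by simp)

theorem poisson_swap (f k : Aff g → ℝ) (r : Aff g) : poisson f k r = -poisson k f r :=
  canonicalBracket_swap _ _ _

theorem poisson_add_right {f k l : Aff g → ℝ} (hk : IsSmooth k) (hl : IsSmooth l) (r : Aff g) :
    poisson f (k + l) r = poisson f k r + poisson f l r := by
  simp only [poisson, loc_add]
  exact canonicalBracket_add_right (hk.differentiableAt_coord r _) (hl.differentiableAt_coord r _)

theorem poisson_add_left {f k l : Aff g → ℝ} (hf : IsSmooth f) (hk : IsSmooth k) (r : Aff g) :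
    poisson (f + k) l r = poisson f l r + poisson k l r := by
  rw [poisson_swap, poisson_add_right hf hk, poisson_swap f, poisson_swap k]
  ring

theorem poisson_mul_right {f k l : Aff g → ℝ} (hk : IsSmooth k) (hl : IsSmooth l) (r : Aff g) :
    poisson f (k * l) r = k r * poisson f l r + l r * poisson f k r := by
  -- The coordinates at which `poisson` is evaluated are those of the point `r` itself.
  have hr : ∀ f : Aff g → ℝ, loc (𝒰.covers r.base).choose r.base f
      (extChartAt (𝓡 n) r.base r.base, r.mom _ (𝒰.covers r.base).choose_spec ∘L
        (mvfderiv (𝓡 n) (extChartAt (𝓡 n) r.base) r.base).inverse) = f r := fun f => by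
    rw [loc_apply f (𝒰.covers r.base).choose_spec (mem_extChartAt_source r.base),
      exists_covec (mem_extChartAt_source r.base), pt_mom]
  simp only [poisson, loc_mul]
  rw [canonicalBracket_mul_right (hk.differentiableAt_coord r _) (hl.differentiableAt_coord r _),
    hr, hr]

theorem poisson_const_right (f : Aff g → ℝ) (t : ℝ) (r : Aff g) :
    poisson f (fun _ => t) r = 0 := by
  have hfd : loc (𝒰.covers r.base).choose r.base (fun _ : Aff g => t) =ᶠ[𝓝
      (extChartAt (𝓡 n) r.base r.base, r.mom _ (𝒰.covers r.base).choose_spec ∘L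
        (mvfderiv (𝓡 n) (extChartAt (𝓡 n) r.base) r.base).inverse)] fun _ => t := by
    filter_upwards [(isOpen_dom _ r.base).mem_nhds
      (coord_mem_dom r (𝒰.covers r.base).choose_spec _)] with z hz
    rw [loc_of_mem_dom _ hz]
  change canonicalBracket _ _ _ = 0
  rw [canonicalBracket_eq, hfd.fderiv_eq]
  simp

theorem poisson_const_mul_right {f k : Aff g → ℝ} (hk : IsSmooth k) (t : ℝ) (r : Aff g) :
    poisson f (fun r => t * k r) r = t * poisson f k r := by
  have := poisson_mul_right (f := f) (isSmooth_const t) hk r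
  rw [poisson_const_right, mul_zero, add_zero] at this
  exact this

theorem poisson_jacobi {f k l : Aff g → ℝ} (hf : IsSmooth f) (hk : IsSmooth k) (hl : IsSmooth l)
    (r : Aff g) :
    poisson f (poisson k l) r = poisson (poisson f k) l r + poisson k (poisson f l) r := by
  have hc := coord_mem_dom r (𝒰.covers r.base).choose_spec (r.mom _ (𝒰.covers r.base).choose_spec ∘L
        (mvfderiv (𝓡 n) (extChartAt (𝓡 n) r.base) r.base).inverse)
  have key : ∀ {f k : Aff g → ℝ}, IsSmooth f → IsSmooth k →
      loc (𝒰.covers r.base).choose r.base (poisson f k) =ᶠ[𝓝 _] canonicalBracket _ _ :=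
    fun hf hk => Filter.eventually_of_mem ((isOpen_dom _ r.base).mem_nhds hc)
      fun z hz => loc_poisson hf hk hz
  have h2 : ∀ {f : Aff g → ℝ}, IsSmooth f → ContDiffAt ℝ 2 (loc _ r.base f) _ := fun hf =>
    (hf.contDiffAt hc).of_le (by norm_cast)
  change canonicalBracket _ _ _ = canonicalBracket _ _ _ + canonicalBracket _ _ _
  rw [canonicalBracket_congr Filter.EventuallyEq.rfl (key hk hl),
    canonicalBracket_congr (key hf hk) Filter.EventuallyEq.rfl,
    canonicalBracket_congr Filter.EventuallyEq.rfl (key hf hl)]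
  exact canonicalBracket_jacobi (h2 hf) (h2 hk) (h2 hl)

end Aff
end FunctionsOnAff

/-! ### Vector fields and Lie brackets in charts -/

section VectorFields

variable {n : ℕ} {M : Type*} [TopologicalSpace M] [ChartedSpace (EuclideanSpace ℝ (Fin n)) M]
  [IsManifold (𝓡 n) ∞ M]

/-- The derivative of a smooth function along a smooth vector field is smooth. -/
theorem contMDiffOn_mvfderiv_apply {G : Type*} [NormedAddCommGroup G] [NormedSpace ℝ G]
    {f : M → G} {U : Set M} (hU : IsOpen U) (hf : ContMDiffOn (𝓡 n) 𝓘(ℝ, G) ∞ f U)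
    {V : ∀ x : M, TangentSpace (𝓡 n) x}
    (hV : ContMDiff (𝓡 n) (𝓡 n).tangent ∞ fun x => (⟨x, V x⟩ : TangentBundle (𝓡 n) M)) :
    ContMDiffOn (𝓡 n) 𝓘(ℝ, G) ∞ (fun x => mvfderiv (𝓡 n) f x (V x)) U := by
  have h1 := (hf.contMDiffOn_tangentMapWithin (m := ∞) (by simp) hU.uniqueMDiffOn).comp
    (hV.contMDiffOn (s := U)) fun x hx => hx
  have h2 := (contMDiff_snd_tangentBundle_modelSpace G 𝓘(ℝ, G) (n := ∞)).comp_contMDiffOn h1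
  refine h2.congr fun x hx => ?_
  change _ = mfderivWithin (𝓡 n) 𝓘(ℝ, G) f U x (V x)
  rw [mfderivWithin_of_isOpen hU hx]
  rfl

/-- A vector field in the coordinates of the chart around `x₀`. -/
def chartField (x₀ : M) (V : ∀ x : M, TangentSpace (𝓡 n) x) (q : EuclideanSpace ℝ (Fin n)) :
    EuclideanSpace ℝ (Fin n) :=
  mvfderiv (𝓡 n) (extChartAt (𝓡 n) x₀) ((extChartAt (𝓡 n) x₀).symm q)
    (V ((extChartAt (𝓡 n) x₀).symm q))

theorem chartField_apply {x₀ y : M} (V : ∀ x : M, TangentSpace (𝓡 n) x)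
    (hy : y ∈ (extChartAt (𝓡 n) x₀).source) : chartField x₀ V (extChartAt (𝓡 n) x₀ y) =
      mvfderiv (𝓡 n) (extChartAt (𝓡 n) x₀) y (V y) := by
  have key : ∀ w, w = y → mvfderiv (𝓡 n) (extChartAt (𝓡 n) x₀) w (V w) =
      mvfderiv (𝓡 n) (extChartAt (𝓡 n) x₀) y (V y) := by
    rintro w rfl; rfl
  exact key _ ((extChartAt (𝓡 n) x₀).left_inv hy)

theorem contDiffAt_chartField {V : ∀ x : M, TangentSpace (𝓡 n) x}
    (hV : ContMDiff (𝓡 n) (𝓡 n).tangent ∞ fun x => (⟨x, V x⟩ : TangentBundle (𝓡 n) M))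
    {x₀ : M} {q : EuclideanSpace ℝ (Fin n)} (hq : q ∈ (extChartAt (𝓡 n) x₀).target) :
    ContDiffAt ℝ ∞ (chartField x₀ V) q := by
  have ho := isOpen_extChartAt_source (I := 𝓡 n) x₀
  have h := contMDiffOn_mvfderiv_apply ho (f := extChartAt (𝓡 n) x₀)
    (fun y hy => (contMDiffAt_extChartAt_of_mem hy).contMDiffWithinAt) hV
  have hs := (extChartAt (𝓡 n) x₀).map_target hq
  exact contDiffAt_comp_extChartAt_symm hq ((h _ hs).contMDiffAt (ho.mem_nhds hs))

theorem mvfderiv_symm_apply {G : Type*} [NormedAddCommGroup G] [NormedSpace ℝ G] {f : M → G}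
    (V : ∀ x : M, TangentSpace (𝓡 n) x) {x₀ : M} {q : EuclideanSpace ℝ (Fin n)}
    (hq : q ∈ (extChartAt (𝓡 n) x₀).target)
    (hf : MDifferentiableAt (𝓡 n) 𝓘(ℝ, G) f ((extChartAt (𝓡 n) x₀).symm q)) :
    mvfderiv (𝓡 n) f ((extChartAt (𝓡 n) x₀).symm q) (V ((extChartAt (𝓡 n) x₀).symm q)) =
      fderiv ℝ (f ∘ (extChartAt (𝓡 n) x₀).symm) q (chartField x₀ V q) := by
  rw [mvfderiv_eq_fderiv_comp ((extChartAt (𝓡 n) x₀).map_target hq) hf,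
    (extChartAt (𝓡 n) x₀).right_inv hq]
  rfl

/-- The Lie bracket of vector fields, read in the chart around the point. -/
theorem mvfderiv_extChartAt_mlieBracket (V W : ∀ x : M, TangentSpace (𝓡 n) x) (x : M) :
    mvfderiv (𝓡 n) (extChartAt (𝓡 n) x) x (VectorField.mlieBracket (𝓡 n) V W x) =
      VectorField.lieBracket ℝ (chartField x V) (chartField x W) (extChartAt (𝓡 n) x x) := by
  let P (V : ∀ x : M, TangentSpace (𝓡 n) x) : EuclideanSpace ℝ (Fin n) → EuclideanSpace ℝ (Fin n) :=
    VectorField.mpullbackWithin 𝓘(ℝ, EuclideanSpace ℝ (Fin n)) (𝓡 n) (extChartAt (𝓡 n) x).symm V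
        (Set.range (𝓡 n))
  -- `P V` is the pull-back used in the definition of `mlieBracket`. The derivatives of the chart
  -- and of its inverse are inverse to each other, so `P V` is `chartField` near the point.
  have key : ∀ V : ∀ x : M, TangentSpace (𝓡 n) x,
      P V =ᶠ[𝓝 (extChartAt (𝓡 n) x x)] chartField x V := by
    intro V
    filter_upwards [(isOpen_extChartAt_target (I := 𝓡 n) x).mem_nhds
      ((extChartAt (𝓡 n) x).map_source (mem_extChartAt_source x))] with q hq
    have := ContinuousLinearMap.inverse_eq
      (mfderivWithin_extChartAt_symm_comp_mfderiv_extChartAt hq)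
      (mfderiv_extChartAt_comp_mfderivWithin_extChartAt_symm hq)
    change (mfderivWithin 𝓘(ℝ, EuclideanSpace ℝ (Fin n)) (𝓡 n) (extChartAt (𝓡 n) x).symm
      (Set.range (𝓡 n)) q).inverse _ = _
    rw [this]
    rfl
  have hr : (extChartAt (𝓡 n) x).symm ⁻¹' Set.univ ∩ Set.range (𝓡 n) = Set.univ := by
    simp
  rw [VectorField.mlieBracket, VectorField.mlieBracketWithin_apply, hr]
  have h : VectorField.lieBracketWithin ℝ (P V) (P W) Set.univ (extChartAt (𝓡 n) x x) =
      VectorField.lieBracket ℝ (chartField x V) (chartField x W) (extChartAt (𝓡 n) x x) := by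
    rw [VectorField.lieBracketWithin_univ, (key V).lieBracket_vectorField_eq (key W)]
  have hD : ∀ w : EuclideanSpace ℝ (Fin n), mvfderiv (𝓡 n) (extChartAt (𝓡 n) x) x
      ((mvfderiv (𝓡 n) (extChartAt (𝓡 n) x) x).inverse w) = w := by
    obtain ⟨e, he⟩ := isInvertible_mvfderiv_extChartAt (mem_extChartAt_source (I := 𝓡 n) x)
    intro w
    rw [← he, ContinuousLinearMap.inverse_equiv]
    exact e.apply_symm_apply w
  exact (hD _).trans h

/-- The derivative along a Lie bracket is the commutator of the derivatives. -/
theorem mvfderiv_mlieBracket {V W : ∀ x : M, TangentSpace (𝓡 n) x}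
    (hV : ContMDiff (𝓡 n) (𝓡 n).tangent ∞ fun x => (⟨x, V x⟩ : TangentBundle (𝓡 n) M))
    (hW : ContMDiff (𝓡 n) (𝓡 n).tangent ∞ fun x => (⟨x, W x⟩ : TangentBundle (𝓡 n) M))
    {f : M → ℝ} {U : Set M} (hU : IsOpen U) (hf : ContMDiffOn (𝓡 n) 𝓘(ℝ) ∞ f U) {x : M}
    (hx : x ∈ U) :
    mvfderiv (𝓡 n) f x (VectorField.mlieBracket (𝓡 n) V W x) =
      mvfderiv (𝓡 n) (fun y => mvfderiv (𝓡 n) f y (W y)) x (V x) -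
        mvfderiv (𝓡 n) (fun y => mvfderiv (𝓡 n) f y (V y)) x (W x) := by
  have hsrc := mem_extChartAt_source (I := 𝓡 n) x
  have hq := (extChartAt (𝓡 n) x).map_source hsrc
  have hl := (extChartAt (𝓡 n) x).left_inv hsrc
  have hdiff : ∀ y ∈ U, MDifferentiableAt (𝓡 n) 𝓘(ℝ) f y := fun y hy =>
    ((hf y hy).contMDiffAt (hU.mem_nhds hy)).mdifferentiableAt (by simp)
  -- The inner derivative is differentiated again, so its coordinate expression is needed on a
  -- neighbourhood.
  have hev : ∀ V : ∀ x : M, TangentSpace (𝓡 n) x,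
      (fun y => mvfderiv (𝓡 n) f y (V y)) ∘ (extChartAt (𝓡 n) x).symm =ᶠ[𝓝 (extChartAt (𝓡 n) x x)]
        fun q => fderiv ℝ (f ∘ (extChartAt (𝓡 n) x).symm) q (chartField x V q) := by
    intro V
    have hc := (continuousOn_extChartAt_symm (I := 𝓡 n) x).continuousAt
      ((isOpen_extChartAt_target x).mem_nhds hq)
    filter_upwards [(isOpen_extChartAt_target (I := 𝓡 n) x).mem_nhds hq,
      hc.preimage_mem_nhds (hU.mem_nhds (by rwa [hl]))] with q hq hqU
    exact mvfderiv_symm_apply V hq (hdiff _ hqU)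
  have hd : ∀ {V W : ∀ x : M, TangentSpace (𝓡 n) x},
      ContMDiff (𝓡 n) (𝓡 n).tangent ∞ (fun x => (⟨x, V x⟩ : TangentBundle (𝓡 n) M)) →
      mvfderiv (𝓡 n) (fun y => mvfderiv (𝓡 n) f y (V y)) x (W x) =
      fderiv ℝ (fun q => fderiv ℝ (f ∘ (extChartAt (𝓡 n) x).symm) q (chartField x V q))
        (extChartAt (𝓡 n) x x) (chartField x W (extChartAt (𝓡 n) x x)) := by
    intro V W hV
    have h := contMDiffOn_mvfderiv_apply hU hf hV
    rw [mvfderiv_eq_fderiv_comp hsrc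
      (((h x hx).contMDiffAt (hU.mem_nhds hx)).mdifferentiableAt (by simp)), (hev V).fderiv_eq]
    rw [chartField_apply W hsrc]
    rfl
  rw [hd hV, hd hW, mvfderiv_eq_fderiv_comp hsrc (hdiff x hx), ContinuousLinearMap.comp_apply,
    mvfderiv_extChartAt_mlieBracket]
  refine VectorField.fderiv_apply_lieBracket (n := ∞)
    (contDiffAt_comp_extChartAt_symm hq ?_) (by simp; norm_cast) ?_ ?_
  · rw [hl]; exact (hf x hx).contMDiffAt (hU.mem_nhds hx)
  · exact (contDiffAt_chartField hW hq).differentiableAt (by simp)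
  · exact (contDiffAt_chartField hV hq).differentiableAt (by simp)

end VectorFields

/-! ### Cut-offs, local frames and extension of germs -/

section Cutoffs

variable {n : ℕ} {M : Type*} [TopologicalSpace M] [T2Space M]
  [ChartedSpace (EuclideanSpace ℝ (Fin n)) M] [IsManifold (𝓡 n) ∞ M]

/-- The conditions on lifts and brackets are stated for global functions and sections; cut-offs make
them available for germs. -/
theorem exists_cutoff {x : M} {U : Set M} (hU : U ∈ 𝓝 x) :
    ∃ χ : C^∞⟮𝓡 n, M; ℝ⟯, (∀ᶠ y in 𝓝 x, χ y = 1) ∧ tsupport χ ⊆ U := by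
  obtain ⟨f, -, hf⟩ := (SmoothBumpFunction.nhds_basis_tsupport (I := 𝓡 n) x).mem_iff.1 hU
  exact ⟨⟨f, f.contMDiff⟩, f.eventuallyEq_one, hf⟩

/-- The germ of a smooth function extends to all of `M`. -/
theorem exists_extend_fun {x : M} {U : Set M} (hU : IsOpen U) (hx : x ∈ U) {f : M → ℝ}
    (hf : ContMDiffOn (𝓡 n) 𝓘(ℝ) ∞ f U) :
    ∃ u : C^∞⟮𝓡 n, M; ℝ⟯, ∀ᶠ y in 𝓝 x, u y = f y := by
  obtain ⟨χ, hχ, hs⟩ := exists_cutoff (n := n) (hU.mem_nhds hx)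
  refine ⟨⟨fun y => χ y * f y, contMDiff_of_tsupport fun y hy => ?_⟩, ?_⟩
  · have hy' : y ∈ U := hs (closure_mono (fun w hw => left_ne_zero_of_mul hw) hy)
    exact χ.contMDiff.contMDiffAt.mul ((hf y hy').contMDiffAt (hU.mem_nhds hy'))
  · filter_upwards [hχ] with y hy
    change χ y * f y = f y
    rw [hy, one_mul]

variable {F : Type*} [NormedAddCommGroup F] [NormedSpace ℝ F] [FiniteDimensional ℝ F]
  {A : M → Type*} [TopologicalSpace (TotalSpace F A)] [∀ x, TopologicalSpace (A x)]
  [FiberBundle F A] [∀ x, AddCommGroup (A x)] [∀ x, Module ℝ (A x)] [VectorBundle ℝ F A]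
  [ContMDiffVectorBundle ∞ F A (𝓡 n)]

/-- The components of the fibres of `A` in a local trivialization, cut off by a function. -/
def cutCoord (x₀ : M) (χ : C^∞⟮𝓡 n, M; ℝ⟯) (k : Fin (Module.finrank ℝ F)) (x : M) :
    A x →ₗ[ℝ] ℝ :=
  χ x • ((Module.finBasis ℝ F).coord k ∘ₗ (trivializationAt F A x₀).linearMapAt ℝ x)

/-- Over the base set the trivialization gives smoothness, and off the closed support of `χ` the
form vanishes; `hχ` makes these cases exhaustive. Working along a map `b` covers sections of A and
of its pull-back at once. -/
theorem contMDiffOn_cutCoord {x₀ : M} {χ : C^∞⟮𝓡 n, M; ℝ⟯}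
    (hχ : tsupport χ ⊆ (trivializationAt F A x₀).baseSet)
    {E' H' N : Type*} [NormedAddCommGroup E'] [NormedSpace ℝ E'] [TopologicalSpace H']
    [TopologicalSpace N] [ChartedSpace H' N] {J : ModelWithCorners ℝ E' H'}
    {b : N → M} {w : ∀ z, A (b z)} {D : Set N} (hw : ContMDiffOn J ((𝓡 n).prod 𝓘(ℝ, F)) ∞
      (fun z => (⟨b z, w z⟩ : TotalSpace F A)) D) (k : Fin (Module.finrank ℝ F)) :
    ContMDiffOn J 𝓘(ℝ) ∞ (fun z => cutCoord x₀ χ k (b z) (w z)) D := by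
  intro z hz
  have hb := ((contMDiffWithinAt_totalSpace).1 (hw z hz)).1
  by_cases hz₀ : b z ∈ (trivializationAt F A x₀).baseSet
  · have h := (((trivializationAt F A x₀).contMDiffWithinAt_iff
      ((trivializationAt F A x₀).mem_source.2 hz₀)).1 (hw z hz)).2
    have hl : ContMDiff 𝓘(ℝ, F) 𝓘(ℝ) ∞
        (LinearMap.toContinuousLinearMap ((Module.finBasis ℝ F).coord k)) :=
      (ContinuousLinearMap.contDiff _).contMDiff
    have h1 := (χ.contMDiff.contMDiffAt.comp_contMDiffWithinAt z hb).mul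
      (hl.contMDiffAt.comp_contMDiffWithinAt z h)
    have hev : ∀ᶠ y in 𝓝[D] z, b y ∈ (trivializationAt F A x₀).baseSet :=
      hb.continuousWithinAt.preimage_mem_nhdsWithin
        ((trivializationAt F A x₀).open_baseSet.mem_nhds hz₀)
    have he : ∀ y, b y ∈ (trivializationAt F A x₀).baseSet → cutCoord x₀ χ k (b y) (w y) =
        χ (b y) * (Module.finBasis ℝ F).coord k ((trivializationAt F A x₀) ⟨b y, w y⟩).2 := by
      intro y hy
      simp [cutCoord, (trivializationAt F A x₀).coe_linearMapAt_of_mem hy]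
    exact h1.congr_of_eventuallyEq (hev.mono he) (he z hz₀)
  · have hz₁ : b z ∈ (tsupport χ)ᶜ := fun h => hz₀ (hχ h)
    have hev : ∀ᶠ y in 𝓝[D] z, b y ∈ (tsupport χ)ᶜ :=
      hb.continuousWithinAt.preimage_mem_nhdsWithin
        ((isClosed_tsupport χ).isOpen_compl.mem_nhds hz₁)
    have he : ∀ y, b y ∈ (tsupport χ)ᶜ → cutCoord x₀ χ k (b y) (w y) = 0 := by
      intro y hy
      simp [cutCoord, image_eq_zero_of_notMem_tsupport hy]
    exact (contMDiffWithinAt_const (c := (0 : ℝ))).congr_of_eventuallyEq (hev.mono he) (he z hz₁)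

variable (n F A) in
/-- Around every point there is a local frame of `A` that extends to global sections, with
coordinate functions that extend to linear forms on `A`. -/
theorem exists_frame (x₀ : M) : ∃ (χ : C^∞⟮𝓡 n, M; ℝ⟯)
    (E : Fin (Module.finrank ℝ F) → Sec n M F A),
    tsupport χ ⊆ (trivializationAt F A x₀).baseSet ∧
    ∀ᶠ y in 𝓝 x₀, ∀ a : A y, a = ∑ k, cutCoord x₀ χ k y a • E k y := by
  set e := trivializationAt F A x₀
  have hx₀ : x₀ ∈ e.baseSet := FiberBundle.mem_baseSet_trivializationAt F A x₀
  obtain ⟨χ, hχ, hs⟩ := exists_cutoff (n := n) (e.open_baseSet.mem_nhds hx₀)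
  -- The sections carry a factor `χ` besides the one in the coordinates; both factors are 1 near
  -- `x₀`.
  refine ⟨χ, fun k => ⟨fun x => χ x • e.localFrame (Module.finBasis ℝ F) k x,
    χ.contMDiff.contMDiffOn.smul_section_of_tsupport e.open_baseSet hs
      (e.contMDiffOn_localFrame_baseSet ∞ (Module.finBasis ℝ F) k)⟩, hs, ?_⟩
  filter_upwards [hχ, e.open_baseSet.mem_nhds hx₀] with y hy hye a
  have h := (e.basisAt (Module.finBasis ℝ F) hye).sum_repr a
  conv_lhs => rw [← h]
  refine Finset.sum_congr rfl fun k _ => ?_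
  change _ = cutCoord x₀ χ k y a • (χ y • e.localFrame (Module.finBasis ℝ F) k y)
  rw [hy, one_smul, e.localFrame_apply_of_mem_baseSet _ hye]
  congr 1
  simp [cutCoord, hy, Trivialization.basisAt, e, e.coe_linearMapAt_of_mem hye]

theorem sec_sum_apply {κ : Type*} (s : Finset κ) (E : κ → Sec n M F A) (x : M) :
    (∑ k ∈ s, E k) x = ∑ k ∈ s, E k x := by
  induction s using Finset.cons_induction with
  | empty => rfl
  | cons k s hk ih =>
    rw [Finset.sum_cons, Finset.sum_cons, ← ih]
    rfl

/-- Serves to pass from identities for sections to identities in a fibre. The frame coefficients of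
`a` are taken as constants. -/
theorem exists_sec (x : M) (a : A x) : ∃ ε : Sec n M F A, ε x = a := by
  obtain ⟨χ, E, -, h⟩ := exists_frame n F A x
  refine ⟨∑ k, cutCoord x χ k x a • E k, ?_⟩
  conv_rhs => rw [h.self_of_nhds a]
  exact sec_sum_apply _ _ x

end Cutoffs

/-! ### From one-cocycles to lifts -/

section AffineHamiltonians

variable {n : ℕ} {M : Type*} [TopologicalSpace M]
  [ChartedSpace (EuclideanSpace ℝ (Fin n)) M] [IsManifold (𝓡 n) ∞ M]
  {F : Type*} [NormedAddCommGroup F] [NormedSpace ℝ F]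
  {A : M → Type*} [TopologicalSpace (TotalSpace F A)] [∀ x, TopologicalSpace (A x)]
  [FiberBundle F A] [∀ x, AddCommGroup (A x)] [∀ x, Module ℝ (A x)] [VectorBundle ℝ F A]
  {L : LieAlgebroid n M F A} {ι : Type*} {𝒰 : OpenCover M ι} {g : LineCocycle n 𝒰}

/-- The vector field that the anchor assigns to a section. -/
def LieAlgebroid.field (L : LieAlgebroid n M F A) (ε : Sec n M F A) (x : M) :
    TangentSpace (𝓡 n) x :=
  L.anchor x (ε x)

theorem covec_apply_field (x₀ y : M) (hy : y ∈ (extChartAt (𝓡 n) x₀).source) (ε : Sec n M F A)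
    (η : EuclideanSpace ℝ (Fin n) →L[ℝ] ℝ) :
    Aff.covec x₀ y η (L.anchor y (ε y)) =
      η (chartField x₀ (L.field ε) (extChartAt (𝓡 n) x₀ y)) := by
  rw [chartField_apply _ hy]
  rfl

/-- In coordinates, `⟨p_i | δ_ε⟩ + c(ε)` is affine in the momenta. -/
theorem loc_affine {h : ∀ r : Aff g, A r.base → ℝ} {c : ∀ x, A x → ℝ} {i : ι}
    (hh : ∀ (r : Aff g) (hi : r.base ∈ 𝒰.set i) (a : A r.base),
      h r a = r.mom i hi (L.anchor r.base a) + c r.base a) (x₀ : M) (ε : Sec n M F A)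
    {z : Aff.Phase n} (hz : z ∈ Aff.dom 𝒰 i x₀) :
    Aff.loc i x₀ (fun r => h r (ε r.base)) z = z.2 (chartField x₀ (L.field ε) z.1) +
      ((fun x => c x (ε x)) ∘ (extChartAt (𝓡 n) x₀).symm) z.1 := by
  rw [Aff.loc_of_mem_dom _ hz, hh _ hz.2, Aff.pt_mom_self hz.2]
  refine congrArg (· + _) ?_
  refine (covec_apply_field x₀ _ ((extChartAt (𝓡 n) x₀).map_target hz.1) ε z.2).trans ?_
  rw [(extChartAt (𝓡 n) x₀).right_inv hz.1]

theorem loc_affine_eventuallyEq {h : ∀ r : Aff g, A r.base → ℝ} {c : ∀ x, A x → ℝ} {i : ι}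
    (hh : ∀ (r : Aff g) (hi : r.base ∈ 𝒰.set i) (a : A r.base),
      h r a = r.mom i hi (L.anchor r.base a) + c r.base a) (x₀ : M) (ε : Sec n M F A)
    {z : Aff.Phase n} (hz : z ∈ Aff.dom 𝒰 i x₀) :
    Aff.loc i x₀ (fun r => h r (ε r.base)) =ᶠ[𝓝 z] fun z =>
      z.2 (chartField x₀ (L.field ε) z.1) +
        ((fun x => c x (ε x)) ∘ (extChartAt (𝓡 n) x₀).symm) z.1 :=
  Filter.eventually_of_mem ((Aff.isOpen_dom i x₀).mem_nhds hz) fun _ hw => loc_affine hh x₀ ε hw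

/-- A function of the position is presented as affine with zero vector field, so that
`canonicalBracket_affine` covers the anchor condition too. -/
theorem loc_comp_base_eventuallyEq (u : M → ℝ) {i : ι} {x₀ : M} {z : Aff.Phase n}
    (hz : z ∈ Aff.dom 𝒰 i x₀) :
    Aff.loc i x₀ (fun r : Aff g => u r.base) =ᶠ[𝓝 z] fun z =>
      z.2 ((fun _ => 0 : EuclideanSpace ℝ (Fin n) → EuclideanSpace ℝ (Fin n)) z.1) +
        (u ∘ (extChartAt (𝓡 n) x₀).symm) z.1 := by
  filter_upwards [(Aff.isOpen_dom i x₀).mem_nhds hz] with w hw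
  rw [Aff.loc_of_mem_dom _ hw, map_zero, zero_add]
  rfl

theorem isSmooth_affine {h : ∀ r : Aff g, A r.base → ℝ} {c : ι → ∀ x, A x → ℝ}
    (hh : ∀ (i : ι) (r : Aff g) (hi : r.base ∈ 𝒰.set i) (a : A r.base),
      h r a = r.mom i hi (L.anchor r.base a) + c i r.base a) (ε : Sec n M F A)
    (hc : ∀ i, ContMDiffOn (𝓡 n) 𝓘(ℝ) ∞ (fun x => c i x (ε x)) (𝒰.set i)) :
    Aff.IsSmooth fun r => h r (ε r.base) := by
  intro i x₀ z hz
  have h1 := contDiffAt_comp_extChartAt_symm hz.1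
    ((hc i _ hz.2).contMDiffAt ((𝒰.set i).isOpen.mem_nhds hz.2))
  have h2 := contDiffAt_chartField (L.anchor_smooth ε) hz.1
  refine ContDiffAt.contDiffWithinAt (ContDiffAt.congr_of_eventuallyEq ?_
    (loc_affine_eventuallyEq (hh i) x₀ ε hz))
  exact (contDiffAt_snd.clm_apply (h2.comp z contDiffAt_fst)).add (h1.comp z contDiffAt_fst)

/-- With second vector field zero, the affine bracket formula leaves only the derivative of `u`
along the anchor field. -/
theorem poisson_affine_base {h : ∀ r : Aff g, A r.base → ℝ} {c : ι → ∀ x, A x → ℝ}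
    (hh : ∀ (i : ι) (r : Aff g) (hi : r.base ∈ 𝒰.set i) (a : A r.base),
      h r a = r.mom i hi (L.anchor r.base a) + c i r.base a)
    (hc : ∀ i (ε : Sec n M F A), ContMDiffOn (𝓡 n) 𝓘(ℝ) ∞ (fun x => c i x (ε x)) (𝒰.set i))
    (ε : Sec n M F A) (u : C^∞⟮𝓡 n, M; ℝ⟯) (r : Aff g) :
    Aff.poisson (fun r => h r (ε r.base)) (fun r => u r.base) r =
      mvfderiv (𝓡 n) u r.base (L.anchor r.base (ε r.base)) := by
  obtain ⟨i, hi⟩ := 𝒰.covers r.base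
  have hs := mem_extChartAt_source (I := 𝓡 n) r.base
  have ht := (extChartAt (𝓡 n) r.base).map_source hs
  obtain ⟨η, hη⟩ := Aff.exists_eq_pt_of_mem r hi hs
  have hz := Aff.mem_dom hi hs η
  have hu : ContDiffAt ℝ ∞ (u ∘ (extChartAt (𝓡 n) r.base).symm)
      (extChartAt (𝓡 n) r.base r.base) :=
    contDiffAt_comp_extChartAt_symm ht u.contMDiff.contMDiffAt
  have h1 := Aff.poisson_pt (isSmooth_affine hh ε fun i => hc i ε)
    (Aff.isSmooth_comp_base (g := g) u.contMDiff) hi hs η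
  rw [← hη] at h1
  rw [h1, canonicalBracket_congr (loc_affine_eventuallyEq (hh i) _ ε hz)
    (loc_comp_base_eventuallyEq u hz), canonicalBracket_affine
      ((contDiffAt_chartField (L.anchor_smooth ε) ht).differentiableAt (by simp))
      ((contDiffAt_comp_extChartAt_symm ht ((hc i ε _ (by
        rwa [(extChartAt (𝓡 n) r.base).left_inv hs])).contMDiffAt
        ((𝒰.set i).isOpen.mem_nhds (by
          rwa [(extChartAt (𝓡 n) r.base).left_inv hs])))).differentiableAt (by simp))
      (differentiableAt_const _) (hu.differentiableAt (by simp))]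
  rw [mvfderiv_eq_fderiv_comp hs (u.contMDiff.contMDiffAt.mdifferentiableAt (by simp)),
    chartField_apply _ hs]
  simp [VectorField.lieBracket]
  rfl

/-- The coordinate fields bracket to the anchor of the bracket by `anchor_bracket`. Against the
Hamiltonian of the bracket the momentum terms cancel, and the first cocycle equation is left. The
formula is used both to build lifts and to extract cocycles. -/
theorem poisson_affine {h : ∀ r : Aff g, A r.base → ℝ} {c : ι → ∀ x, A x → ℝ}
    (hh : ∀ (i : ι) (r : Aff g) (hi : r.base ∈ 𝒰.set i) (a : A r.base),
      h r a = r.mom i hi (L.anchor r.base a) + c i r.base a)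
    (hc : ∀ i (ε : Sec n M F A), ContMDiffOn (𝓡 n) 𝓘(ℝ) ∞ (fun x => c i x (ε x)) (𝒰.set i))
    (ε₁ ε₂ : Sec n M F A) {i : ι} (r : Aff g) (hi : r.base ∈ 𝒰.set i) :
    Aff.poisson (fun r => h r (ε₁ r.base)) (fun r => h r (ε₂ r.base)) r =
      r.mom i hi (L.anchor r.base (L.bracket ε₁ ε₂ r.base)) +
        (mvfderiv (𝓡 n) (fun x => c i x (ε₂ x)) r.base (L.anchor r.base (ε₁ r.base)) -
          mvfderiv (𝓡 n) (fun x => c i x (ε₁ x)) r.base (L.anchor r.base (ε₂ r.base))) := by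
  have hs := mem_extChartAt_source (I := 𝓡 n) r.base
  have ht := (extChartAt (𝓡 n) r.base).map_source hs
  have hl := (extChartAt (𝓡 n) r.base).left_inv hs
  obtain ⟨η, hη⟩ : ∃ η, r.mom i hi = Aff.covec r.base r.base η := ⟨_, (Aff.exists_covec hs _).symm⟩
  have hr : r = Aff.pt g i r.base hi (Aff.covec r.base r.base η) := by rw [← hη, Aff.pt_mom]
  have hz := Aff.mem_dom hi hs η
  have h1 := Aff.poisson_pt (isSmooth_affine hh ε₁ fun i => hc i ε₁)
    (isSmooth_affine hh ε₂ fun i => hc i ε₂) hi hs η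
  rw [← hr] at h1
  have hX : ∀ ε, DifferentiableAt ℝ (chartField r.base (L.field ε))
      (extChartAt (𝓡 n) r.base r.base) := fun ε =>
    (contDiffAt_chartField (L.anchor_smooth ε) ht).differentiableAt (by simp)
  have hcM : ∀ ε : Sec n M F A, ContMDiffAt (𝓡 n) 𝓘(ℝ) ∞ (fun x => c i x (ε x)) r.base := fun ε =>
    (hc i ε _ hi).contMDiffAt ((𝒰.set i).isOpen.mem_nhds hi)
  have hC : ∀ ε : Sec n M F A, DifferentiableAt ℝ
      ((fun x => c i x (ε x)) ∘ (extChartAt (𝓡 n) r.base).symm)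
      (extChartAt (𝓡 n) r.base r.base) := fun ε =>
    (contDiffAt_comp_extChartAt_symm ht (by rw [hl]; exact hcM ε)).differentiableAt (by simp)
  have hd : ∀ ε ε' : Sec n M F A,
      mvfderiv (𝓡 n) (fun x => c i x (ε x)) r.base (L.anchor r.base (ε' r.base)) =
      fderiv ℝ ((fun x => c i x (ε x)) ∘ (extChartAt (𝓡 n) r.base).symm)
        (extChartAt (𝓡 n) r.base r.base)
        (chartField r.base (L.field ε') (extChartAt (𝓡 n) r.base r.base)) := fun ε ε' => by
    rw [mvfderiv_eq_fderiv_comp hs ((hcM ε).mdifferentiableAt (by simp)), chartField_apply _ hs]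
    rfl
  rw [h1, canonicalBracket_congr (loc_affine_eventuallyEq (hh i) _ ε₁ hz)
    (loc_affine_eventuallyEq (hh i) _ ε₂ hz), canonicalBracket_affine (hX _) (hC _) (hX _) (hC _),
    hd, hd, hη, L.anchor_bracket, ← mvfderiv_extChartAt_mlieBracket]
  rfl

variable {z : Z1 𝒰 L}

open Classical in
/-- The Hamiltonians `⟨p_i | δ_ε⟩ + c_i(ε)` of a one-cocycle. -/
def hamOf (z : Z1 𝒰 L) (r : Aff g) : A r.base →ₗ[ℝ] ℝ :=
  (r.mom _ (𝒰.covers r.base).choose_spec).toLinearMap ∘ₗ L.anchor r.base +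
    IsLinearMap.mk' ((z.1.1 (𝒰.covers r.base).choose).1 r.base)
      ((z.1.1 (𝒰.covers r.base).choose).2.1 r.base)

/-- The choice of trivialization does not matter: p_i - p_j = dc_ij, while c_j - c_i is the
derivative of c_ij along the anchor, so the two changes cancel. -/
theorem hamOf_apply (hz : z.1.2 = g.c) (i : ι) (r : Aff g) (hi : r.base ∈ 𝒰.set i)
    (a : A r.base) :
    hamOf z r a = r.mom i hi (L.anchor r.base a) + (z.1.1 i).1 r.base a := by
  set j := (𝒰.covers r.base).choose
  have hj : r.base ∈ 𝒰.set j := (𝒰.covers r.base).choose_spec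
  have h2 := z.2.2.1 i j r.base ⟨hi, hj⟩ a
  rw [hz] at h2
  have h3 := r.glue i j hi hj
  rw [h3]
  change r.mom j hj (L.anchor r.base a) + (z.1.1 j).1 r.base a =
    (r.mom j hj (L.anchor r.base a) + mvfderiv (𝓡 n) (g.c i j).1 r.base (L.anchor r.base a)) + _
  rw [h2]
  ring

/-- The lift described by a one-cocycle. -/
def liftOf (g : LineCocycle n 𝒰) (z : Z1 𝒰 L) (hz : z.1.2 = g.c) : Lift L g where
  ham r := hamOf z r
  smooth ε := isSmooth_affine (h := fun r a => hamOf z r a) (hamOf_apply hz) ε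
    fun i => (z.1.1 i).2.2.1 ε
  anchor ε f r := poisson_affine_base (h := fun r a => hamOf z r a) (hamOf_apply hz)
    (fun i ε => (z.1.1 i).2.2.1 ε) ε f r
  bracket ε₁ ε₂ r := by
    obtain ⟨i, hi⟩ := 𝒰.covers r.base
    rw [hamOf_apply hz i r hi, z.2.1 i _ hi]
    exact poisson_affine (h := fun r a => hamOf z r a) (hamOf_apply hz)
      (fun i ε => (z.1.1 i).2.2.1 ε) ε₁ ε₂ r hi

theorem describes_liftOf (g : LineCocycle n 𝒰) (z : Z1 𝒰 L) (hz : z.1.2 = g.c) :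
    Describes z (liftOf g z hz) :=
  ⟨hz, hamOf_apply hz⟩

end AffineHamiltonians

/-! ### From lifts to one-cocycles -/

section CocycleOfLift

variable {n : ℕ} {M : Type*} [TopologicalSpace M] [T2Space M]
  [ChartedSpace (EuclideanSpace ℝ (Fin n)) M] [IsManifold (𝓡 n) ∞ M]
  {F : Type*} [NormedAddCommGroup F] [NormedSpace ℝ F] [FiniteDimensional ℝ F]
  {A : M → Type*} [TopologicalSpace (TotalSpace F A)] [∀ x, TopologicalSpace (A x)]
  [FiberBundle F A] [∀ x, AddCommGroup (A x)] [∀ x, Module ℝ (A x)] [VectorBundle ℝ F A]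
  [ContMDiffVectorBundle ∞ F A (𝓡 n)]
  {L : LieAlgebroid n M F A} {ι : Type*} {𝒰 : OpenCover M ι} {g : LineCocycle n 𝒰}

/-- The bracket with a function of the position sees only momentum derivatives. The anchor condition
is therefore tested on a global function that near `x` is the linear coordinate `ζ`. -/
theorem fderiv_loc_lift (h : Lift L g) (ε : Sec n M F A) {i : ι} {x : M} (hi : x ∈ 𝒰.set i)
    (η ζ : EuclideanSpace ℝ (Fin n) →L[ℝ] ℝ) :
    fderiv ℝ (Aff.loc i x fun r => h.ham r (ε r.base)) (extChartAt (𝓡 n) x x, η) (0, ζ) =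
      ζ (chartField x (L.field ε) (extChartAt (𝓡 n) x x)) := by
  have hs := mem_extChartAt_source (I := 𝓡 n) x
  have hz := Aff.mem_dom hi hs η
  obtain ⟨u, hu⟩ := exists_extend_fun (isOpen_extChartAt_source (I := 𝓡 n) x) hs
    (f := fun y => ζ (extChartAt (𝓡 n) x y)) fun y hy =>
      (ζ.contDiff.contMDiff.contMDiffAt.comp y (contMDiffAt_extChartAt_of_mem hy)).contMDiffWithinAt
  have h1 := h.anchor ε u (Aff.pt g i x hi (Aff.covec x x η))
  rw [Aff.poisson_pt (h.smooth ε) (Aff.isSmooth_comp_base u.contMDiff) hi hs η] at h1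
  have hud : mvfderiv (𝓡 n) u x = Aff.covec x x ζ := by
    rw [mvfderiv_eq_fderiv_comp hs (u.contMDiff.contMDiffAt.mdifferentiableAt (by simp))]
    have e : u ∘ (extChartAt (𝓡 n) x).symm =ᶠ[𝓝 (extChartAt (𝓡 n) x x)] ζ := by
      filter_upwards [(continuousAt_extChartAt_symm (I := 𝓡 n) x).eventually
        (by rw [(extChartAt (𝓡 n) x).left_inv hs]; exact hu),
        extChartAt_target_mem_nhds (I := 𝓡 n) x] with q hq hq'
      refine hq.trans ?_
      rw [(extChartAt (𝓡 n) x).right_inv hq']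
    rw [e.fderiv_eq, ζ.fderiv]
    rfl
  have hloc : Aff.loc i x (fun r : Aff g => u r.base) =ᶠ[𝓝 (extChartAt (𝓡 n) x x, η)]
      fun z => ζ z.1 := by
    have := Aff.loc_eventuallyEq (g := g) (f := fun r => u r.base)
      (k := fun r => ζ (extChartAt (𝓡 n) x r.base)) (i := i) (x₀ := x) hi hs
      (hu.mono fun w hw r hr => by rw [hr]; exact hw) η
    filter_upwards [this, (Aff.isOpen_dom i x).mem_nhds hz] with w hw hw'
    rw [hw, Aff.loc_of_mem_dom _ hw']
    change ζ (extChartAt (𝓡 n) x ((extChartAt (𝓡 n) x).symm w.1)) = _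
    rw [(extChartAt (𝓡 n) x).right_inv hw'.1]
  rw [canonicalBracket_congr Filter.EventuallyEq.rfl hloc, canonicalBracket_eq] at h1
  have hfd : fderiv ℝ (fun z : Aff.Phase n => ζ z.1) (extChartAt (𝓡 n) x x, η) =
      ζ ∘L ContinuousLinearMap.fst ℝ _ _ :=
    (ζ.hasFDerivAt.comp _ hasFDerivAt_fst).fderiv
  rw [hfd] at h1
  -- Only the position part of the Hamiltonian vector pairs with `(0, ζ)`, and `h1` computes `ζ` on
  -- it.
  rw [← symplecticForm_hamVec]
  refine Eq.trans ?_ (h1.trans ?_)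
  · simp [symplecticForm]
  · rw [chartField_apply _ hs]
    change mvfderiv (𝓡 n) u x (L.anchor x (ε x)) = _
    rw [hud]
    rfl

/-- The Hamiltonians of a lift are affine in the momenta. -/
theorem Lift.ham_eq (h : Lift L g) (i : ι) (r : Aff g) (hi : r.base ∈ 𝒰.set i) (a : A r.base) :
    h.ham r a = r.mom i hi (L.anchor r.base a) + h.ham (Aff.pt g i r.base hi 0) a := by
  obtain ⟨ε, rfl⟩ := exists_sec (n := n) (F := F) r.base a
  have hs := mem_extChartAt_source (I := 𝓡 n) r.base
  obtain ⟨η, hη⟩ : ∃ η, r.mom i hi = Aff.covec r.base r.base η := ⟨_, (Aff.exists_covec hs _).symm⟩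
  have hr : r = Aff.pt g i r.base hi (Aff.covec r.base r.base η) := by rw [← hη, Aff.pt_mom]
  set H := Aff.loc i r.base fun r => h.ham r (ε r.base)
  set q := extChartAt (𝓡 n) r.base r.base
  set X := chartField r.base (L.field ε) q
  -- After subtracting `η X` the derivative along the fibre vanishes at every momentum, so the
  -- difference is constant and may be taken at zero momentum.
  have hconst : ∀ η : EuclideanSpace ℝ (Fin n) →L[ℝ] ℝ, H (q, η) - η X = H (q, 0) - (0 : _ →L[ℝ] ℝ) X := by
    intro η
    have hd : ∀ η, HasFDerivAt (fun η : EuclideanSpace ℝ (Fin n) →L[ℝ] ℝ => H (q, η) - η X)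
        (0 : (EuclideanSpace ℝ (Fin n) →L[ℝ] ℝ) →L[ℝ] ℝ) η := by
      intro η
      have h1 : HasFDerivAt H (fderiv ℝ H (q, η)) (q, η) :=
        (((h.smooth ε).contDiffAt (Aff.mem_dom hi hs η)).differentiableAt (by simp)).hasFDerivAt
      have h2 := (h1.comp η ((hasFDerivAt_const q η).prodMk (hasFDerivAt_id η))).sub
        ((ContinuousLinearMap.apply ℝ ℝ X).hasFDerivAt (x := η))
      refine h2.congr_fderiv ?_
      ext ζ
      exact sub_eq_zero.2 (fderiv_loc_lift h ε hi η ζ)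
    exact is_const_of_fderiv_eq_zero (𝕜 := ℝ) (fun η => (hd η).differentiableAt)
      (fun η => (hd η).fderiv) η 0
  have hη' := hconst η
  have e1 : H (q, η) = h.ham r (ε r.base) :=
    (Aff.loc_apply _ hi hs η).trans (congrArg (fun r : Aff g => h.ham r (ε r.base)) hr.symm)
  have e2 : H (q, 0) = h.ham (Aff.pt g i r.base hi 0) (ε r.base) := by
    refine (Aff.loc_apply _ hi hs 0).trans ?_
    have : Aff.covec r.base r.base (0 : EuclideanSpace ℝ (Fin n) →L[ℝ] ℝ) = 0 := by
      ext v; rfl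
    rw [this]
    rfl
  rw [e1, e2] at hη'
  rw [hη, covec_apply_field _ _ hs]
  have : (0 : EuclideanSpace ℝ (Fin n) →L[ℝ] ℝ) X = 0 := rfl
  linarith

open Classical in
/-- The linear forms `c_i` of a lift: the Hamiltonians at zero momentum. -/
def Lift.form (h : Lift L g) (i : ι) (x : M) (a : A x) : ℝ :=
  if hi : x ∈ 𝒰.set i then h.ham (Aff.pt g i x hi 0) a else 0

theorem Lift.ham_eq_form (h : Lift L g) (i : ι) (r : Aff g) (hi : r.base ∈ 𝒰.set i)
    (a : A r.base) : h.ham r a = r.mom i hi (L.anchor r.base a) + h.form i r.base a := by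
  rw [h.ham_eq i r hi, Lift.form, dif_pos hi]

/-- Near `x` the form is the smooth coordinate expression of the Hamiltonian restricted to `η = 0`,
since zero components mean the zero covector. -/
theorem Lift.contMDiffOn_form (h : Lift L g) (i : ι) (ε : Sec n M F A) :
    ContMDiffOn (𝓡 n) 𝓘(ℝ) ∞ (fun x => h.form i x (ε x)) (𝒰.set i) := by
  intro x hx
  have hs := mem_extChartAt_source (I := 𝓡 n) x
  have h1 := (h.smooth ε).contDiffAt (Aff.mem_dom hx hs (0 : EuclideanSpace ℝ (Fin n) →L[ℝ] ℝ))
  have h0 : ContDiffAt ℝ ∞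
      (fun q => Aff.loc i x (fun r => h.ham r (ε r.base)) (q, 0)) (extChartAt (𝓡 n) x x) :=
    ContDiffAt.comp (extChartAt (𝓡 n) x x) h1 (contDiffAt_id.prodMk contDiffAt_const)
  have h2 : ContMDiffAt (𝓡 n) 𝓘(ℝ) ∞
      (fun y => Aff.loc i x (fun r => h.ham r (ε r.base)) (extChartAt (𝓡 n) x y, 0)) x :=
    h0.contMDiffAt.comp x contMDiffAt_extChartAt
  refine (h2.congr_of_eventuallyEq ?_).contMDiffWithinAt
  filter_upwards [(𝒰.set i).isOpen.mem_nhds hx, extChartAt_source_mem_nhds (I := 𝓡 n) x] with y hy hy'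
  rw [Aff.loc_apply _ hy hy', Lift.form, dif_pos (show y ∈ 𝒰.set i from hy)]
  have : Aff.covec x y (0 : EuclideanSpace ℝ (Fin n) →L[ℝ] ℝ) = 0 := by
    ext v; rfl
  rw [this]
  rfl

/-- The one-cocycle of a lift. -/
def Lift.cocycle (h : Lift L g) : Z1 𝒰 L :=
  ⟨(fun i => ⟨h.form i, fun x => by
      by_cases hx : x ∈ 𝒰.set i
      · refine ⟨fun a b => ?_, fun t a => ?_⟩
        · simp only [Lift.form, dif_pos hx]
          exact map_add (h.ham (Aff.pt g i x hx 0)) a b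
        · simp only [Lift.form, dif_pos hx]
          exact map_smul (h.ham (Aff.pt g i x hx 0)) t a
      · constructor <;> simp [Lift.form, hx],
    h.contMDiffOn_form i, fun x hx => by funext a; simp [Lift.form, hx]⟩, g.c), by
    refine ⟨fun i x hx ε₁ ε₂ => ?_, fun i j x hx a => ?_, g.cocycle⟩
    -- Two expressions for the same bracket share their momentum term; cancelling it leaves the
    -- first cocycle equation.
    · have h1 := poisson_affine (h := fun r a => h.ham r a) h.ham_eq_form h.contMDiffOn_form ε₁ ε₂
        (Aff.pt g i x hx 0) hx
      rw [h.bracket, h.ham_eq_form i (Aff.pt g i x hx 0) hx] at h1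
      exact add_left_cancel h1
    -- The Hamiltonian at one point is written in two trivializations; the gluing law of the momenta
    -- turns this into the second cocycle equation.
    · have h1 := h.ham_eq_form i (Aff.pt g i x hx.1 0) hx.1 a
      have h2 := h.ham_eq_form j (Aff.pt g i x hx.1 0) hx.2 a
      rw [(Aff.pt g i x hx.1 0).glue i j hx.1 hx.2] at h1
      rw [h1] at h2
      let p : TangentSpace (𝓡 n) x →L[ℝ] ℝ := (Aff.pt g i x hx.1 0).mom j hx.2
      change (p (L.anchor x a) + mvfderiv (𝓡 n) (g.c i j).1 x (L.anchor x a)) + h.form i x a =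
        p (L.anchor x a) + h.form j x a at h2
      change mvfderiv (𝓡 n) (g.c i j).1 x (L.anchor x a) = h.form j x a - h.form i x a
      linarith⟩

theorem Lift.describes_cocycle (h : Lift L g) : Describes h.cocycle h :=
  ⟨rfl, h.ham_eq_form⟩

theorem Describes.form_eq {z : Z1 𝒰 L} {h : Lift L g} (hz : Describes z h) {i : ι} {x : M}
    (hx : x ∈ 𝒰.set i) (a : A x) : (z.1.1 i).1 x a = h.ham (Aff.pt g i x hx 0) a := by
  have h1 := hz.2 i (Aff.pt g i x hx 0) hx a
  rw [Aff.pt_mom_self hx] at h1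
  rw [h1]
  exact (zero_add _).symm

/-- On U_i the form is the Hamiltonian at zero momentum. Off U_i both forms vanish by the convention
of extension by zero. -/
theorem Describes.unique {z z' : Z1 𝒰 L} {h : Lift L g} (hz : Describes z h)
    (hz' : Describes z' h) : z = z' := by
  refine Subtype.ext (Prod.ext ?_ (hz.1.trans hz'.1.symm))
  funext i
  refine Subtype.ext ?_
  funext x
  by_cases hx : x ∈ 𝒰.set i
  · funext a
    rw [hz.form_eq hx, hz'.form_eq hx]
  · rw [(z.1.1 i).2.2.2 x hx, (z'.1.1 i).2.2.2 x hx]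

end CocycleOfLift

/-! ### Coboundaries and equivalence of lifts -/

section Coboundaries

variable {n : ℕ} {M : Type*} [TopologicalSpace M]
  [ChartedSpace (EuclideanSpace ℝ (Fin n)) M] [IsManifold (𝓡 n) ∞ M]
  {F : Type*} [NormedAddCommGroup F] [NormedSpace ℝ F]
  {A : M → Type*} [TopologicalSpace (TotalSpace F A)] [∀ x, TopologicalSpace (A x)]
  [FiberBundle F A] [∀ x, AddCommGroup (A x)] [∀ x, Module ℝ (A x)] [VectorBundle ℝ F A]
  {L : LieAlgebroid n M F A} {ι : Type*} {𝒰 : OpenCover M ι}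

open Classical in
/-- The form `ε ↦ δ_ε f` on `U`. -/
def anchorForm (L : LieAlgebroid n M F A) {U : Opens M} (f : funOn n U) (x : M) (a : A x) : ℝ :=
  if x ∈ U then mvfderiv (𝓡 n) f.1 x (L.anchor x a) else 0

theorem anchorForm_of_mem {U : Opens M} (f : funOn n U) {x : M} (hx : x ∈ U) (a : A x) :
    anchorForm L f x a = mvfderiv (𝓡 n) f.1 x (L.anchor x a) :=
  if_pos hx

theorem anchorForm_mem (L : LieAlgebroid n M F A) {U : Opens M} (f : funOn n U) :
    anchorForm L f ∈ formOn n F A U := by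
  refine ⟨fun x => ?_, fun ε => ?_, fun x hx => funext fun a => if_neg hx⟩
  · by_cases hx : x ∈ U
    · refine ⟨fun a b => ?_, fun t a => ?_⟩
      · simp only [anchorForm_of_mem f hx, map_add]
      · simp only [anchorForm_of_mem f hx, map_smul]
    · constructor <;> simp [anchorForm, hx]
  · exact (contMDiffOn_mvfderiv_apply U.isOpen f.2.1 (L.anchor_smooth ε)).congr
      fun x hx => anchorForm_of_mem f hx _

/-- The anchor respects brackets, and differentiation along a Lie bracket is a commutator. -/
theorem anchorForm_bracket {U : Opens M} (f : funOn n U) {x : M} (hx : x ∈ U)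
    (ε₁ ε₂ : Sec n M F A) :
    anchorForm L f x (L.bracket ε₁ ε₂ x) =
      mvfderiv (𝓡 n) (fun y => anchorForm L f y (ε₂ y)) x (L.anchor x (ε₁ x)) -
        mvfderiv (𝓡 n) (fun y => anchorForm L f y (ε₁ y)) x (L.anchor x (ε₂ x)) := by
  have key : ∀ ε : Sec n M F A, mvfderiv (𝓡 n) (fun y => anchorForm L f y (ε y)) x =
      mvfderiv (𝓡 n) (fun y => mvfderiv (𝓡 n) f.1 y (L.anchor y (ε y))) x := fun ε => by
    have he : (fun y => anchorForm L f y (ε y)) =ᶠ[𝓝 x]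
        fun y => mvfderiv (𝓡 n) f.1 y (L.anchor y (ε y)) :=
      Filter.eventually_of_mem (U.isOpen.mem_nhds hx) fun y hy => anchorForm_of_mem f hy _
    simp only [mvfderiv]
    rw [he.mfderiv_eq]
    rfl
  rw [key, key, anchorForm_of_mem f hx, L.anchor_bracket]
  exact mvfderiv_mlieBracket (L.anchor_smooth ε₁) (L.anchor_smooth ε₂) U.isOpen f.2.1 hx

open Classical in
/-- The difference `f_j - f_i` on `U_i ∩ U_j`. -/
def cechDiff (f : C0 n 𝒰) (i j : ι) (x : M) : ℝ :=
  if x ∈ 𝒰.set i ⊓ 𝒰.set j then (f j).1 x - (f i).1 x else 0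

theorem cechDiff_of_mem (f : C0 n 𝒰) {i j : ι} {x : M} (hx : x ∈ 𝒰.set i ⊓ 𝒰.set j) :
    cechDiff f i j x = (f j).1 x - (f i).1 x :=
  if_pos hx

theorem cechDiff_mem (f : C0 n 𝒰) (i j : ι) : cechDiff f i j ∈ funOn n (𝒰.set i ⊓ 𝒰.set j) :=
  ⟨(((f j).2.1.mono fun _ hx => hx.2).sub ((f i).2.1.mono fun _ hx => hx.1)).congr
    fun _ hx => cechDiff_of_mem f hx, fun _ hx => if_neg hx⟩

/-- The coboundary of a zero-cochain, as a one-cocycle. -/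
def coboundary (L : LieAlgebroid n M F A) (f : C0 n 𝒰) : Z1 𝒰 L :=
  ⟨(fun i => ⟨anchorForm L (f i), anchorForm_mem L (f i)⟩,
    fun i j => ⟨cechDiff f i j, cechDiff_mem f i j⟩), by
    refine ⟨fun i x hx ε₁ ε₂ => anchorForm_bracket (f i) hx ε₁ ε₂, fun i j x hx a => ?_,
      fun i j k x hx => ?_⟩
    · have he : cechDiff f i j =ᶠ[𝓝 x] (f j).1 - (f i).1 :=
        Filter.eventually_of_mem ((𝒰.set i ⊓ 𝒰.set j).isOpen.mem_nhds hx)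
          fun y hy => cechDiff_of_mem f hy
      have hd : mvfderiv (𝓡 n) (cechDiff f i j) x =
          mvfderiv (𝓡 n) (f j).1 x - mvfderiv (𝓡 n) (f i).1 x := by
        rw [← mvfderiv_sub (mdiffAt_of_funOn (f j) hx.2) (mdiffAt_of_funOn (f i) hx.1)]
        simp only [mvfderiv]
        rw [he.mfderiv_eq, he.self_of_nhds]
      change mvfderiv (𝓡 n) (cechDiff f i j) x _ = anchorForm L (f j) x a - anchorForm L (f i) x a
      rw [hd, anchorForm_of_mem _ hx.1, anchorForm_of_mem _ hx.2]
      rfl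
    · change cechDiff f i k x = cechDiff f i j x + cechDiff f j k x
      rw [cechDiff_of_mem f ⟨hx.1.1, hx.2⟩, cechDiff_of_mem f hx.1,
        cechDiff_of_mem f ⟨hx.1.2, hx.2⟩]
      ring⟩

/-- Membership of `-z + z'` in the coboundaries, rearranged to the shape in which gauge
transformations act. -/
theorem mk_eq_mk_iff {z z' : Z1 𝒰 L} :
    (QuotientAddGroup.mk z : H1 𝒰 L) = QuotientAddGroup.mk z' ↔ ∃ f : C0 n 𝒰,
      (∀ i, ∀ x ∈ 𝒰.set i, ∀ a : A x, (z'.1.1 i).1 x a =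
        (z.1.1 i).1 x a + mvfderiv (𝓡 n) (f i).1 x (L.anchor x a)) ∧
      ∀ i j, ∀ x ∈ 𝒰.set i ⊓ 𝒰.set j,
        (z'.1.2 i j).1 x = (z.1.2 i j).1 x + ((f j).1 x - (f i).1 x) := by
  rw [QuotientAddGroup.eq]
  change (∃ f : C0 n 𝒰,
      (∀ i, ∀ x ∈ 𝒰.set i, ∀ a : A x, -(z.1.1 i).1 x a + (z'.1.1 i).1 x a =
        mvfderiv (𝓡 n) (f i).1 x (L.anchor x a)) ∧
      ∀ i j, ∀ x ∈ 𝒰.set i ⊓ 𝒰.set j,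
        -(z.1.2 i j).1 x + (z'.1.2 i j).1 x = (f j).1 x - (f i).1 x) ↔ _
  simp only [neg_add_eq_iff_eq_add]

theorem mk_add_coboundary (z : Z1 𝒰 L) (f : C0 n 𝒰) :
    (QuotientAddGroup.mk (z + coboundary L f) : H1 𝒰 L) = QuotientAddGroup.mk z :=
  (mk_eq_mk_iff.2 ⟨f, fun i _ hx a => congrArg ((z.1.1 i).1 _ a + ·) (anchorForm_of_mem (f i) hx a),
    fun i j _ hx => congrArg ((z.1.2 i j).1 _ + ·) (cechDiff_of_mem f hx)⟩).symm

/-- The gauge map subtracts df_i from the momentum, hence the derivative of f_i along the anchor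
from the linear part of the Hamiltonian; c'_i has to exceed c_i by just this amount. The same `f`
thus serves as equivalence and as bounding cochain. -/
theorem liftEquiv_iff {g g' : LineCocycle n 𝒰} {h : Lift L g} {h' : Lift L g'} {z z' : Z1 𝒰 L}
    (hz : Describes z h) (hz' : Describes z' h') :
    LiftEquiv L 𝒰 ⟨g, h⟩ ⟨g', h'⟩ ↔
      (QuotientAddGroup.mk z : H1 𝒰 L) = QuotientAddGroup.mk z' := by
  have key : ∀ (f : C0 n 𝒰) (H : ∀ i j, ∀ x ∈ 𝒰.set i ⊓ 𝒰.set j,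
      (g'.c i j).1 x = (g.c i j).1 x + ((f j).1 x - (f i).1 x)) (r : Aff g) (a : A r.base) (i : ι),
      r.base ∈ 𝒰.set i → (h'.ham (Aff.gauge f H r) a = h.ham r a ↔
        (z'.1.1 i).1 r.base a =
          (z.1.1 i).1 r.base a + mvfderiv (𝓡 n) (f i).1 r.base (L.anchor r.base a)) := by
    intro f H r a i hi
    have h1 : h'.ham (Aff.gauge f H r) a = (r.mom i hi (L.anchor r.base a) -
        mvfderiv (𝓡 n) (f i).1 r.base (L.anchor r.base a)) + (z'.1.1 i).1 r.base a :=
      hz'.2 i (Aff.gauge f H r) hi a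
    rw [h1, hz.2 i r hi a]
    constructor <;> intro h2 <;> linarith
  rw [mk_eq_mk_iff, hz.1, hz'.1]
  constructor
  · rintro ⟨f, H, hf⟩
    exact ⟨f, fun i x hx a => (key f H (Aff.pt g i x hx 0) a i hx).1
      (hf (Aff.pt g i x hx 0) a), H⟩
  · rintro ⟨f, hf, H⟩
    refine ⟨f, H, fun r a => ?_⟩
    obtain ⟨i, hi⟩ := 𝒰.covers r.base
    exact (key f H r a i hi).2 (hf i _ hi a)

end Coboundaries

/-! ### Partition of unity and the classification of lifts -/

section Classification

variable {n : ℕ} {M : Type*} [TopologicalSpace M] [T2Space M] [SigmaCompactSpace M]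
  [ChartedSpace (EuclideanSpace ℝ (Fin n)) M] [IsManifold (𝓡 n) ∞ M]
  {ι : Type*} {𝒰 : OpenCover M ι}

/-- Smooth Čech one-cocycles are coboundaries. -/
theorem LineCocycle.exists_eq_sub (b : LineCocycle n 𝒰) : ∃ f : C0 n 𝒰,
    ∀ i j, ∀ x ∈ 𝒰.set i ⊓ 𝒰.set j, (b.c i j).1 x = (f j).1 x - (f i).1 x := by
  classical
  obtain ⟨ρ, hρ⟩ := SmoothPartitionOfUnity.exists_isSubordinate (𝓡 n) (isClosed_univ (X := M))
    (fun i => (𝒰.set i : Set M)) (fun i => (𝒰.set i).isOpen)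
    fun x _ => Set.mem_iUnion.2 (𝒰.covers x)
  have hsupp : ∀ k x, ρ k x ≠ 0 → x ∈ 𝒰.set k := fun k x hx =>
    hρ k (subset_tsupport _ hx)
  -- The witness is f_i = ∑ₖ ρₖ c_ki, the contraction by a partition of unity.
  refine ⟨fun i => ⟨fun x => if x ∈ 𝒰.set i then ∑ᶠ k, ρ k x • (b.c k i).1 x else 0,
    fun x hx => ?_, fun x hx => if_neg hx⟩, fun i j x hx => ?_⟩
  · have h1 : ContMDiffAt (𝓡 n) 𝓘(ℝ) ∞ (fun x => ∑ᶠ k, ρ k x • (b.c k i).1 x) x :=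
      ρ.contMDiffAt_finsum fun k hk =>
        ((b.c k i).2.1 x ⟨hρ k hk, hx⟩).contMDiffAt
          ((𝒰.set k ⊓ 𝒰.set i).isOpen.mem_nhds ⟨hρ k hk, hx⟩)
    exact (h1.congr_of_eventuallyEq (Filter.eventually_of_mem ((𝒰.set i).isOpen.mem_nhds hx)
      fun y hy => if_pos hy)).contMDiffWithinAt
  · have hfin : ∀ u : ι → ℝ, (Function.support fun k => ρ k x • u k).Finite := fun u =>
      (ρ.locallyFinite.point_finite x).subset fun k hk h0 => hk (by
        have h0' : ρ k x = 0 := h0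
        simp [h0'])
    change _ = (if x ∈ 𝒰.set j then _ else 0) - (if x ∈ 𝒰.set i then _ else 0)
    rw [if_pos (show x ∈ 𝒰.set i from hx.1), if_pos (show x ∈ 𝒰.set j from hx.2),
       ← finsum_sub_distrib (hfin _) (hfin _)]
    -- Where ρₖ does not vanish, x lies in U_k and the cocycle identity gives c_kj - c_ki = c_ij;
    -- summing uses ∑ ρₖ = 1.
    have h2 : ∀ k, ρ k x • (b.c k j).1 x - ρ k x • (b.c k i).1 x = ρ k x * (b.c i j).1 x := by
      intro k
      by_cases hk : ρ k x = 0
      · simp [hk]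
      · rw [b.cocycle k i j x ⟨⟨hsupp k x hk, hx.1⟩, hx.2⟩]
        simp only [smul_eq_mul]
        ring
    rw [finsum_congr h2, ← finsum_mul, ρ.sum_eq_one (Set.mem_univ x), one_mul]

variable {F : Type*} [NormedAddCommGroup F] [NormedSpace ℝ F]
  {A : M → Type*} [TopologicalSpace (TotalSpace F A)] [∀ x, TopologicalSpace (A x)]
  [FiberBundle F A] [∀ x, AddCommGroup (A x)] [∀ x, Module ℝ (A x)] [VectorBundle ℝ F A]
  {L : LieAlgebroid n M F A}

/-- Every class has a representative with prescribed Čech component. -/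
theorem exists_representative (g : LineCocycle n 𝒰) (ξ : H1 𝒰 L) :
    ∃ z : Z1 𝒰 L, QuotientAddGroup.mk z = ξ ∧ z.1.2 = g.c := by
  obtain ⟨w, rfl⟩ := QuotientAddGroup.mk_surjective ξ
  -- The two Čech components differ by a Čech cocycle. A cochain `f` bounding it corrects `w`
  -- without changing its class.
  obtain ⟨f, hf⟩ := LineCocycle.exists_eq_sub (⟨g.c - w.1.2, fun i j k x hx => by
    have h1 := g.cocycle i j k x hx
    have h2 := w.2.2.2 i j k x hx
    change (g.c i k).1 x - (w.1.2 i k).1 x =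
      ((g.c i j).1 x - (w.1.2 i j).1 x) + ((g.c j k).1 x - (w.1.2 j k).1 x)
    rw [h1, h2]
    ring⟩ : LineCocycle n 𝒰)
  refine ⟨w + coboundary L f, mk_add_coboundary w f, ?_⟩
  funext i j
  refine Subtype.ext (funext fun x => ?_)
  change (w.1.2 i j).1 x + cechDiff f i j x = (g.c i j).1 x
  by_cases hx : x ∈ 𝒰.set i ⊓ 𝒰.set j
  · have h1 : (g.c i j).1 x - (w.1.2 i j).1 x = (f j).1 x - (f i).1 x := hf i j x hx
    rw [cechDiff_of_mem f hx]
    linarith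
  -- Off the overlap all terms are zero by convention, so the Čech components are equal as functions
  -- on M.
  · rw [(w.1.2 i j).2.2 x hx, (g.c i j).2.2 x hx, cechDiff, if_neg hx, add_zero]

variable [FiniteDimensional ℝ F] [ContMDiffVectorBundle ∞ F A (𝓡 n)]

/-- Equivalence classes of lifts correspond to cohomology classes. -/
def liftClass (L : LieAlgebroid n M F A) (𝒰 : OpenCover M ι) :
    Quotient (LiftEquiv L 𝒰) ≃ H1 𝒰 L :=
  Equiv.ofBijective
    (Quotient.lift (fun s => QuotientAddGroup.mk s.2.cocycle) fun s t hst =>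
      (liftEquiv_iff s.2.describes_cocycle t.2.describes_cocycle).1 hst) <| by
    refine ⟨?_, fun ξ => ?_⟩
    · rintro ⟨s⟩ ⟨t⟩ hst
      exact Quotient.sound ((liftEquiv_iff s.2.describes_cocycle t.2.describes_cocycle).2 hst)
    · obtain ⟨z, rfl⟩ := QuotientAddGroup.mk_surjective ξ
      refine ⟨Quotient.mk _ ⟨⟨z.1.2, z.2.2.2⟩, liftOf _ z rfl⟩, ?_⟩
      exact congrArg QuotientAddGroup.mk
        ((Lift.describes_cocycle _).unique (describes_liftOf ⟨z.1.2, z.2.2.2⟩ z rfl))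

theorem liftClass_mk {g : LineCocycle n 𝒰} {h : Lift L g} {z : Z1 𝒰 L} (hz : Describes z h) :
    liftClass L 𝒰 (Quotient.mk _ ⟨g, h⟩) = QuotientAddGroup.mk z :=
  congrArg QuotientAddGroup.mk (h.describes_cocycle.unique hz)

end Classification

/-! ### Frames and sections of the pulled-back bundle -/

section PullBackSections

variable {n : ℕ} {M : Type*} [TopologicalSpace M] [T2Space M]
  [ChartedSpace (EuclideanSpace ℝ (Fin n)) M] [IsManifold (𝓡 n) ∞ M]
  {F : Type*} [NormedAddCommGroup F] [NormedSpace ℝ F] [FiniteDimensional ℝ F]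
  {A : M → Type*} [TopologicalSpace (TotalSpace F A)] [∀ x, TopologicalSpace (A x)]
  [FiberBundle F A] [∀ x, AddCommGroup (A x)] [∀ x, Module ℝ (A x)] [VectorBundle ℝ F A]
  [ContMDiffVectorBundle ∞ F A (𝓡 n)]
  {L : LieAlgebroid n M F A} {ι : Type*} {𝒰 : OpenCover M ι} {g : LineCocycle n 𝒰}

variable (n F A) in
/-- A local frame of `A`, extended to global sections, with a cut-off of its coordinates. -/
structure CutFrame where
  center : M
  cutoff : C^∞⟮𝓡 n, M; ℝ⟯
  sec : Fin (Module.finrank ℝ F) → Sec n M F A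
  supp : tsupport cutoff ⊆ (trivializationAt F A center).baseSet

/-- The cut-off coordinates with respect to the frame. -/
def CutFrame.coord (Φ : CutFrame n F A) (k : Fin (Module.finrank ℝ F)) (x : M) : A x →ₗ[ℝ] ℝ :=
  cutCoord Φ.center Φ.cutoff k x

/-- Near `y` the sections are a frame, with its coordinates. -/
def CutFrame.IsFrameAt (Φ : CutFrame n F A) (y : M) : Prop :=
  ∀ᶠ w in 𝓝 y, ∀ a : A w, a = ∑ k, Φ.coord k w a • Φ.sec k w

variable (n F A) in
theorem CutFrame.exists_isFrameAt (x : M) : ∃ Φ : CutFrame n F A, Φ.IsFrameAt x := by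
  obtain ⟨χ, E, hs, hE⟩ := exists_frame n F A x
  exact ⟨⟨x, χ, E, hs⟩, hE⟩

theorem CutFrame.contMDiff_coord (Φ : CutFrame n F A) (k : Fin (Module.finrank ℝ F))
    (ε : Sec n M F A) : ContMDiff (𝓡 n) 𝓘(ℝ) ∞ fun x => Φ.coord k x (ε x) :=
  contMDiffOn_univ.1 (contMDiffOn_cutCoord Φ.supp ε.contMDiff.contMDiffOn k)

/-- The coordinates of a section, as smooth functions. -/
def CutFrame.coordSec (Φ : CutFrame n F A) (k : Fin (Module.finrank ℝ F)) (ε : Sec n M F A) :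
    C^∞⟮𝓡 n, M; ℝ⟯ :=
  ⟨fun x => Φ.coord k x (ε x), Φ.contMDiff_coord k ε⟩

/-- The coordinates of a section of `A^H`. -/
def CutFrame.coordFun (Φ : CutFrame n F A) (k : Fin (Module.finrank ℝ F)) (s : HSec F A g)
    (r : Aff g) : ℝ :=
  Φ.coord k r.base (s.1 r)

theorem CutFrame.isSmooth_coordFun (Φ : CutFrame n F A) (k : Fin (Module.finrank ℝ F))
    (s : HSec F A g) : Aff.IsSmooth (Φ.coordFun k s) := by
  intro i x₀
  refine (contMDiffOn_cutCoord Φ.supp (s.2 i x₀) k).contDiffOn.congr fun z hz => ?_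
  rw [Aff.loc_of_mem_dom _ hz, locSec_of_mem i x₀ s.1 z hz.2 _ rfl]
  rfl

/-- Agreement over a neighbourhood of `x`. -/
def AgreeNear (x : M) (s t : ∀ r : Aff g, A r.base) : Prop :=
  ∀ᶠ w in 𝓝 x, ∀ r : Aff g, r.base = w → s r = t r

theorem AgreeNear.eq {s t : ∀ r : Aff g, A r.base} {r : Aff g} (h : AgreeNear r.base s t) :
    s r = t r :=
  h.self_of_nhds r rfl

/-- Smoothness of sections of `A^H` is local over the base. -/
theorem mem_hSec_of_local {s : ∀ r : Aff g, A r.base}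
    (h : ∀ x, ∃ t : HSec F A g, AgreeNear x s t.1) : s ∈ HSec F A g := by
  intro i x₀ z hz
  obtain ⟨t, ht⟩ := h ((extChartAt (𝓡 n) x₀).symm z.1)
  refine (t.2 i x₀ z hz).congr_of_eventuallyEq_of_mem ?_ hz
  have hcont : ContinuousAt (fun w : Aff.Phase n => (extChartAt (𝓡 n) x₀).symm w.1) z :=
    ((continuousOn_extChartAt_symm x₀).continuousAt
      ((isOpen_extChartAt_target x₀).mem_nhds hz.1)).comp (f := Prod.fst) continuousAt_fst
  filter_upwards [nhdsWithin_le_nhds (hcont.eventually ht), self_mem_nhdsWithin] with w hw hw'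
  congr 1
  rw [locSec_of_mem i x₀ s w hw'.2 _ rfl, locSec_of_mem i x₀ t.1 w hw'.2 _ rfl]
  exact hw _ rfl

theorem hsmul_pull_apply (f : Aff g → ℝ) (hf : Aff.IsSmooth f) (ε : Sec n M F A) (r : Aff g) :
    (hsmul f hf (pull g ε)).1 r = f r • ε r.base :=
  rfl

theorem hSec_sum_apply {κ : Type*} (S : Finset κ) (s : κ → HSec F A g) (r : Aff g) :
    (∑ k ∈ S, s k).1 r = ∑ k ∈ S, (s k).1 r := by
  change ((HSec F A g).subtype (∑ k ∈ S, s k)) r = _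
  rw [map_sum, Finset.sum_apply]
  rfl

/-- The frame comes from M, so the expansion holds on entire fibres of R over a neighbourhood of
`x`. This is why locality over the base suffices below. -/
theorem CutFrame.agreeNear (Φ : CutFrame n F A) {x : M} (hΦ : Φ.IsFrameAt x) (s : HSec F A g) :
    AgreeNear x s.1
      (∑ k, hsmul (Φ.coordFun k s) (Φ.isSmooth_coordFun k s) (pull g (Φ.sec k))).1 := by
  filter_upwards [hΦ] with w hw r hr
  subst hr
  rw [hSec_sum_apply]
  exact hw (s.1 r)

/-- Additive local properties of sections of `A^H` are checked on the products of functions and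
pulled back sections. -/
theorem hSec_induction {P : HSec F A g → Prop} (x : M) (add : ∀ s t, P s → P t → P (s + t))
    (near : ∀ s t : HSec F A g, AgreeNear x s.1 t.1 → P t → P s)
    (gen : ∀ f hf (ε : Sec n M F A), P (hsmul f hf (pull g ε))) (s : HSec F A g) : P s := by
  obtain ⟨Φ, hΦ⟩ := CutFrame.exists_isFrameAt n F A x
  refine near _ _ (Φ.agreeNear hΦ s) ?_
  refine Finset.sum_induction _ P add ?_ fun k _ => gen _ _ _
  -- The empty sum: the zero section is the zero function times a pulled-back section.
  refine near _ _ ?_ (gen (fun _ => 0) (Aff.isSmooth_const 0) 0)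
  exact Filter.Eventually.of_forall fun w r _ => (zero_smul ℝ _).symm

/-- A cut-off supported where `ε₂` vanishes kills `ε₂` globally. The Leibniz rule at `x`, where the
cut-off is 1 and `ε₂` is 0, then leaves only the bracket. -/
theorem LieAlgebroid.bracket_eq_zero (L : LieAlgebroid n M F A) (ε₁ : Sec n M F A)
    {ε₂ : Sec n M F A} {x : M} (h : ∀ᶠ y in 𝓝 x, ε₂ y = 0) : L.bracket ε₁ ε₂ x = 0 := by
  obtain ⟨χ, hχ, hs⟩ := exists_cutoff (n := n) h
  have h0 : fsmul χ ε₂ = 0 := by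
    ext y
    change χ y • ε₂ y = 0
    by_cases hy : χ y = 0
    · rw [hy, zero_smul]
    · rw [show ε₂ y = 0 from hs (subset_tsupport _ hy), smul_zero]
  have h1 := L.leibniz ε₁ ε₂ χ x
  rw [h0, map_zero, hχ.self_of_nhds, one_smul, h.self_of_nhds, smul_zero, add_zero] at h1
  exact h1.symm

theorem LieAlgebroid.bracket_congr (L : LieAlgebroid n M F A) (ε₁ : Sec n M F A)
    {ε₂ ε₃ : Sec n M F A} {x : M} (h : ∀ᶠ y in 𝓝 x, ε₂ y = ε₃ y) :
    L.bracket ε₁ ε₂ x = L.bracket ε₁ ε₃ x := by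
  have h1 := L.bracket_eq_zero ε₁ (ε₂ := ε₂ - ε₃) (h.mono fun y hy => sub_eq_zero.2 hy)
  rw [map_sub] at h1
  exact sub_eq_zero.1 h1

/-- The bracket in terms of a frame. -/
theorem LieAlgebroid.bracket_eq_sum (L : LieAlgebroid n M F A) (ε₁ ε₂ : Sec n M F A)
    {Φ : CutFrame n F A} {x : M} (hΦ : Φ.IsFrameAt x) :
    L.bracket ε₁ ε₂ x = ∑ k, (Φ.coordSec k ε₂ x • L.bracket ε₁ (Φ.sec k) x +
      mvfderiv (𝓡 n) (Φ.coordSec k ε₂) x (L.anchor x (ε₁ x)) • Φ.sec k x) := by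
  have h : ∀ᶠ y in 𝓝 x, ε₂ y = (∑ k, fsmul (Φ.coordSec k ε₂) (Φ.sec k)) y := by
    filter_upwards [hΦ] with y hy
    rw [sec_sum_apply]
    exact hy (ε₂ y)
  rw [L.bracket_congr ε₁ h, map_sum, sec_sum_apply]
  exact Finset.sum_congr rfl fun k _ => L.leibniz _ _ _ _

/-- The Hamiltonian of a section. -/
def Lift.fn (h : Lift L g) (ε : Sec n M F A) (r : Aff g) : ℝ :=
  h.ham r (ε r.base)

/-- The Hamiltonian of a section of `A^H`. -/
def Lift.hfn (h : Lift L g) (s : HSec F A g) (r : Aff g) : ℝ :=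
  h.ham r (s.1 r)

theorem Lift.isSmooth_fn (h : Lift L g) (ε : Sec n M F A) : Aff.IsSmooth (h.fn ε) :=
  h.smooth ε

theorem Lift.fn_add (h : Lift L g) (ε₁ ε₂ : Sec n M F A) :
    h.fn (ε₁ + ε₂) = h.fn ε₁ + h.fn ε₂ :=
  funext fun r => map_add (h.ham r) _ _

theorem Lift.fn_smul (h : Lift L g) (t : ℝ) (ε : Sec n M F A) :
    h.fn (t • ε) = fun r => t * h.fn ε r :=
  funext fun r => map_smul (h.ham r) t _

theorem Lift.poisson_fn (h : Lift L g) (ε₁ ε₂ : Sec n M F A) :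
    Aff.poisson (h.fn ε₁) (h.fn ε₂) = h.fn (L.bracket ε₁ ε₂) :=
  funext fun r => h.bracket ε₁ ε₂ r

theorem Lift.hfn_congr (h : Lift L g) {s t : HSec F A g} {x : M} (hst : AgreeNear x s.1 t.1) :
    ∀ᶠ w in 𝓝 x, ∀ r : Aff g, r.base = w → h.hfn s r = h.hfn t r :=
  hst.mono fun _ hw r hr => congrArg (h.ham r) (hw r hr)

theorem isSmooth_sum {κ : Type*} (S : Finset κ) (f : κ → Aff g → ℝ)
    (hf : ∀ k ∈ S, Aff.IsSmooth (f k)) : Aff.IsSmooth (∑ k ∈ S, f k) :=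
  Finset.sum_induction _ _ (fun _ _ => Aff.IsSmooth.add) (Aff.isSmooth_const 0) hf

/-- A lift is assumed smooth only on sections of A; fibrewise linearity and a local frame extend
this to sections of A^H. -/
theorem Lift.isSmooth_hfn (h : Lift L g) (s : HSec F A g) : Aff.IsSmooth (h.hfn s) := by
  refine Aff.isSmooth_of_local fun x => ?_
  obtain ⟨Φ, hΦ⟩ := CutFrame.exists_isFrameAt n F A x
  refine ⟨∑ k, Φ.coordFun k s * h.fn (Φ.sec k), isSmooth_sum _ _ fun k _ =>
    (Φ.isSmooth_coordFun k s).mul (h.isSmooth_fn _), ?_⟩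
  filter_upwards [hΦ] with w hw r hr
  subst hr
  rw [Lift.hfn, hw (s.1 r), map_sum, Finset.sum_apply]
  exact Finset.sum_congr rfl fun k _ => map_smul (h.ham r) _ _

/-! ### Leibniz operators and the Hamiltonian algebroid bracket -/

/-- The Leibniz rule at a point `r`, for an operator on sections of `A^H` with values in the fibre
at `r`, over the bracket with `ε`. -/
structure IsLeibnizAt (h : Lift L g) (ε : Sec n M F A) (r : Aff g) (D : HSec F A g → A r.base) :
    Prop where
  add : ∀ s t, D (s + t) = D s + D t
  near : ∀ s t : HSec F A g, AgreeNear r.base s.1 t.1 → D s = D t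
  gen : ∀ f hf (ε' : Sec n M F A), D (hsmul f hf (pull g ε')) =
    f r • L.bracket ε ε' r.base + Aff.poisson (h.fn ε) f r • ε' r.base

/-- The rule prescribes the values on products, which suffice by `hSec_induction`. Both the
independence of the frame and the uniqueness of the bracket come from here. -/
theorem IsLeibnizAt.unique {h : Lift L g} {ε : Sec n M F A} {r : Aff g}
    {D D' : HSec F A g → A r.base} (hD : IsLeibnizAt h ε r D) (hD' : IsLeibnizAt h ε r D')
    (s : HSec F A g) : D s = D' s := by
  refine hSec_induction (P := fun s => D s = D' s) r.base (fun s t hs ht => ?_)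
    (fun s t hst ht => ?_) (fun f hf ε' => ?_) s
  · rw [hD.add, hD'.add, hs, ht]
  · rw [hD.near s t hst, hD'.near s t hst, ht]
  · rw [hD.gen, hD'.gen]

/-- The Hamiltonian algebroid bracket computed in a frame. -/
def frameBracket (h : Lift L g) (Φ : CutFrame n F A) (ε : Sec n M F A) (s : HSec F A g)
    (r : Aff g) : A r.base :=
  ∑ k, (Φ.coordFun k s r • L.bracket ε (Φ.sec k) r.base +
    Aff.poisson (h.fn ε) (Φ.coordFun k s) r • Φ.sec k r.base)

theorem coordFun_add (Φ : CutFrame n F A) (k : Fin (Module.finrank ℝ F)) (s t : HSec F A g) :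
    Φ.coordFun k (s + t) = Φ.coordFun k s + Φ.coordFun k t :=
  funext fun r => map_add (Φ.coord k r.base) _ _

theorem coordFun_smul (Φ : CutFrame n F A) (k : Fin (Module.finrank ℝ F)) (c : ℝ)
    (s : HSec F A g) : Φ.coordFun k (c • s) = fun r => c * Φ.coordFun k s r :=
  funext fun r => map_smul (Φ.coord k r.base) c _

theorem coordFun_hsmul_pull (Φ : CutFrame n F A) (k : Fin (Module.finrank ℝ F)) (f : Aff g → ℝ)
    (hf : Aff.IsSmooth f) (ε : Sec n M F A) :
    Φ.coordFun k (hsmul f hf (pull g ε)) = f * fun r => Φ.coordSec k ε r.base :=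
  funext fun r => map_smul (Φ.coord k r.base) _ _

/-- The coordinates of f·π*ε' are `f` times those of `ε'`. The product rule, the anchor condition
applied to the latter, and `bracket_eq_sum` reassemble the bracket of `ε` and `ε'`. -/
theorem isLeibnizAt_frameBracket (h : Lift L g) (Φ : CutFrame n F A) (ε : Sec n M F A) {r : Aff g}
    (hΦ : Φ.IsFrameAt r.base) : IsLeibnizAt h ε r fun s => frameBracket h Φ ε s r where
  add s t := by
    simp only [frameBracket, coordFun_add]
    rw [← Finset.sum_add_distrib]
    refine Finset.sum_congr rfl fun k _ => ?_
    rw [Aff.poisson_add_right (Φ.isSmooth_coordFun k s) (Φ.isSmooth_coordFun k t), Pi.add_apply]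
    module
  near s t hst := by
    have hc : ∀ k, ∀ᶠ w in 𝓝 r.base, ∀ r : Aff g, r.base = w →
        Φ.coordFun k s r = Φ.coordFun k t r := fun k =>
      hst.mono fun w hw r hr => congrArg (Φ.coord k r.base) (hw r hr)
    refine Finset.sum_congr rfl fun k _ => ?_
    rw [Aff.poisson_congr (Filter.Eventually.of_forall fun _ _ _ => rfl) (hc k),
      (hc k).self_of_nhds r rfl]
  gen f hf ε' := by
    have he : ε' r.base = ∑ k, Φ.coordSec k ε' r.base • Φ.sec k r.base :=
      hΦ.self_of_nhds (ε' r.base)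
    rw [L.bracket_eq_sum ε ε' hΦ]
    conv_rhs => enter [2, 2]; rw [he]
    rw [Finset.smul_sum, Finset.smul_sum, ← Finset.sum_add_distrib]
    refine Finset.sum_congr rfl fun k _ => ?_
    have ha : Aff.poisson (h.fn ε) (fun r => Φ.coordSec k ε' r.base) r =
        mvfderiv (𝓡 n) (Φ.coordSec k ε') r.base (L.anchor r.base (ε r.base)) :=
      h.anchor ε (Φ.coordSec k ε') r
    rw [coordFun_hsmul_pull, Aff.poisson_mul_right hf
      (Aff.isSmooth_comp_base (Φ.coordSec k ε').contMDiff), ha, Pi.mul_apply]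
    module

theorem frameBracket_mem (h : Lift L g) (Φ : CutFrame n F A) (ε : Sec n M F A) (s : HSec F A g) :
    frameBracket h Φ ε s ∈ HSec F A g := by
  have : frameBracket h Φ ε s = (∑ k, (hsmul (Φ.coordFun k s) (Φ.isSmooth_coordFun k s)
      (pull g (L.bracket ε (Φ.sec k))) + hsmul (Aff.poisson (h.fn ε) (Φ.coordFun k s))
        ((h.isSmooth_fn ε).poisson (Φ.isSmooth_coordFun k s)) (pull g (Φ.sec k)))).1 := by
    funext r
    rw [hSec_sum_apply]
    rfl
  rw [this]
  exact Subtype.property _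

variable (n F A) in
/-- A chosen frame around every point. -/
def frameAt (x : M) : CutFrame n F A :=
  (CutFrame.exists_isFrameAt n F A x).choose

theorem isFrameAt_frameAt (x : M) : (frameAt n F A x).IsFrameAt x :=
  (CutFrame.exists_isFrameAt n F A x).choose_spec

/-- The chosen frame varies with the point without any continuity. Near `x`, however, the frame
chosen at `x` is still a frame, so by uniqueness the values are those computed in this one fixed
frame. -/
theorem frameBracket_frameAt_mem (h : Lift L g) (ε : Sec n M F A) (s : HSec F A g) :
    (fun r => frameBracket h (frameAt n F A r.base) ε s r) ∈ HSec F A g := by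
  refine mem_hSec_of_local fun x => ⟨⟨_, frameBracket_mem h (frameAt n F A x) ε s⟩, ?_⟩
  have h1 : ∀ᶠ y in 𝓝 x, (frameAt n F A x).IsFrameAt y :=
    eventually_eventually_nhds.2 (isFrameAt_frameAt x)
  filter_upwards [h1] with y hy r hr
  subst hr
  exact (isLeibnizAt_frameBracket h _ ε (isFrameAt_frameAt r.base)).unique
    (isLeibnizAt_frameBracket h _ ε hy) s

theorem frameBracket_add_left (h : Lift L g) (Φ : CutFrame n F A) (ε₁ ε₂ : Sec n M F A)
    (s : HSec F A g) (r : Aff g) : frameBracket h Φ (ε₁ + ε₂) s r =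
      frameBracket h Φ ε₁ s r + frameBracket h Φ ε₂ s r := by
  simp only [frameBracket]
  rw [← Finset.sum_add_distrib]
  refine Finset.sum_congr rfl fun k _ => ?_
  have h1 : L.bracket (ε₁ + ε₂) (Φ.sec k) r.base =
      L.bracket ε₁ (Φ.sec k) r.base + L.bracket ε₂ (Φ.sec k) r.base := by
    rw [map_add]
    rfl
  rw [h.fn_add, Aff.poisson_add_left (h.isSmooth_fn ε₁) (h.isSmooth_fn ε₂), h1]
  module

theorem frameBracket_smul_left (h : Lift L g) (Φ : CutFrame n F A) (c : ℝ) (ε : Sec n M F A)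
    (s : HSec F A g) (r : Aff g) :
    frameBracket h Φ (c • ε) s r = c • frameBracket h Φ ε s r := by
  simp only [frameBracket]
  rw [Finset.smul_sum]
  refine Finset.sum_congr rfl fun k _ => ?_
  have h1 : L.bracket (c • ε) (Φ.sec k) r.base = c • L.bracket ε (Φ.sec k) r.base := by
    rw [map_smul]
    rfl
  rw [h.fn_smul, Aff.poisson_swap, Aff.poisson_const_mul_right (h.isSmooth_fn ε),
    Aff.poisson_swap, h1]
  module

theorem frameBracket_smul_right (h : Lift L g) (Φ : CutFrame n F A) (c : ℝ) (ε : Sec n M F A)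
    (s : HSec F A g) (r : Aff g) :
    frameBracket h Φ ε (c • s) r = c • frameBracket h Φ ε s r := by
  simp only [frameBracket]
  rw [Finset.smul_sum]
  refine Finset.sum_congr rfl fun k _ => ?_
  rw [coordFun_smul, Aff.poisson_const_mul_right (Φ.isSmooth_coordFun k s)]
  module

/-- The bracket of the Hamiltonian algebroid of a lift. -/
def hamBracket (h : Lift L g) : Sec n M F A →ₗ[ℝ] HSec F A g →ₗ[ℝ] HSec F A g :=
  LinearMap.mk₂ ℝ (fun ε s => ⟨_, frameBracket_frameAt_mem h ε s⟩)
    (fun ε₁ ε₂ s => Subtype.ext (funext fun r => frameBracket_add_left h _ ε₁ ε₂ s r))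
    (fun c ε s => Subtype.ext (funext fun r => frameBracket_smul_left h _ c ε s r))
    (fun ε s t => Subtype.ext (funext fun r =>
      (isLeibnizAt_frameBracket h _ ε (isFrameAt_frameAt r.base)).add s t))
    (fun c ε s => Subtype.ext (funext fun r => frameBracket_smul_right h _ c ε s r))

theorem isLeibnizAt_hamBracket (h : Lift L g) (ε : Sec n M F A) (r : Aff g) :
    IsLeibnizAt h ε r fun s => (hamBracket h ε s).1 r :=
  isLeibnizAt_frameBracket h _ ε (isFrameAt_frameAt r.base)

theorem agreeNear_hamBracket (h : Lift L g) (ε : Sec n M F A) {s t : HSec F A g} {x : M}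
    (hst : AgreeNear x s.1 t.1) : AgreeNear x (hamBracket h ε s).1 (hamBracket h ε t).1 := by
  filter_upwards [eventually_eventually_nhds.2 hst] with y hy r hr
  subst hr
  exact (isLeibnizAt_hamBracket h ε r).near s t hy

theorem hamBracket_pull (h : Lift L g) (ε₁ ε₂ : Sec n M F A) :
    hamBracket h ε₁ (pull g ε₂) = pull g (L.bracket ε₁ ε₂) := by
  refine Subtype.ext (funext fun r => ?_)
  -- The factor 1 brings the pulled-back section into product form; its Poisson bracket with any
  -- function is zero.
  have h1 : pull g ε₂ = hsmul (fun _ => 1) (Aff.isSmooth_const 1) (pull g ε₂) :=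
    Subtype.ext (funext fun r => (one_smul ℝ _).symm)
  rw [h1]
  refine ((isLeibnizAt_hamBracket h ε₁ r).gen _ _ ε₂).trans ?_
  rw [Aff.poisson_const_right, zero_smul, add_zero, one_smul]
  rfl

/-- The rule in `IsLeibnizAt` concerns pulled-back sections only. For s = k·π*ε' it is applied to
the function f·k, and the product rule of the Poisson bracket separates the factors. -/
theorem hamBracket_leibniz (h : Lift L g) (ε : Sec n M F A) (f : Aff g → ℝ)
    (hf : Aff.IsSmooth f) (s : HSec F A g) (r : Aff g) :
    (hamBracket h ε (hsmul f hf s)).1 r =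
      f r • (hamBracket h ε s).1 r + Aff.poisson (h.fn ε) f r • s.1 r := by
  have hB := isLeibnizAt_hamBracket h ε r
  refine hSec_induction (P := fun s => (hamBracket h ε (hsmul f hf s)).1 r =
      f r • (hamBracket h ε s).1 r + Aff.poisson (h.fn ε) f r • s.1 r)
    r.base (fun s t hs ht => ?_) (fun s t hst ht => ?_) (fun k hk ε' => ?_) s
  · have h1 : hsmul f hf (s + t) = hsmul f hf s + hsmul f hf t :=
      Subtype.ext (funext fun r => smul_add _ _ _)
    have h2 : (s + t).1 r = s.1 r + t.1 r := rfl
    rw [h1, hB.add, hB.add, hs, ht, h2]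
    module
  · have h1 : AgreeNear r.base (hsmul f hf s).1 (hsmul f hf t).1 :=
      hst.mono fun w hw r hr => congrArg (f r • ·) (hw r hr)
    rw [hB.near _ _ h1, hB.near _ _ hst, ht, hst.eq]
  · have h1 : hsmul f hf (hsmul k hk (pull g ε')) = hsmul (f * k) (hf.mul hk) (pull g ε') :=
      Subtype.ext (funext fun r => smul_smul _ _ _)
    rw [h1, hB.gen, hB.gen, Aff.poisson_mul_right hf hk, hsmul_pull_apply, Pi.mul_apply]
    module

/-- On products this is {h_ε, k h_ε'} = k {h_ε, h_ε'} + {h_ε, k} h_ε' combined with the bracket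
condition of the lift. -/
theorem hamBracket_ham (h : Lift L g) (ε : Sec n M F A) (s : HSec F A g) (r : Aff g) :
    Aff.poisson (h.fn ε) (h.hfn s) r = h.ham r ((hamBracket h ε s).1 r) := by
  have hB := isLeibnizAt_hamBracket h ε r
  refine hSec_induction (P := fun s =>
      Aff.poisson (h.fn ε) (h.hfn s) r = h.ham r ((hamBracket h ε s).1 r))
    r.base (fun s t hs ht => ?_) (fun s t hst ht => ?_) (fun k hk ε' => ?_) s
  · have h1 : h.hfn (s + t) = h.hfn s + h.hfn t := funext fun r => map_add (h.ham r) _ _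
    rw [h1, Aff.poisson_add_right (h.isSmooth_hfn s) (h.isSmooth_hfn t), hs, ht, hB.add, map_add]
  · rw [Aff.poisson_congr (Filter.Eventually.of_forall fun _ _ _ => rfl) (h.hfn_congr hst), ht,
      hB.near _ _ hst]
  · have h1 : h.hfn (hsmul k hk (pull g ε')) = k * h.fn ε' :=
      funext fun r => map_smul (h.ham r) _ _
    rw [h1, Aff.poisson_mul_right hk (h.isSmooth_fn ε'), hB.gen, map_add, map_smul, map_smul,
      h.poisson_fn, smul_eq_mul, smul_eq_mul, mul_comm (Aff.poisson _ _ _)]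
    rfl

theorem hamBracket_hsmul_pull (h : Lift L g) (ε : Sec n M F A) (f : Aff g → ℝ)
    (hf : Aff.IsSmooth f) (ε' : Sec n M F A) :
    hamBracket h ε (hsmul f hf (pull g ε')) = hsmul f hf (pull g (L.bracket ε ε')) +
      hsmul (Aff.poisson (h.fn ε) f) ((h.isSmooth_fn ε).poisson hf) (pull g ε') :=
  Subtype.ext (funext fun r => (isLeibnizAt_hamBracket h ε r).gen f hf ε')

/-- On k·π*ε' the terms with `k` undifferentiated match by the Jacobi identity of A. Those with `k`
bracketed twice match by that of the Poisson bracket, since the Hamiltonians represent the bracket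
of A. The mixed terms are the same on both sides. -/
theorem hamBracket_jacobi (h : Lift L g) (ε₁ ε₂ : Sec n M F A) (s : HSec F A g) :
    hamBracket h ε₁ (hamBracket h ε₂ s) =
      hamBracket h (L.bracket ε₁ ε₂) s + hamBracket h ε₂ (hamBracket h ε₁ s) := by
  refine Subtype.ext (funext fun r => ?_)
  have hB := fun ε => isLeibnizAt_hamBracket h ε r
  refine hSec_induction (P := fun s => (hamBracket h ε₁ (hamBracket h ε₂ s)).1 r =
      (hamBracket h (L.bracket ε₁ ε₂) s).1 r + (hamBracket h ε₂ (hamBracket h ε₁ s)).1 r)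
    r.base (fun s t hs ht => ?_) (fun s t hst ht => ?_) (fun k hk ε' => ?_) s
  · rw [map_add, map_add, map_add, map_add, map_add]
    refine (congrArg₂ (· + ·) hs ht).trans ?_
    exact add_add_add_comm _ _ _ _
  · rw [(hB ε₁).near _ _ (agreeNear_hamBracket h ε₂ hst),
      (hB ε₂).near _ _ (agreeNear_hamBracket h ε₁ hst), (hB _).near _ _ hst, ht]
  · rw [(hB _).gen, hamBracket_hsmul_pull, hamBracket_hsmul_pull, (hB _).add, (hB _).add,
      (hB _).gen, (hB _).gen, (hB _).gen, (hB _).gen]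
    have h1 := Aff.poisson_jacobi (h.isSmooth_fn ε₁) (h.isSmooth_fn ε₂) hk r
    rw [h.poisson_fn] at h1
    have h2 : L.bracket ε₁ (L.bracket ε₂ ε') r.base =
        L.bracket (L.bracket ε₁ ε₂) ε' r.base + L.bracket ε₂ (L.bracket ε₁ ε') r.base := by
      rw [L.jacobi]
      rfl
    rw [h1, h2]
    module

theorem isHamiltonianAlgebroid_hamBracket (h : Lift L g) :
    IsHamiltonianAlgebroid h (hamBracket h) where
  pull := hamBracket_pull h
  ham := hamBracket_ham h
  leibniz := hamBracket_leibniz h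
  jacobi := hamBracket_jacobi h

/-- Locality is not an axiom but follows from the Leibniz rule and a cut-off, as it does for A. Any
Hamiltonian algebroid bracket thus falls under `IsLeibnizAt.unique`. -/
theorem IsHamiltonianAlgebroid.isLeibnizAt {h : Lift L g}
    {B : Sec n M F A →ₗ[ℝ] HSec F A g →ₗ[ℝ] HSec F A g} (hB : IsHamiltonianAlgebroid h B)
    (ε : Sec n M F A) (r : Aff g) : IsLeibnizAt h ε r fun s => (B ε s).1 r where
  add s t := by
    rw [map_add]
    rfl
  near s t hst := by
    obtain ⟨χ, hχ, hs⟩ := exists_cutoff (n := n) hst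
    have h0 : hsmul (fun r => χ r.base) (Aff.isSmooth_comp_base χ.contMDiff) (s - t) = 0 := by
      refine Subtype.ext (funext fun r => ?_)
      change χ r.base • (s.1 r - t.1 r) = 0
      by_cases hr : χ r.base = 0
      · rw [hr, zero_smul]
      · have hst' : s.1 r = t.1 r := hs (subset_tsupport _ hr) r rfl
        rw [hst', sub_self, smul_zero]
    have h1 := hB.leibniz ε _ (Aff.isSmooth_comp_base χ.contMDiff) (s - t) r
    have h2 : (s - t).1 r = 0 := sub_eq_zero.2 hst.eq
    rw [h0, hχ.self_of_nhds, one_smul, h2, smul_zero, add_zero, map_zero, map_sub] at h1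
    exact (sub_eq_zero.1 h1.symm)
  gen f hf ε' := by
    rw [hB.leibniz, hB.pull]
    rfl

theorem existsUnique_isHamiltonianAlgebroid (h : Lift L g) :
    ∃! B, IsHamiltonianAlgebroid h B :=
  ⟨hamBracket h, isHamiltonianAlgebroid_hamBracket h, fun _ hB =>
    LinearMap.ext fun ε => LinearMap.ext fun s => Subtype.ext (funext fun r =>
      (hB.isLeibnizAt ε r).unique (isLeibnizAt_hamBracket h ε r) s)⟩

end PullBackSections

end HamAlg

end

/-! ### The theorem -/

theorem lemma2p1 {n : ℕ} {M : Type*} [TopologicalSpace M] [T2Space M] [SigmaCompactSpace M]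
    [ChartedSpace (EuclideanSpace ℝ (Fin n)) M] [IsManifold (𝓡 n) ∞ M]
    {F : Type*} [NormedAddCommGroup F] [NormedSpace ℝ F] [FiniteDimensional ℝ F]
    {A : M → Type*} [TopologicalSpace (TotalSpace F A)] [∀ x, TopologicalSpace (A x)]
    [FiberBundle F A] [∀ x, AddCommGroup (A x)] [∀ x, Module ℝ (A x)] [VectorBundle ℝ F A]
    [ContMDiffVectorBundle ∞ F A (𝓡 n)]
    (L : HamAlg.LieAlgebroid n M F A) {ι : Type*} (𝒰 : HamAlg.OpenCover M ι) :
    -- the anchor action lifts to every affinization `R`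
    (∀ g : HamAlg.LineCocycle n 𝒰, Nonempty (HamAlg.Lift L g)) ∧
    -- every lift defines a Hamiltonian algebroid
    (∀ (g : HamAlg.LineCocycle n 𝒰) (h : HamAlg.Lift L g),
      ∃! B, HamAlg.IsHamiltonianAlgebroid h B) ∧
    -- the Hamiltonians of a lift are `⟨p_i | δ_ε⟩ + c_i(ε)` with `(c_i, c_ij)` a one-cocycle
    (∀ (g : HamAlg.LineCocycle n 𝒰) (h : HamAlg.Lift L g),
      ∃! z : HamAlg.Z1 𝒰 L, HamAlg.Describes z h) ∧
    -- the class of this cocycle classifies the lifts up to equivalence, and all classes occur on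
    -- every `R`
    ∃ Φ : Quotient (HamAlg.LiftEquiv L 𝒰) ≃ HamAlg.H1 𝒰 L,
      (∀ (g : HamAlg.LineCocycle n 𝒰) (h : HamAlg.Lift L g) (z : HamAlg.Z1 𝒰 L),
        HamAlg.Describes z h → Φ (Quotient.mk _ ⟨g, h⟩) = QuotientAddGroup.mk z) ∧
      ∀ (g : HamAlg.LineCocycle n 𝒰) (ξ : HamAlg.H1 𝒰 L),
        ∃ h : HamAlg.Lift L g, Φ (Quotient.mk _ ⟨g, h⟩) = ξ := by
  have lift : ∀ (g : HamAlg.LineCocycle n 𝒰) (ξ : HamAlg.H1 𝒰 L),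
      ∃ h : HamAlg.Lift L g, HamAlg.liftClass L 𝒰 (Quotient.mk _ ⟨g, h⟩) = ξ := fun g ξ => by
    obtain ⟨z, rfl, hz⟩ := HamAlg.exists_representative g ξ
    exact ⟨_, HamAlg.liftClass_mk (HamAlg.describes_liftOf g z hz)⟩
  -- A lift to a given R exists because even the zero class is realized there.
  exact ⟨fun g => (lift g 0).nonempty,
    fun _ h => HamAlg.existsUnique_isHamiltonianAlgebroid h,
    fun _ h => ⟨h.cocycle, h.describes_cocycle, fun _ hz => hz.unique h.describes_cocycle⟩,
    HamAlg.liftClass L 𝒰, fun _ _ _ hz => HamAlg.liftClass_mk hz, lift⟩
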